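/- **Theorem 4 (Functional Equation).** Let $X$ be an irreducible, reduced, regular projective curve over a finite field $\mathbb F_q$, with function field $F$ and genus $g$, normalised by $g-1=-\chi(X,\mathcal O_X)$ (the usual genus when $\mathbb F_q$ is the full field of constants of $F$). Let $\widehat\zeta_X$ be its complete Artin zeta function, i.e. the meromorphic continuation to $\mathbb C$ of $q^{(g-1)s}\sum_{D\ge 0}q^{-s\deg D}$ ($D$ running over the effective divisors of $X$, $\operatorname{Re}s>1$). Let $G$ be a split connected reductive group over $F$ with a fixed Borel subgroup, and let $V$ be the complex vector space spanned by its roots, $\Phi=\Phi^+\cup\Phi^-$ the (finite, reduced, crystallographic) root system, $\Delta=\{\alpha_1,\dots,\alpha_n\}$ the simple roots, $W$ the Weyl group, $\alpha^\vee$ the coroot of $\alpha\in\Phi$, $\rho=\frac12\sum_{\alpha\in\Phi^+}\alpha$, and $\lambda_1,\dots,\lambda_n\in V$ the fundamental weights, $\langle\lambda_j,\alpha_i^\vee\rangle=\delta_{ij}$. For $w\in W$ put $\Phi_w=\Phi^+\cap w^{-1}\Phi^-$. Let $P$ be the standard maximal parabolic subgroup corresponding to $\Delta_p=\Delta\setminus\{\alpha_p\}$,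 let $\rho_p$ be half the sum of the positive roots in the span of $\Delta_p$, and put $c_p=2\langle\lambda_p-\rho_p,\alpha_p^\vee\rangle$. For $\lambda\in V$ let $$\omega_X^G(\lambda)=\sum_{w\in W}\omega_w(\lambda),\qquad \omega_w(\lambda)=\frac{1}{\prod_{\alpha\in\Delta}\bigl(1-q^{-\langle w\lambda-\rho,\alpha^\vee\rangle}\bigr)}\prod_{\alpha\in\Phi_w}\frac{\widehat\zeta_X(\langle\lambda,\alpha^\vee\rangle)}{\widehat\zeta_X(\langle\lambda,\alpha^\vee\rangle+1)},$$ and, in the coordinates $\lambda=\sum_{j}(1+s_j)\lambda_j$ and with $s=s_p$, let $\omega_X^{(G,P)}(s)$ be the iterated residue of $\omega_X^G(\lambda)$ along $s_j=0$ for all $j\ne p$, one variable after the other in a fixed order. Then $\omega_X^{(G,P)}$ is the sum of the iterated residues of the terms $\omega_w$. To the term of $w$ we attach the formal zeta factors $\widehat\zeta_X(\langle\lambda_p,\alpha^\vee\rangle s+\langle\rho,\alpha^\vee\rangle)$, $\alpha\in\Phi_w\setminus\Delta_p$, in the numerator and $\widehat\zeta_X(\langle\lambda_p,\alpha^\vee\rangle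 s+\langle\rho,\alpha^\vee\rangle+1)$, $\alpha\in\Phi_w$, in the denominator. There is a unique finite family (with multiplicities) of pairs $(a_i,b_i)$, $1\le i\le I$, with $I$ minimal, such that after formal multiplication by $\prod_{i=1}^{I}\widehat\zeta_X(a_is+b_i)$ and formal cancellation no zeta factor is left in the denominator of any $w$-term whose iterated residue is not identically zero. Put $$\widehat\zeta_X^{(G,P)}(s)=\Bigl[\prod_{i=1}^{I}\widehat\zeta_X(a_is+b_i)\Bigr]\cdot\omega_X^{(G,P)}(s).$$ This function is meromorphic on $\mathbb C$, and, as an identity of meromorphic functions, $$\widehat\zeta_X^{(G,P)}(-c_p-s)=\widehat\zeta_X^{(G,P)}(s).$$ -/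

import Mathlib

open Filter Topology
open scoped WithZero

noncomputable section

/-! ### Curves over a finite field and the complete Artin zeta function

A regular projective irreducible curve over `k` is given through its function field `F`; its closed
points are the places of `F / k`, i.e. the normalised discrete valuations of `F` trivial on `k`. -/

section Curve

variable (k F : Type*) [Field k] [Field F] [Algebra k F]

/-- `F` is an algebraic function field in one variable over `k`. -/
def IsFunctionFieldOfOneVariable : Prop :=
  ∃ x : F, Transcendental k x ∧ FiniteDimensional (IntermediateField.adjoin k {x}) F

/-- The closed points of the curve: normalised (surjective onto `ℤ ∪ {∞}`, written
multiplicatively) discrete valuations of `F` which are trivial on `k`. -/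
def CurvePoint : Type _ :=
  {v : Valuation F ℤᵐ⁰ // Function.Surjective v ∧ ∀ c : k, v (algebraMap k F c) ≤ 1}

variable {k F}

/-- The inclusion of the constants into the residue field of a closed point. -/
def CurvePoint.constHom (v : CurvePoint k F) :
    k →+* IsLocalRing.ResidueField v.1.valuationSubring :=
  (IsLocalRing.residue v.1.valuationSubring).comp
    ((algebraMap k F).codRestrict v.1.valuationSubring
      fun c => (v.1.mem_valuationSubring_iff _).2 (v.2.2 c))

/-- The degree over `k` of the residue field of a closed point. -/
def CurvePoint.degree (v : CurvePoint k F) : ℕ :=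
  letI := v.constHom.toAlgebra
  Module.finrank k (IsLocalRing.ResidueField v.1.valuationSubring)

/-- The Riemann-Roch space `L(D) = H⁰(X, O(D)) = {x | ord_v x ≥ -D(v) for all v}`. -/
def riemannRochSpace (D : CurvePoint k F →₀ ℤ) : Submodule k F where
  carrier := {x | ∀ v : CurvePoint k F, v.1 x ≤ WithZero.exp (D v)}
  zero_mem' v := by simp
  add_mem' {x y} hx hy v := (v.1.map_add x y).trans (max_le (hx v) (hy v))
  smul_mem' c x hx v := by
    rw [Algebra.smul_def, map_mul]
    exact (mul_le_of_le_one_left' (v.2.2 c)).trans (hx v)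

variable (k F)

/-- The genus, `g = max_D (deg D + 1 - dim L(D))`; equivalently `g - 1 = -χ(X, O_X)`. -/
def curveGenus : ℤ :=
  sSup (Set.range fun D : CurvePoint k F →₀ ℤ =>
    (D.sum fun v n => n * (v.degree : ℤ)) + 1 - (Module.finrank k (riemannRochSpace D) : ℤ))

/-- The Artin zeta series `∑_D (q^{deg D})^{-s}` over all effective divisors `D`, convergent for
`Re s > 1`. -/
def artinZetaSeries (s : ℂ) : ℂ :=
  ∑' D : CurvePoint k F →₀ ℕ,
    (Nat.card k : ℂ) ^ (-(((D.sum fun v n => n * v.degree : ℕ) : ℂ) * s))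

/-- `f` is the meromorphic continuation to `ℂ` of `q^{(g-1)s} ζ_X(s)`, with the value `0` at the
poles; these properties determine `f`. -/
def IsCompleteArtinZeta (f : ℂ → ℂ) : Prop :=
  MeromorphicNFOn f Set.univ ∧
    ∀ s : ℂ, 1 < s.re →
      f s = (Nat.card k : ℂ) ^ (((curveGenus k F : ℂ) - 1) * s) * artinZetaSeries k F s

open scoped Classical in
/-- The complete Artin zeta function of the curve with function field `F`. -/
def completeArtinZeta : ℂ → ℂ :=
  if h : ∃ f, IsCompleteArtinZeta k F f then h.choose else 0

end Curve

/-! ### Residues -/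

/-- The residue at `z₀` of a function meromorphic near `z₀`: the value of
`(2πi)⁻¹ ∮_{|z - z₀| = r} f` for all small `r > 0`. -/
def residue (f : ℂ → ℂ) (z₀ : ℂ) : ℂ :=
  limUnder (𝓝[>] (0 : ℝ)) fun r => (2 * Real.pi * Complex.I)⁻¹ * ∮ z in C(z₀, r), f z

open scoped Classical in
/-- The residue along `s_j = 0` of a function of several variables, as a function of the remaining
variables (it does not depend on `s_j`). -/
def residueAlong {J : Type*} (j : J) (f : (J → ℂ) → ℂ) : (J → ℂ) → ℂ :=
  fun s => residue (fun z => f (Function.update s j z)) 0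

/-- The iterated residue along `s_j = 0`, `j` in a list, the head of the list being taken first. -/
def iteratedResidue {J : Type*} : List J → ((J → ℂ) → ℂ) → ((J → ℂ) → ℂ)
  | [], f => f
  | j :: l, f => iteratedResidue l (residueAlong j f)

/-! ### Periods and zeta functions attached to a root system

`V` is the complexification of the space spanned by the roots, `N` its dual. -/

namespace RootPairing.Base

variable {ι V N : Type*} [Fintype ι] [AddCommGroup V] [Module ℂ V] [AddCommGroup N] [Module ℂ N]
  {P : RootPairing ι ℂ V N} (b : P.Base)

/-- The Weyl vector, half the sum of the positive roots. -/
def weylVector : V :=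
  open scoped Classical in (2⁻¹ : ℂ) • ∑ i with b.IsPos i, P.root i

/-- `Φ_w = Φ⁺ ∩ w⁻¹ Φ⁻`. -/
def inversions (w : P.weylGroup) : Finset ι :=
  open scoped Classical in {i | b.IsPos i ∧ ¬ b.IsPos (w • i)}

/-- Half the sum of the positive roots in the root system spanned by `Δ \ {α_p}`. -/
def leviWeylVector (p : b.support) : V :=
  open scoped Classical in
  (2⁻¹ : ℂ) • ∑ i with b.IsPos i ∧
    P.root i ∈ Submodule.span ℂ (P.root '' {j | j ∈ b.support ∧ j ≠ p}), P.root i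

variable [P.IsRootSystem]

/-- The Weyl group of a finite root system is finite. -/
theorem weylGroup_finite (P : RootPairing ι ℂ V N) [P.IsRootSystem] : Finite P.weylGroup := by
  refine Finite.of_injective (fun w : P.weylGroup => P.weylGroupToPerm w) ?_
  intro g g' h
  refine Subtype.ext (RootPairing.Equiv.weightHom_injective P (LinearEquiv.toLinearMap_injective ?_))
  refine LinearMap.ext_on_range (v := P.root) RootPairing.IsRootSystem.span_root_eq_top fun i => ?_
  have key : g • P.root i = g' • P.root i := by
    rw [P.weylGroup_apply_root, P.weylGroup_apply_root]
    exact congrArg P.root (congrArg (fun e : Equiv.Perm ι => e i) h)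
  exact key

instance weylGroupFintype (P : RootPairing ι ℂ V N) [P.IsRootSystem] : Fintype P.weylGroup :=
  have := weylGroup_finite P
  Fintype.ofFinite _

/-- The fundamental weights: `⟨λ_j, α_i^∨⟩ = δ_{ij}` for simple roots `α_i`. -/
def fundamentalWeight (j : b.support) : V :=
  P.toLinearMap.toPerfPair.symm (b.toCoweightBasis.coord j)

/-- The constant `c_p = 2 ⟨λ_p - ρ_p, α_p^∨⟩`. -/
def levelConstant (p : b.support) : ℂ :=
  2 * P.toLinearMap (b.fundamentalWeight p - b.leviWeylVector p) (P.coroot p)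

/-- The coordinates `λ = ∑_j (1 + s_j) λ_j` on `V`. -/
def weightOfCoords (s : b.support → ℂ) : V := ∑ j, (1 + s j) • b.fundamentalWeight j

/-- The term of `w` in the period of the group; `q` is the number of elements of the finite field
and `ζ` the complete Artin zeta function. -/
def periodTerm (q : ℕ) (ζ : ℂ → ℂ) (w : P.weylGroup) (lam : V) : ℂ :=
  1 / (∏ i ∈ b.support,
      (1 - (q : ℂ) ^ (-(P.toLinearMap (w • lam - b.weylVector) (P.coroot i))))) *
    ∏ i ∈ b.inversions w,
      ζ (P.toLinearMap lam (P.coroot i)) / ζ (P.toLinearMap lam (P.coroot i) + 1)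

/-- The period `ω_X^G(λ)`, the sum of the terms of all `w` in the Weyl group. -/
def period (q : ℕ) (ζ : ℂ → ℂ) (lam : V) : ℂ :=
  ∑ w : P.weylGroup, b.periodTerm q ζ w lam

/-- The contribution of `w` to the period of `(G, P)`: the iterated residue of the term of `w` along
`s_j = 0` for `j` in the list `l`, as a function of `s = s_p`. -/
def parabolicPeriodTerm (q : ℕ) (ζ : ℂ → ℂ) (p : b.support) (l : List b.support)
    (w : P.weylGroup) (s : ℂ) : ℂ :=
  open scoped Classical in
  iteratedResidue l (fun x => b.periodTerm q ζ w (b.weightOfCoords x)) (Pi.single p s)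

/-- The period of `(G, P)`: the iterated residue of the period of `G` along `s_j = 0` for `j` in the
list `l` (an enumeration of all `j ≠ p`), as a function of `s = s_p`. -/
def parabolicPeriod (q : ℕ) (ζ : ℂ → ℂ) (p : b.support) (l : List b.support) (s : ℂ) : ℂ :=
  open scoped Classical in
  iteratedResidue l (fun x => b.period q ζ (b.weightOfCoords x)) (Pi.single p s)

/-- The zeta factors `ζ(a s + b)`, recorded as pairs `(a, b)`, in the numerator of the contribution
of `w` to the period of `(G, P)`: those of the term of `w` at `λ = ρ + s λ_p`, except for the roots
in `Δ \ {α_p}`, whose factor has its pole `ζ(1)` there and is consumed by the residue. -/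
def zetaNumerators (p : b.support) (w : P.weylGroup) : Multiset (ℂ × ℂ) :=
  open scoped Classical in
  ((b.inversions w).filter fun i => ¬ (i ∈ b.support ∧ i ≠ p)).val.map fun i =>
    (P.toLinearMap (b.fundamentalWeight p) (P.coroot i), P.toLinearMap b.weylVector (P.coroot i))

/-- The zeta factors `ζ(a s + b)`, recorded as pairs `(a, b)`, in the denominator of the
contribution of `w` to the period of `(G, P)`. -/
def zetaDenominators (p : b.support) (w : P.weylGroup) : Multiset (ℂ × ℂ) :=
  (b.inversions w).val.map fun i =>
    (P.toLinearMap (b.fundamentalWeight p) (P.coroot i),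
      P.toLinearMap b.weylVector (P.coroot i) + 1)

/-- After multiplication by the zeta factors in `S`, no zeta factor is left in the denominator of
any of the (not identically vanishing) terms of the period of `(G, P)`: the zeta factors in the
denominator of a term cancel against those in `S` and in its numerator. -/
def ClearsDenominators (q : ℕ) (ζ : ℂ → ℂ) (p : b.support) (l : List b.support)
    (S : Multiset (ℂ × ℂ)) : Prop :=
  ∀ w : P.weylGroup, ¬ (b.parabolicPeriodTerm q ζ p l w =ᶠ[codiscrete ℂ] 0) →
    b.zetaDenominators p w ≤ S + b.zetaNumerators p w

/-- `S` is a family of zeta factors, of minimal number, clearing all denominators. -/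
def IsMinimalClearing (q : ℕ) (ζ : ℂ → ℂ) (p : b.support) (l : List b.support)
    (S : Multiset (ℂ × ℂ)) : Prop :=
  b.ClearsDenominators q ζ p l S ∧
    ∀ T, b.ClearsDenominators q ζ p l T → S.card ≤ T.card

/-- The zeta function `[∏_i ζ(a_i s + b_i)] · ω^{(G,P)}(s)`, where `S` lists the `(a_i, b_i)`. -/
def parabolicZeta (q : ℕ) (ζ : ℂ → ℂ) (p : b.support) (l : List b.support)
    (S : Multiset (ℂ × ℂ)) (s : ℂ) : ℂ :=
  (S.map fun ab => ζ (ab.1 * s + ab.2)).prod * b.parabolicPeriod q ζ p l s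

end RootPairing.Base

end

set_option linter.unusedSectionVars false

/-! Everything takes place at `λ = ρ + s λ_p`. Write `k = ⟨λ_p, α^∨⟩` (`corootCoeff`) and `h = ⟨ρ,
α^∨⟩` (`corootHeight`), so that `⟨λ, α^∨⟩ = k s + h`. Let `w₀` and `w_p` be the longest elements of
the Weyl groups of `G` and of the Levi subgroup. Since `w_p` fixes `λ_p`, negates `ρ_p`, and `ρ =
ρ_p + (c_p / 2) λ_p`, the substitution `s ↦ -c_p - s` is `λ ↦ -w_p λ`. The matching permutation of
the terms is `w ↦ w₀ w w_p`.

Near a generic point of this line, a term has at most a simple pole along each `s_j = 0`: it comes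
from `(1 - q^{-s_j})⁻¹` if `w α_j` is simple, from `ζ(1 + s_j)` if `w α_j` is negative, and is
absent otherwise. So the term is `∏ s_j⁻¹` times a regular function, and the iterated residue is the
value of that function (`iteratedResidue_sum_periodTerm`). The result, `explicitTerm`, is a product
of a constant, factors in powers of `q`, constant zeta values from the Levi roots, and zeta
quotients from the roots of the unipotent radical. The bijection `α ↦ -w_p⁻¹ α` matches the first
three for `w` at `-c_p - s` with those for `w₀ w w_p` at `s`. In the last one `ζ(1 - s) = ζ(s)`
inverts every quotient, while `w_p⁻¹` carries the radical roots of `Φ_w` onto the radical roots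
outside `Φ_{w₀ w w_p}`. Hence the period is multiplied by a function `radicalQuotient` that does not
depend on `w` (`sum_explicitTerm_neg_sub`).

The minimal clearing family is the supremum, over the contributing `w`, of the multisets
denominators minus numerators. The same two bijections show how its multiplicities change under the
involution of pairs `(a, b)` given by the functional equation (`count_clearingFamily_add`), and the
change compensates `radicalQuotient` exactly (`zetaProduct_clearingFamily`).

What is needed of `ζ` is collected in `IsZetaLike`. For the Artin zeta function it is derived from
Riemann-Roch, which is proved by Weil's method with adeles and differentials; over a finite field
dimensions can be computed as indices of additive groups. Counting effective divisors class by class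
turns the series into a rational function of `y = q^{-s}` that is visibly symmetric under `y ↦ (q
y)⁻¹` (`rationalZeta`). The class numbers are only used to be periodic in the degree with period the
degree of some closed point, so no divisor of degree one is needed. -/

/-! ### Identities off a discrete set; iterated residues at simple poles. -/

theorem eventually_codiscrete_iff {X : Type*} [TopologicalSpace X] {p : X → Prop} :
    (∀ᶠ x in codiscrete X, p x) ↔ ∀ x, ∀ᶠ y in 𝓝[≠] x, p y := by
  rw [Filter.Eventually, mem_codiscrete]
  simp only [disjoint_principal_right, compl_compl]
  rfl

/-- A nonconstant affine map is continuous and injective, so it maps punctured neighbourhoods into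
punctured neighbourhoods. This is what allows `s ↦ 1 - s` and `s ↦ a s + b` to be substituted in
identities of meromorphic functions. -/
theorem Filter.Eventually.comp_affine {p : ℂ → Prop} (h : ∀ᶠ s in codiscrete ℂ, p s) {a : ℂ}
    (ha : a ≠ 0) (b : ℂ) : ∀ᶠ s in codiscrete ℂ, p (a * s + b) := by
  rw [eventually_codiscrete_iff] at h ⊢
  intro x
  have hinj : Function.Injective fun s : ℂ => a * s + b := fun u v huv => by
    simpa [ha] using huv
  exact (ContinuousAt.continuousWithinAt (by fun_prop)).tendsto_nhdsWithin
    (fun y hy => hinj.ne hy) |>.eventually (h (a * x + b))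

/-- By Cauchy's integral formula the normalised integral over every circle of radius less than `R`
is already `g 0`, so the limit is that of an eventually constant function. -/
theorem residue_eq {f g : ℂ → ℂ} {R : ℝ} (hR : 0 < R)
    (hg : DifferentiableOn ℂ g (Metric.ball 0 R))
    (hf : ∀ z ∈ Metric.ball (0 : ℂ) R, z ≠ 0 → f z = z⁻¹ * g z) : residue f 0 = g 0 := by
  refine Tendsto.limUnder_eq (tendsto_const_nhds.congr' ?_)
  filter_upwards [Ioo_mem_nhdsGT hR] with r hr
  have h1 : (∮ z in C(0, r), f z) = ∮ z in C(0, r), (z - 0)⁻¹ • g z := by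
    refine circleIntegral.integral_congr hr.1.le fun z hz => ?_
    have hz' : ‖z‖ = r := by simpa using hz
    simpa using hf z (by simpa [hz'] using hr.2) (by rw [← norm_pos_iff, hz']; exact hr.1)
  rw [h1, DifferentiableOn.circleIntegral_sub_inv_smul
    (hg.mono (Metric.closedBall_subset_ball hr.2)) (Metric.mem_ball_self hr.1), smul_eq_mul,
    inv_mul_cancel_left₀ Complex.two_pi_I_ne_zero]

/-- Each residue removes one factor `(x j)⁻¹` and sets `x j = 0` in `g`. The ball for the sup norm
is a polydisc whose centre has `j`-th coordinate `0`, so changing that coordinate inside a disc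
stays in the domain and the induction keeps the same radius. -/
theorem iteratedResidue_eq {J : Type*} [Fintype J] (x₀ : J → ℂ) {ε : ℝ} (hε : 0 < ε)
    (l : List J) (hl : l.Nodup) (f g : (J → ℂ) → ℂ) (hx₀ : ∀ j ∈ l, x₀ j = 0)
    (hg : DifferentiableOn ℂ g (Metric.ball x₀ ε))
    (hf : ∀ x ∈ Metric.ball x₀ ε, (∀ j ∈ l, x j ≠ 0) →
      f x = (l.map fun j => (x j)⁻¹).prod * g x) :
    iteratedResidue l f x₀ = g x₀ := by
  classical
  induction l generalizing f g with
  | nil => simpa [iteratedResidue] using hf x₀ (Metric.mem_ball_self hε) (by simp)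
  | cons j l ih =>
    have hj : j ∉ l := (List.nodup_cons.1 hl).1
    have hj0 : x₀ j = 0 := hx₀ j (by simp)
    have hup : ∀ x ∈ Metric.ball x₀ ε, ∀ z ∈ Metric.ball (0 : ℂ) ε,
        Function.update x j z ∈ Metric.ball x₀ ε := by
      intro x hx z hz
      rw [Metric.mem_ball, dist_pi_lt_iff hε] at hx ⊢
      intro i
      rcases eq_or_ne i j with rfl | hij
      · simpa [hj0] using hz
      · simpa [hij] using hx i
    have key := ih (List.nodup_cons.1 hl).2 (residueAlong j f)
      (fun x => g (Function.update x j 0)) (fun i hi => hx₀ i (by simp [hi])) ?_ ?_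
    · rw [iteratedResidue, key, ← hj0, Function.update_eq_self]
    · refine hg.comp (Differentiable.differentiableOn ?_)
        fun x hx => hup x hx 0 (Metric.mem_ball_self hε)
      rw [differentiable_pi]
      intro i
      rcases eq_or_ne i j with rfl | hij
      · simp
      · simpa [hij] using differentiable_apply i
    · intro x hx hxl
      have : residueAlong j f x = residue (fun z => f (Function.update x j z)) 0 := by
        unfold residueAlong
        congr!
      rw [this]
      refine residue_eq
        (g := fun z => (l.map fun j => (x j)⁻¹).prod * g (Function.update x j z)) hε ?_ ?_
      · refine (differentiableOn_const _).mul
          (hg.comp (Differentiable.differentiableOn ?_) fun z hz => hup x hx z hz)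
        rw [differentiable_pi]
        intro i
        rcases eq_or_ne i j with rfl | hij
        · simp
        · simp [hij]
      · intro z hz hz0
        rw [hf _ (hup x hx z hz)]
        · have : l.map (fun i => (Function.update x j z i)⁻¹) = l.map fun i => (x i)⁻¹ :=
            List.map_congr_left fun i hi => by
              rw [Function.update_of_ne (ne_of_mem_of_not_mem hi hj)]
          rw [List.map_cons, List.prod_cons, this, Function.update_self]
          ring
        · intro i hi
          rcases List.mem_cons.1 hi with rfl | hi
          · simpa using hz0
          · rw [Function.update_of_ne (ne_of_mem_of_not_mem hi hj)]
            exact hxl i hi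

/-! ### Pairings with coroots, coroot coefficients, `ρ` and `ρ_p`. -/

namespace RootPairing

section Pairing

variable {ι V N : Type*} [AddCommGroup V] [Module ℂ V] [AddCommGroup N] [Module ℂ N]
  {P : RootPairing ι ℂ V N}

theorem weylGroup_smul_pairing (w : P.weylGroup) (x : V) (i : ι) :
    P.toLinearMap (w • x) (P.coroot (w • i)) = P.toLinearMap x (P.coroot i) := by
  have h := LinearMap.congr_fun (Hom.weight_coweight_transpose_apply P P (P.coroot (w • i))
    w.1.toHom) x
  have h2 := Hom.coroot_coweightMap_apply P P (w • i) w.1.toHom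
  rw [h2] at h
  have h3 : w.1.toHom.indexEquiv.symm (w • i) = i := w.1.toHom.indexEquiv.symm_apply_apply i
  rw [h3] at h
  exact h

theorem weylGroup_smul_pairing' (w : P.weylGroup) (x : V) (i : ι) :
    P.toLinearMap (w • x) (P.coroot i) = P.toLinearMap x (P.coroot (w⁻¹ • i)) := by
  rw [← weylGroup_smul_pairing w x (w⁻¹ • i), smul_inv_smul]

theorem root_weylGroup_smul (w : P.weylGroup) (i : ι) : P.root (w • i) = w • P.root i :=
  (P.weylGroup_apply_root w i).symm

theorem root_reflectionPerm_self_eq_neg (i : ι) : P.root (P.reflectionPerm i i) = -P.root i := by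
  simp

theorem reflectionPerm_self_self (i : ι) :
    P.reflectionPerm (P.reflectionPerm i i) (P.reflectionPerm i i) = i :=
  P.root.injective (by simp only [root_reflectionPerm_self_eq_neg, neg_neg])

theorem weylGroup_smul_reflectionPerm_self (w : P.weylGroup) (i : ι) :
    w • P.reflectionPerm i i = P.reflectionPerm (w • i) (w • i) := by
  refine P.root.injective ?_
  rw [root_weylGroup_smul, root_reflectionPerm_self_eq_neg, root_reflectionPerm_self_eq_neg,
    root_weylGroup_smul, smul_neg]

theorem ofIdx_smul_idx (j i : ι) : weylGroup.ofIdx P j • i = P.reflectionPerm j i := rfl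

theorem smul_weylGroup_ofIdx (j : ι) (x : V) :
    weylGroup.ofIdx P j • x = x - P.toLinearMap x (P.coroot j) • P.root j := by
  rw [weylGroup.ofIdx_smul, Equiv.reflection_smul, reflection_apply]
  rfl

theorem weylGroup_smul_smul (w : P.weylGroup) (c : ℂ) (x : V) : w • (c • x) = c • (w • x) :=
  smul_comm w.1 c x

theorem pairing_coroot_neg (x : V) (i : ι) :
    P.toLinearMap x (P.coroot (P.reflectionPerm i i)) = -P.toLinearMap x (P.coroot i) := by
  simp

end Pairing

namespace Base

variable {ι V N : Type*} [Fintype ι] [AddCommGroup V] [Module ℂ V] [AddCommGroup N] [Module ℂ N]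
  {P : RootPairing ι ℂ V N} (b : P.Base)

theorem isPos_neg_iff (i : ι) : b.IsPos (P.reflectionPerm i i) ↔ ¬ b.IsPos i :=
  IsPos.neg_iff_not b i

variable [P.IsRootSystem]

theorem pairing_fundamentalWeight (j : b.support) (x : N) :
    P.toLinearMap (b.fundamentalWeight j) x = b.toCoweightBasis.coord j x := by
  have : P.toLinearMap.toPerfPair (b.fundamentalWeight j) = b.toCoweightBasis.coord j := by
    simp [fundamentalWeight]
  exact LinearMap.congr_fun this x

theorem pairing_fundamentalWeight_coroot [DecidableEq b.support] (j i : b.support) :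
    P.toLinearMap (b.fundamentalWeight j) (P.coroot i) = if i = j then 1 else 0 := by
  rw [pairing_fundamentalWeight, ← b.toCoweightBasis_apply, Module.Basis.coord_apply,
    Module.Basis.repr_self, Finsupp.single_apply]

/-- A vector is determined by its pairings with the simple coroots. -/
theorem eq_of_pairing_eq {x y : V}
    (h : ∀ j : b.support, P.toLinearMap x (P.coroot j) = P.toLinearMap y (P.coroot j)) :
    x = y := by
  refine P.toLinearMap.toPerfPair.injective (b.toCoweightBasis.ext fun j => ?_)
  simpa using h j

variable [P.IsCrystallographic] [P.IsReduced]

/-- Roots are signed by `b`, but the arguments of `ζ` are expansions of coroots in simple coroots.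
Both notions of positivity hold on simple roots, change under negation, and are preserved by a
simple reflection away from its own root; induction along reflections identifies them. -/
theorem flip_isPos_iff (i : ι) : b.flip.IsPos i ↔ b.IsPos i := by
  refine b.induction_reflect i (p := fun i => b.flip.IsPos i ↔ b.IsPos i) ?_ ?_ ?_
  · intro i hi
    rw [b.isPos_neg_iff, ← hi]
    exact b.flip.isPos_neg_iff i
  · exact fun i hi => iff_of_true (isPos_of_mem_support (b := b.flip) hi) (isPos_of_mem_support hi)
  · intro i j hi hj
    by_cases hp : b.IsPos i
    · have hp' := hi.2 hp
      rcases eq_or_ne i j with rfl | hij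
      · rw [b.isPos_neg_iff, ← hi]
        exact b.flip.isPos_neg_iff i
      · exact iff_of_true (IsPos.reflectionPerm (b := b.flip) hp' hj hij)
          (hp.reflectionPerm hj hij)
    · have hp' := fun h => hp (hi.1 h)
      rw [← b.isPos_neg_iff] at hp
      have hp'' := (b.flip.isPos_neg_iff i).2 hp'
      have hn : P.reflectionPerm j (P.reflectionPerm i i) =
          P.reflectionPerm (P.reflectionPerm j i) (P.reflectionPerm j i) :=
        weylGroup_smul_reflectionPerm_self (weylGroup.ofIdx P j) i
      rcases eq_or_ne (P.reflectionPerm i i) j with hij | hij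
      · have h1 : P.reflectionPerm j i = j := by
          rw [← reflectionPerm_self_self (P := P) i, hij, P.reflectionPerm_self]
        rw [h1]
        exact iff_of_true (isPos_of_mem_support (b := b.flip) hj) (isPos_of_mem_support hj)
      · have a1 := hp.reflectionPerm hj hij
        have a2 := IsPos.reflectionPerm (b := b.flip) hp'' hj hij
        have a3 : ¬ b.IsPos (P.reflectionPerm j i) := by
          rw [← b.isPos_neg_iff, ← hn]; exact a1
        refine iff_of_false (fun h => ?_) a3
        refine (b.flip.isPos_neg_iff (P.reflectionPerm j i)).1 ?_ h
        exact hn ▸ a2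

/-- The coefficients of the coroots with respect to the simple coroots. -/
theorem exists_corootCoeff (i : ι) : ∃ m : b.support → ℤ,
    (∀ j, P.toLinearMap (b.fundamentalWeight j) (P.coroot i) = m j) ∧
    (b.IsPos i → 0 ≤ m) ∧ (¬ b.IsPos i → m ≤ 0) := by
  classical
  obtain ⟨f, -, hf1, hf2⟩ := b.flip.exists_root_eq_sum_int i
  have hf2' : P.coroot i = ∑ j ∈ b.support, f j • P.coroot j := hf2
  have hh : b.flip.height i = ∑ j ∈ b.support, f j := height_eq_sum hf2
  refine ⟨fun j => f j, fun j => ?_, fun h j => ?_, fun h j => ?_⟩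
  · rw [hf2', map_sum, ← Finset.sum_coe_sort b.support]
    simp only [map_zsmul, pairing_fundamentalWeight_coroot]
    simp
  · refine (hf1.resolve_right fun hneg => ?_).le j
    rw [← b.flip_isPos_iff, isPos_iff, hh] at h
    exact absurd h (not_lt.2 (Finset.sum_nonpos fun i _ => hneg.le i))
  · refine (hf1.resolve_left fun hneg => h ?_).le j
    rw [← b.flip_isPos_iff, isPos_iff', hh]
    exact Finset.sum_nonneg fun i _ => hneg.le i

/-- The coefficient of a coroot at a simple coroot. -/
noncomputable def corootCoeff (i : ι) (j : b.support) : ℤ := (b.exists_corootCoeff i).choose j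

theorem pairing_fundamentalWeight_eq (i : ι) (j : b.support) :
    P.toLinearMap (b.fundamentalWeight j) (P.coroot i) = b.corootCoeff i j :=
  (b.exists_corootCoeff i).choose_spec.1 j

theorem corootCoeff_nonneg {i : ι} (h : b.IsPos i) (j : b.support) : 0 ≤ b.corootCoeff i j :=
  (b.exists_corootCoeff i).choose_spec.2.1 h j

theorem corootCoeff_nonpos {i : ι} (h : ¬ b.IsPos i) (j : b.support) : b.corootCoeff i j ≤ 0 :=
  (b.exists_corootCoeff i).choose_spec.2.2 h j

theorem coroot_eq_sum (i : ι) :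
    P.coroot i = ∑ j : b.support, b.corootCoeff i j • P.coroot j := by
  rw [← b.toCoweightBasis.sum_repr (P.coroot i)]
  refine Finset.sum_congr rfl fun j _ => ?_
  rw [← Module.Basis.coord_apply, ← pairing_fundamentalWeight, pairing_fundamentalWeight_eq,
    toCoweightBasis_apply, Int.cast_smul_eq_zsmul]

theorem pairing_coroot (x : V) (i : ι) :
    P.toLinearMap x (P.coroot i) =
      ∑ j : b.support, b.corootCoeff i j * P.toLinearMap x (P.coroot j) := by
  conv_lhs => rw [b.coroot_eq_sum i]
  simp

/-- The height of the coroot of a root. -/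
noncomputable def corootHeight (i : ι) : ℤ := ∑ j, b.corootCoeff i j

theorem corootHeight_pos_iff {i : ι} : 0 < b.corootHeight i ↔ b.IsPos i := by
  constructor
  · intro h
    by_contra hi
    exact absurd h (not_lt.2 (Finset.sum_nonpos fun j _ => b.corootCoeff_nonpos hi j))
  · intro h
    refine (Finset.sum_nonneg fun j _ => b.corootCoeff_nonneg h j).lt_of_ne fun h0 => ?_
    refine P.flip.ne_zero i ?_
    change P.coroot i = 0
    rw [b.coroot_eq_sum i]
    refine Finset.sum_eq_zero fun j hj => ?_
    rw [(Finset.sum_eq_zero_iff_of_nonneg fun j _ => b.corootCoeff_nonneg h j).1 h0.symm j hj,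
      zero_smul]

theorem corootCoeff_simple (i j : b.support) [DecidableEq b.support] :
    b.corootCoeff i j = if i = j then 1 else 0 := by
  have := b.pairing_fundamentalWeight_eq i j
  rw [pairing_fundamentalWeight_coroot] at this
  split_ifs at this ⊢ <;> exact_mod_cast this.symm

theorem corootHeight_eq_one_iff {i : ι} : b.corootHeight i = 1 ↔ i ∈ b.support := by
  classical
  constructor
  · intro h
    have hi : b.IsPos i := b.corootHeight_pos_iff.1 (by lia)
    obtain ⟨j, -, hj⟩ := Finset.exists_ne_zero_of_sum_ne_zero
      (show ∑ j, b.corootCoeff i j ≠ 0 by rw [← corootHeight, h]; exact one_ne_zero)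
    have hnn := b.corootCoeff_nonneg hi
    have h1 := Finset.add_sum_erase Finset.univ (b.corootCoeff i) (Finset.mem_univ j)
    rw [← corootHeight, h] at h1
    have h2 : 0 ≤ ∑ x ∈ Finset.univ.erase j, b.corootCoeff i x :=
      Finset.sum_nonneg fun j _ => hnn j
    have hj0 := hnn j
    have hj1 : b.corootCoeff i j = 1 := by lia
    have h3 : ∑ x ∈ Finset.univ.erase j, b.corootCoeff i x = 0 := by lia
    rw [Finset.sum_eq_zero_iff_of_nonneg fun j _ => hnn j] at h3
    have : P.coroot i = P.coroot j := by
      rw [b.coroot_eq_sum i, Finset.sum_eq_single j]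
      · rw [hj1, one_smul]
      · intro x _ hx
        rw [h3 x (by simp [hx]), zero_smul]
      · simp
    rw [P.coroot.injective this]
    exact j.2
  · intro h
    rw [corootHeight, Finset.sum_congr rfl fun j _ => b.corootCoeff_simple ⟨i, h⟩ j]
    simp

theorem corootHeight_neg (i : ι) :
    b.corootHeight (P.reflectionPerm i i) = -b.corootHeight i := by
  rw [corootHeight, corootHeight, ← Finset.sum_neg_distrib]
  refine Finset.sum_congr rfl fun j _ => ?_
  have := b.pairing_fundamentalWeight_eq (P.reflectionPerm i i) j
  rw [pairing_coroot_neg, pairing_fundamentalWeight_eq] at this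
  exact_mod_cast this.symm

theorem corootCoeff_neg (i : ι) (j : b.support) :
    b.corootCoeff (P.reflectionPerm i i) j = -b.corootCoeff i j := by
  have := b.pairing_fundamentalWeight_eq (P.reflectionPerm i i) j
  rw [pairing_coroot_neg, pairing_fundamentalWeight_eq] at this
  exact_mod_cast this.symm

/-- Half the sum of a set of positive roots which is stable under the reflection in a simple root
`α` up to `α` itself pairs to `1` with the coroot of `α`. -/
theorem pairing_half_sum_coroot (s : Finset ι) (j : b.support) (hj : (j : ι) ∈ s)
    (hs : ∀ i ∈ s, b.IsPos i)
    (hstab : ∀ i ∈ s, i ≠ j → P.reflectionPerm j i ∈ s) :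
    P.toLinearMap ((2⁻¹ : ℂ) • ∑ i ∈ s, P.root i) (P.coroot j) = 1 := by
  classical
  set σ := weylGroup.ofIdx P (j : ι)
  have hperm : ∑ i ∈ s.erase j, P.root (P.reflectionPerm j i) = ∑ i ∈ s.erase j, P.root i := by
    have hmem : ∀ i ∈ s.erase j, P.reflectionPerm j i ∈ s.erase j := by
      intro i hi
      rw [Finset.mem_erase] at hi ⊢
      refine ⟨fun h => ?_, hstab i hi.2 hi.1⟩
      have h1 : i = P.reflectionPerm j j :=
        (P.reflectionPerm j).injective (h.trans (P.reflectionPerm_self j j).symm)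
      have := hs i hi.2
      rw [h1, b.isPos_neg_iff] at this
      exact this (isPos_of_mem_support j.2)
    exact Finset.sum_bij (fun i _ => P.reflectionPerm j i) hmem
      (fun a _ c _ h => (P.reflectionPerm j).injective h)
      (fun c hc => ⟨P.reflectionPerm j c, hmem c hc, by simp⟩) (fun _ _ => rfl)
  -- The reflection `σ` permutes `s \ {j}` and negates the root of `j`. Comparison with the formula
  -- `x - ⟨x, α^∨⟩ α` shows that the full sum pairs to `2`.
  have h1 : σ • ∑ i ∈ s, P.root i = ∑ i ∈ s, P.root i - (2 : ℂ) • P.root j := by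
    rw [Finset.smul_sum, ← Finset.add_sum_erase s _ hj, ← Finset.add_sum_erase s P.root hj,
      ← hperm]
    have : ∀ i, σ • P.root i = P.root (P.reflectionPerm j i) := fun i =>
      (root_weylGroup_smul σ i).symm
    simp only [this]
    have h2 : P.root (P.reflectionPerm j j) = -P.root j := by simp
    rw [h2]
    module
  rw [smul_weylGroup_ofIdx] at h1
  have h3 : P.toLinearMap (∑ i ∈ s, P.root i) (P.coroot j) • P.root j = (2 : ℂ) • P.root j := by
    have := sub_right_injective h1
    exact this
  have h4 := smul_left_injective ℂ (P.ne_zero (j : ι)) h3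
  rw [map_smul, LinearMap.smul_apply, h4]
  simp

theorem pairing_weylVector_simple (j : b.support) :
    P.toLinearMap b.weylVector (P.coroot j) = 1 := by
  classical
  unfold weylVector
  refine b.pairing_half_sum_coroot _ j ?_ ?_ ?_
  · simpa using isPos_of_mem_support j.2
  · simp
  · intro i hi hij
    simp only [Finset.mem_filter, Finset.mem_univ, true_and] at hi ⊢
    exact hi.reflectionPerm j.2 hij

theorem pairing_weylVector (i : ι) :
    P.toLinearMap b.weylVector (P.coroot i) = b.corootHeight i := by
  rw [b.pairing_coroot]
  simp [pairing_weylVector_simple, corootHeight]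

/-- The span condition concerns the coefficient of the root at `α_p`, the right side that of the
coroot. The polarization of the root form sends every root to a nonzero multiple of its coroot, so
the two coefficients agree up to nonzero factors. -/
theorem root_mem_span_iff (p : b.support) (i : ι) :
    P.root i ∈ Submodule.span ℂ (P.root '' {j | j ∈ b.support ∧ j ≠ p}) ↔
      b.corootCoeff i p = 0 := by
  classical
  have hker : ∀ v : V, v ∈ Submodule.span ℂ (P.root '' {j | j ∈ b.support ∧ j ≠ p}) ↔
      b.toWeightBasis.repr v p = 0 := by
    intro v
    constructor
    · intro hv
      refine Submodule.span_induction ?_ ?_ ?_ ?_ hv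
      · rintro _ ⟨j, ⟨hj, hjp⟩, rfl⟩
        have := b.toWeightBasis_repr_root ⟨j, hj⟩
        simp only at this
        rw [this, Finsupp.single_apply, if_neg]
        exact fun h => hjp (congrArg Subtype.val h)
      · simp
      · intro x y _ _ hx hy; simp [hx, hy]
      · intro a x _ hx; simp [hx]
    · intro hv
      rw [← b.toWeightBasis.sum_repr v]
      refine Submodule.sum_mem _ fun j _ => ?_
      rcases eq_or_ne j p with rfl | hjp
      · simp [hv]
      · refine Submodule.smul_mem _ _ (Submodule.subset_span ⟨j, ⟨j.2, ?_⟩, by simp⟩)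
        exact fun h => hjp (Subtype.ext h)
  have hpol : ∀ j, P.Polarization (P.root j) =
      (2⁻¹ * P.RootForm (P.root j) (P.root j)) • P.coroot j := by
    intro j
    rw [mul_smul, P.rootForm_self_smul_coroot j]
    module
  have hne : ∀ j, P.RootForm (P.root j) (P.root j) ≠ 0 := fun j => by
    have := P.isAnisotropic_of_isValuedIn ℤ
    exact IsAnisotropic.rootForm_root_ne_zero j
  rw [hker]
  have h1 : b.toCoweightBasis.coord p (P.Polarization (P.root i)) =
      2⁻¹ * P.RootForm (P.root i) (P.root i) * b.corootCoeff i p := by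
    rw [hpol, map_smul, smul_eq_mul, ← pairing_fundamentalWeight, pairing_fundamentalWeight_eq]
  have h2 : b.toCoweightBasis.coord p (P.Polarization (P.root i)) =
      b.toWeightBasis.repr (P.root i) p * (2⁻¹ * P.RootForm (P.root p) (P.root p)) := by
    conv_lhs => rw [← b.toWeightBasis.sum_repr (P.root i)]
    rw [map_sum, map_sum, Finset.sum_eq_single p]
    · rw [map_smul, map_smul, toWeightBasis_apply, hpol, map_smul, ← pairing_fundamentalWeight,
        pairing_fundamentalWeight_coroot]
      simp
    · intro j _ hj
      rw [map_smul, map_smul, toWeightBasis_apply, hpol, map_smul, ← pairing_fundamentalWeight,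
        pairing_fundamentalWeight_coroot, if_neg hj]
      simp
    · simp
  rw [h1] at h2
  constructor
  · intro h
    rw [h, zero_mul] at h2
    simpa [hne] using h2
  · intro h
    rw [h] at h2
    simpa [hne] using h2.symm

theorem corootCoeff_reflectionPerm {p j : b.support} (hj : j ≠ p) (i : ι) :
    b.corootCoeff (P.reflectionPerm j i) p = b.corootCoeff i p := by
  classical
  have h := weylGroup_smul_pairing (weylGroup.ofIdx P (j : ι)) (b.fundamentalWeight p) i
  rw [smul_weylGroup_ofIdx, pairing_fundamentalWeight_coroot, if_neg hj, zero_smul, sub_zero,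
    ofIdx_smul_idx, pairing_fundamentalWeight_eq, pairing_fundamentalWeight_eq] at h
  exact_mod_cast h

theorem pairing_leviWeylVector_simple {p j : b.support} (hj : j ≠ p) :
    P.toLinearMap (b.leviWeylVector p) (P.coroot j) = 1 := by
  classical
  unfold leviWeylVector
  refine b.pairing_half_sum_coroot _ j ?_ ?_ ?_
  · simp only [Finset.mem_filter, Finset.mem_univ, true_and]
    refine ⟨isPos_of_mem_support j.2, ?_⟩
    rw [root_mem_span_iff, corootCoeff_simple, if_neg hj]
  · intro i hi
    simp only [Finset.mem_filter, Finset.mem_univ, true_and] at hi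
    exact hi.1
  · intro i hi hij
    simp only [Finset.mem_filter, Finset.mem_univ, true_and, root_mem_span_iff] at hi ⊢
    exact ⟨hi.1.reflectionPerm j.2 hij, by rw [b.corootCoeff_reflectionPerm hj]; exact hi.2⟩

/-- Both vectors pair to `1` with the simple coroots other than that of `α_p`, so the difference is
a multiple of `λ_p`; the multiple is read off at `α_p`. -/
theorem weylVector_sub_leviWeylVector (p : b.support) :
    b.weylVector - b.leviWeylVector p = (b.levelConstant p / 2) • b.fundamentalWeight p := by
  classical
  refine b.eq_of_pairing_eq fun j => ?_
  rcases eq_or_ne j p with rfl | hj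
  · simp [levelConstant, pairing_weylVector_simple, pairing_fundamentalWeight_coroot]
  · simp [pairing_leviWeylVector_simple _ hj, pairing_weylVector_simple,
      pairing_fundamentalWeight_coroot, hj]

end Base
end RootPairing

/-! ### Inversions, and the longest elements of the Weyl group and of its Levi subgroup. -/

namespace RootPairing.Base

variable {ι V N : Type*} [Fintype ι] [AddCommGroup V] [Module ℂ V] [AddCommGroup N] [Module ℂ N]
  {P : RootPairing ι ℂ V N} (b : P.Base)

theorem mem_inversions {w : P.weylGroup} {i : ι} :
    i ∈ b.inversions w ↔ b.IsPos i ∧ ¬ b.IsPos (w • i) := by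
  classical
  simp [inversions]

variable [P.IsRootSystem] [P.IsCrystallographic] [P.IsReduced]

/-- The reflection in `j` injects `Φ_w` into the inversions of `w s_j` and misses `j`, which is a
new inversion. -/
theorem card_inversions_lt {w : P.weylGroup} {j : ι} (hj : j ∈ b.support) (hw : b.IsPos (w • j)) :
    (b.inversions w).card < (b.inversions (w * weylGroup.ofIdx P j)).card := by
  classical
  have hjp := isPos_of_mem_support hj
  have hsub : (b.inversions w).image (P.reflectionPerm j) ⊆
      (b.inversions (w * weylGroup.ofIdx P j)).erase j := by
    intro i hi
    obtain ⟨a, ha, rfl⟩ := Finset.mem_image.1 hi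
    rw [mem_inversions] at ha
    have haj : a ≠ j := by rintro rfl; exact ha.2 hw
    rw [Finset.mem_erase, mem_inversions]
    refine ⟨fun h => ?_, ha.1.reflectionPerm hj haj, ?_⟩
    · have h1 : a = P.reflectionPerm j j :=
        (P.reflectionPerm j).injective (h.trans (P.reflectionPerm_self j j).symm)
      rw [h1, b.isPos_neg_iff] at ha
      exact ha.1 hjp
    · rw [mul_smul, ofIdx_smul_idx, P.reflectionPerm_self]
      exact ha.2
  have hmem : j ∈ b.inversions (w * weylGroup.ofIdx P j) := by
    rw [mem_inversions, mul_smul, ofIdx_smul_idx, weylGroup_smul_reflectionPerm_self,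
      isPos_neg_iff, not_not]
    exact ⟨hjp, hw⟩
  have := Finset.card_le_card hsub
  rw [Finset.card_image_of_injective _ (P.reflectionPerm j).injective] at this
  exact this.trans_lt (Finset.card_erase_lt_of_mem hmem)

/-- An element of the parabolic subgroup with the greatest number of inversions will do: if it kept
some `j ∈ J` positive, multiplication by the reflection in `j` would give more inversions. Taking
`J` to be all simple roots yields `w₀`, and `J = Δ \ {α_p}` yields `w_p`. -/
theorem exists_mem_closure_forall_not_isPos (J : Set ι) (hJ : J ⊆ b.support) :
    ∃ w ∈ Subgroup.closure (weylGroup.ofIdx P '' J), ∀ j ∈ J, ¬ b.IsPos (w • j) := by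
  classical
  obtain ⟨w, hw, hmax⟩ := Set.exists_max_image
    (Subgroup.closure (weylGroup.ofIdx P '' J) : Set P.weylGroup)
    (fun w => (b.inversions w).card) (Set.toFinite _) ⟨1, one_mem _⟩
  refine ⟨w, hw, fun j hj hpos => ?_⟩
  exact absurd (hmax _ (mul_mem hw (Subgroup.subset_closure ⟨j, hj, rfl⟩)))
    (not_le.2 (b.card_inversions_lt (hJ hj) hpos))

theorem corootHeight_smul (w : P.weylGroup) (i : ι) :
    b.corootHeight (w • i) = ∑ j : b.support, b.corootCoeff i j * b.corootHeight (w • (j : ι)) := by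
  have h : ∀ i, (b.corootHeight (w • i) : ℂ) = P.toLinearMap (w⁻¹ • b.weylVector) (P.coroot i) := by
    intro i
    rw [weylGroup_smul_pairing', inv_inv, pairing_weylVector]
  have h2 := b.pairing_coroot (w⁻¹ • b.weylVector) i
  simp only [← h] at h2
  exact_mod_cast h2

theorem not_isPos_smul {J : Set ι} {w : P.weylGroup} (hw : ∀ j ∈ J, ¬ b.IsPos (w • j)) {i : ι}
    (hi : b.IsPos i) (hiJ : ∀ j : b.support, (j : ι) ∉ J → b.corootCoeff i j = 0) :
    ¬ b.IsPos (w • i) := by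
  rw [← corootHeight_pos_iff, corootHeight_smul, not_lt]
  refine Finset.sum_nonpos fun j _ => ?_
  by_cases hj : (j : ι) ∈ J
  · refine mul_nonpos_of_nonneg_of_nonpos (b.corootCoeff_nonneg hi j) ?_
    rw [← not_lt, corootHeight_pos_iff]
    exact hw j hj
  · rw [hiJ j hj, zero_mul]

/-- The injection `α ↦ -w α` maps the finite set `s` into itself, hence permutes it. -/
theorem smul_sum_root_eq_neg {w : P.weylGroup} {s : Finset ι}
    (h : ∀ i ∈ s, P.reflectionPerm (w • i) (w • i) ∈ s) :
    w • ∑ i ∈ s, P.root i = -∑ i ∈ s, P.root i := by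
  classical
  have hinj : Function.Injective fun i : ι => P.reflectionPerm (w • i) (w • i) := fun i j hij => by
    have := congrArg P.root hij
    rw [root_reflectionPerm_self_eq_neg, root_reflectionPerm_self_eq_neg, neg_inj] at this
    exact MulAction.injective w (P.root.injective this)
  have himg : s.image (fun i => P.reflectionPerm (w • i) (w • i)) = s :=
    Finset.eq_of_subset_of_card_le (Finset.image_subset_iff.2 h)
      (Finset.card_image_of_injective s hinj).ge
  conv_rhs => rw [← himg]
  rw [Finset.sum_image hinj.injOn, Finset.smul_sum, ← Finset.sum_neg_distrib]
  refine Finset.sum_congr rfl fun i _ => ?_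
  rw [root_reflectionPerm_self_eq_neg, neg_neg, root_weylGroup_smul]

/-- The longest element makes every positive root negative, so it sends `ρ` to `-ρ`; the height is
the pairing with `ρ`. -/
theorem exists_corootHeight_smul_eq_neg :
    ∃ w : P.weylGroup, ∀ i, b.corootHeight (w • i) = -b.corootHeight i := by
  classical
  obtain ⟨w, -, hw⟩ := b.exists_mem_closure_forall_not_isPos b.support subset_rfl
  have hρ : w • b.weylVector = -b.weylVector := by
    unfold weylVector
    rw [weylGroup_smul_smul, smul_sum_root_eq_neg, smul_neg]
    intro i hi
    simp only [Finset.mem_filter, Finset.mem_univ, true_and] at hi ⊢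
    rw [isPos_neg_iff]
    exact b.not_isPos_smul hw hi fun j hj => absurd j.2 hj
  refine ⟨w, fun i => ?_⟩
  have h1 := b.pairing_weylVector (w • i)
  have h2 : b.weylVector = w • -b.weylVector := by rw [smul_neg, hρ, neg_neg]
  rw [h2, weylGroup_smul_pairing, map_neg, LinearMap.neg_apply, pairing_weylVector] at h1
  exact_mod_cast h1.symm

/-- The longest Levi element `w` fixes `λ_p`, as do its generating reflections, and negates `ρ_p`.
With `ρ = (c / 2) λ_p + ρ_p` this gives `w (c λ_p - ρ) = ρ`, and pairing with coroots gives the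
height formula. -/
theorem exists_levi_longest (p : b.support) :
    ∃ (c : ℤ) (w : P.weylGroup), b.levelConstant p = c ∧
      (∀ i, b.corootCoeff (w • i) p = b.corootCoeff i p) ∧
      ∀ i, b.corootHeight (w • i) = c * b.corootCoeff i p - b.corootHeight i := by
  classical
  obtain ⟨w, hwJ, hw⟩ := b.exists_mem_closure_forall_not_isPos {j | j ∈ b.support ∧ j ≠ p}
    fun j hj => hj.1
  have hlam : w • b.fundamentalWeight p = b.fundamentalWeight p := by
    refine Subgroup.closure_induction (p := fun w _ => w • b.fundamentalWeight p =
      b.fundamentalWeight p) ?_ (one_smul _ _) ?_ ?_ hwJ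
    · rintro _ ⟨j, ⟨hj, hjp⟩, rfl⟩
      rw [smul_weylGroup_ofIdx, b.pairing_fundamentalWeight_coroot p ⟨j, hj⟩, if_neg, zero_smul,
        sub_zero]
      exact fun h => hjp (congrArg Subtype.val h)
    · intro x y _ _ hx hy
      rw [mul_smul, hy, hx]
    · intro x _ hx
      rw [inv_smul_eq_iff, hx]
  have hk : ∀ i, b.corootCoeff (w • i) p = b.corootCoeff i p := fun i => by
    have := weylGroup_smul_pairing w (b.fundamentalWeight p) i
    rw [hlam, pairing_fundamentalWeight_eq, pairing_fundamentalWeight_eq] at this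
    exact_mod_cast this
  have hρp : w • b.leviWeylVector p = -b.leviWeylVector p := by
    unfold leviWeylVector
    rw [weylGroup_smul_smul, smul_sum_root_eq_neg, smul_neg]
    intro i hi
    simp only [Finset.mem_filter, Finset.mem_univ, true_and, root_mem_span_iff] at hi ⊢
    rw [isPos_neg_iff, corootCoeff_neg, hk, hi.2, neg_zero]
    refine ⟨b.not_isPos_smul hw hi.1 fun j hj => ?_, rfl⟩
    have : j = p := by
      by_contra h
      exact hj ⟨j.2, fun h' => h (Subtype.ext h')⟩
    rw [this, hi.2]
  have hsum := b.weylVector_sub_leviWeylVector p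
  set c := b.levelConstant p
  have hρ : b.weylVector = w • (c • b.fundamentalWeight p - b.weylVector) := by
    have h1 : b.weylVector = (c / 2) • b.fundamentalWeight p + b.leviWeylVector p := by
      rw [← hsum]; abel
    have h2 : c • b.fundamentalWeight p - b.weylVector =
        (c / 2) • b.fundamentalWeight p - b.leviWeylVector p := by
      rw [h1]; module
    rw [h2, smul_sub, weylGroup_smul_smul, hlam, hρp, h1]
    module
  have hh : ∀ i, (b.corootHeight (w • i) : ℂ) = c * b.corootCoeff i p - b.corootHeight i := by
    intro i
    rw [← pairing_weylVector]
    conv_lhs => rw [hρ]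
    rw [weylGroup_smul_pairing, map_sub, map_smul, LinearMap.sub_apply, LinearMap.smul_apply,
      pairing_weylVector, pairing_fundamentalWeight_eq, smul_eq_mul]
  -- The height formula at `α_p`, where the coefficient is `1`, shows that `c` is an integer.
  have hc : c = ((b.corootHeight (w • (p : ι)) + b.corootHeight p : ℤ) : ℂ) := by
    have := hh p
    rw [corootCoeff_simple, if_pos rfl] at this
    push_cast
    rw [this]
    push_cast
    ring
  refine ⟨_, w, hc, hk, fun i => ?_⟩
  have := hh i
  rw [hc] at this
  exact_mod_cast this

theorem mem_support_and_ne_iff (p : b.support) (i : ι) :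
    i ∈ b.support ∧ i ≠ p ↔ b.corootHeight i = 1 ∧ b.corootCoeff i p = 0 := by
  classical
  rw [corootHeight_eq_one_iff]
  refine and_congr_right fun hi => ?_
  rw [b.corootCoeff_simple ⟨i, hi⟩ p]
  simp [Subtype.ext_iff]

end RootPairing.Base

/-! ### Abstract zeta functions and zeros of meromorphic functions. -/

/-- The analytic properties of the complete Artin zeta function which enter the functional
equation of the zeta functions of `(G, P)`. -/
structure IsZetaLike (ζ : ℂ → ℂ) : Prop where
  meromorphic : Meromorphic ζ
  one_sub : ∀ᶠ s in codiscrete ℂ, ζ (1 - s) = ζ s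
  analyticAt_natCast : ∀ n : ℕ, 2 ≤ n → AnalyticAt ℂ ζ n
  natCast_ne_zero : ∀ n : ℕ, 2 ≤ n → ζ n ≠ 0
  simple_pole : ∃ φ : ℂ → ℂ, AnalyticAt ℂ φ 0 ∧ φ 0 ≠ 0 ∧ ∀ᶠ z in 𝓝[≠] 0, ζ (1 + z) = z⁻¹ * φ z

/-- Identity theorem: finiteness of the order at one point propagates over the connected set `ℂ`. -/
theorem Meromorphic.eventually_ne_zero_codiscrete {f : ℂ → ℂ} (hf : Meromorphic f) {z : ℂ}
    (hz : AnalyticAt ℂ f z) (hz0 : f z ≠ 0) : ∀ᶠ s in codiscrete ℂ, f s ≠ 0 := by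
  have hf' : MeromorphicOn f Set.univ := fun x _ => hf x
  have htop : meromorphicOrderAt f z ≠ ⊤ := by
    rw [hz.meromorphicOrderAt_eq, (hz.analyticOrderAt_eq_zero).2 hz0]
    simp
  rw [eventually_codiscrete_iff]
  intro x
  have hx : meromorphicOrderAt f x ≠ ⊤ :=
    hf'.meromorphicOrderAt_ne_top_of_isPreconnected isPreconnected_univ
      (Set.mem_univ z) (Set.mem_univ x) htop
  exact (meromorphicOrderAt_ne_top_iff_eventually_ne_zero (hf x)).1 hx

theorem Meromorphic.eventually_analyticAt_codiscrete {f : ℂ → ℂ} (hf : Meromorphic f) :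
    ∀ᶠ s in codiscrete ℂ, AnalyticAt ℂ f s := by
  rw [eventually_codiscrete_iff]
  exact fun x => (hf x).eventually_analyticAt

namespace IsZetaLike

variable {ζ : ℂ → ℂ} (hζ : IsZetaLike ζ)
include hζ

theorem eventually_ne_zero : ∀ᶠ s in codiscrete ℂ, ζ s ≠ 0 :=
  hζ.meromorphic.eventually_ne_zero_codiscrete (hζ.analyticAt_natCast 2 le_rfl)
    (hζ.natCast_ne_zero 2 le_rfl)

end IsZetaLike

/-! ### The explicit terms and their behaviour under `s ↦ -c - s`. -/

namespace RootPairing.Base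

variable {ι V N : Type*} [Fintype ι] [AddCommGroup V] [Module ℂ V] [AddCommGroup N] [Module ℂ N]
  {P : RootPairing ι ℂ V N} (b : P.Base) [P.IsRootSystem] [P.IsCrystallographic] [P.IsReduced]

/-- The factors of the term of `w` at `λ = ρ + s λ_p` from the simple roots whose inverse image
under `w` is not a simple root of the Levi subgroup. -/
noncomputable def simpleFactor (q : ℕ) (p : b.support) (w : P.weylGroup) (s : ℂ) : ℂ :=
  ∏ i with b.corootHeight (w • i) = 1 ∧ ¬ (b.corootHeight i = 1 ∧ b.corootCoeff i p = 0),
    (1 - (q : ℂ) ^ (-(b.corootCoeff i p * s + b.corootHeight i - 1)))⁻¹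

/-- The regular zeta factors of the term of `w` from the roots of the Levi subgroup. -/
noncomputable def leviFactor (ζ : ℂ → ℂ) (p : b.support) (w : P.weylGroup) : ℂ :=
  (∏ i with b.corootCoeff i p = 0 ∧ 1 < b.corootHeight i ∧ b.corootHeight (w • i) < 0,
      ζ (b.corootHeight i)) *
    ∏ i with b.corootCoeff i p = 0 ∧ 0 < b.corootHeight i ∧ b.corootHeight (w • i) < 0,
      (ζ (b.corootHeight i + 1))⁻¹

/-- The zeta factors of the term of `w` at `λ = ρ + s λ_p` from the roots of the unipotent
radical. -/
noncomputable def radicalFactor (ζ : ℂ → ℂ) (p : b.support) (w : P.weylGroup) (s : ℂ) : ℂ :=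
  ∏ i with 0 < b.corootCoeff i p ∧ b.corootHeight (w • i) < 0,
    ζ (b.corootCoeff i p * s + b.corootHeight i) /
      ζ (b.corootCoeff i p * s + b.corootHeight i + 1)

/-- The product of the residues of the polar factors of the term of `w`, where `e` is the residue
of `(1 - q^{-z})⁻¹` at `0` and `r` that of `ζ` at `1`. -/
noncomputable def residueConstant (e r : ℂ) (p : b.support) (w : P.weylGroup) : ℂ :=
  ∏ i with b.corootHeight i = 1 ∧ b.corootCoeff i p = 0,
    if b.corootHeight (w • i) = 1 then e else if b.corootHeight (w • i) < 0 then r else 0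

/-- The quotient of the products of all zeta factors from the unipotent radical. -/
noncomputable def radicalQuotient (ζ : ℂ → ℂ) (p : b.support) (s : ℂ) : ℂ :=
  ∏ i with 0 < b.corootCoeff i p,
    ζ (b.corootCoeff i p * s + b.corootHeight i + 1) /
      ζ (b.corootCoeff i p * s + b.corootHeight i)

/-- The elements `w` of the Weyl group whose term has a nonzero iterated residue. -/
def IsContributing (p : b.support) (w : P.weylGroup) : Prop :=
  ∀ i, b.corootHeight i = 1 → b.corootCoeff i p = 0 →
    b.corootHeight (w • i) = 1 ∨ b.corootHeight (w • i) < 0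

theorem residueConstant_ne_zero_iff {e r : ℂ} (he : e ≠ 0) (hr : r ≠ 0) (p : b.support)
    (w : P.weylGroup) : b.residueConstant e r p w ≠ 0 ↔ b.IsContributing p w := by
  unfold residueConstant IsContributing
  rw [Finset.prod_ne_zero_iff]
  refine forall_congr' fun i => ?_
  simp only [Finset.mem_filter, Finset.mem_univ, true_and, and_imp]
  refine imp_congr_right fun _ => imp_congr_right fun _ => ?_
  split_ifs <;> simp_all

theorem corootHeight_ne_zero (i : ι) : b.corootHeight i ≠ 0 := by
  intro h
  have h3 := b.isPos_neg_iff i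
  rw [← corootHeight_pos_iff, ← corootHeight_pos_iff, corootHeight_neg, h] at h3
  simp at h3

theorem corootHeight_pos_of_corootCoeff_pos {i : ι} {p : b.support}
    (h : 0 < b.corootCoeff i p) : 0 < b.corootHeight i := by
  rw [corootHeight_pos_iff]
  by_contra hi
  exact absurd h (not_lt.2 (b.corootCoeff_nonpos hi p))

theorem corootCoeff_nonneg_of_corootHeight_pos {i : ι} (p : b.support)
    (h : 0 < b.corootHeight i) : 0 ≤ b.corootCoeff i p :=
  b.corootCoeff_nonneg (b.corootHeight_pos_iff.1 h) p

section FunctionalEquation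

variable {p : b.support} {c : ℤ} {w₀ wp : P.weylGroup}
  (hw₀ : ∀ i, b.corootHeight (w₀ • i) = -b.corootHeight i)
  (hwpk : ∀ i, b.corootCoeff (wp • i) p = b.corootCoeff i p)
  (hwph : ∀ i, b.corootHeight (wp • i) = c * b.corootCoeff i p - b.corootHeight i)

include hwpk in
theorem corootCoeff_inv_smul (i : ι) : b.corootCoeff (wp⁻¹ • i) p = b.corootCoeff i p := by
  rw [← hwpk, smul_inv_smul]

include hwpk hwph in
theorem corootHeight_inv_smul (i : ι) :
    b.corootHeight (wp⁻¹ • i) = c * b.corootCoeff i p - b.corootHeight i := by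
  have := hwph (wp⁻¹ • i)
  rw [smul_inv_smul, b.corootCoeff_inv_smul hwpk] at this
  lia

/-- The permutation `α ↦ -w_p⁻¹ α` of the roots. -/
noncomputable def negSmulPerm (w : P.weylGroup) : Equiv.Perm ι where
  toFun i := P.reflectionPerm (w⁻¹ • i) (w⁻¹ • i)
  invFun i := w • P.reflectionPerm i i
  left_inv i := by
    simp only [reflectionPerm_self_self, smul_inv_smul]
  right_inv i := by
    simp only [inv_smul_smul, reflectionPerm_self_self]

include hwpk in
theorem corootCoeff_negSmulPerm (i : ι) :
    b.corootCoeff (negSmulPerm wp i) p = -b.corootCoeff i p := by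
  change b.corootCoeff (P.reflectionPerm (wp⁻¹ • i) (wp⁻¹ • i)) p = _
  rw [corootCoeff_neg, b.corootCoeff_inv_smul hwpk]

include hwpk hwph in
theorem corootHeight_negSmulPerm (i : ι) :
    b.corootHeight (negSmulPerm wp i) = b.corootHeight i - c * b.corootCoeff i p := by
  change b.corootHeight (P.reflectionPerm (wp⁻¹ • i) (wp⁻¹ • i)) = _
  rw [corootHeight_neg, b.corootHeight_inv_smul hwpk hwph]
  ring

include hw₀ in
-- The two signs, from `-w_p⁻¹` and from `w₀`, cancel; thus this bijection preserves both "`w α` is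
-- simple" and "`w α` is negative".
theorem corootHeight_smul_negSmulPerm (w : P.weylGroup) (i : ι) :
    b.corootHeight ((w₀ * w * wp) • negSmulPerm wp i) = b.corootHeight (w • i) := by
  change b.corootHeight ((w₀ * w * wp) • P.reflectionPerm (wp⁻¹ • i) (wp⁻¹ • i)) = _
  rw [weylGroup_smul_reflectionPerm_self, corootHeight_neg, mul_smul, mul_smul, smul_inv_smul, hw₀,
    neg_neg]

include hw₀ in
-- Without the sign the bijection `w_p⁻¹` exchanges roots made negative with roots made positive. It
-- is the one used on the radical, since it keeps the coefficient at `α_p` positive.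
theorem corootHeight_smul_inv_smul (w : P.weylGroup) (i : ι) :
    b.corootHeight ((w₀ * w * wp) • wp⁻¹ • i) = -b.corootHeight (w • i) := by
  rw [mul_smul, mul_smul, smul_inv_smul, hw₀]

include hw₀ hwpk hwph in
theorem isContributing_iff (w : P.weylGroup) :
    b.IsContributing p (w₀ * w * wp) ↔ b.IsContributing p w := by
  unfold IsContributing
  rw [← (negSmulPerm wp).forall_congr_right]
  refine forall_congr' fun i => ?_
  rw [b.corootHeight_negSmulPerm hwpk hwph, b.corootCoeff_negSmulPerm hwpk,
    b.corootHeight_smul_negSmulPerm hw₀, neg_eq_zero]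
  constructor
  · intro h h1 h2
    exact h (by rw [h1, h2]; simp) h2
  · intro h h1 h2
    exact h (by rw [h2] at h1; simpa using h1) h2

include hw₀ hwpk hwph in
theorem residueConstant_eq (e r : ℂ) (w : P.weylGroup) :
    b.residueConstant e r p (w₀ * w * wp) = b.residueConstant e r p w := by
  unfold residueConstant
  symm
  refine Finset.prod_equiv (negSmulPerm wp) (fun i => ?_) fun i _ => ?_
  · simp only [Finset.mem_filter, Finset.mem_univ, true_and]
    rw [b.corootHeight_negSmulPerm hwpk hwph, b.corootCoeff_negSmulPerm hwpk, neg_eq_zero]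
    constructor
    · rintro ⟨h1, h2⟩; simp [h1, h2]
    · rintro ⟨h1, h2⟩; rw [h2] at h1; exact ⟨by simpa using h1, h2⟩
  · rw [b.corootHeight_smul_negSmulPerm hw₀]

include hw₀ hwpk hwph in
-- Under `α ↦ -w_p⁻¹ α` the pair `(k, h)` becomes `(-k, h - c k)`, and `k (-c - s) + h = (-k) s + (h
-- - c k)`. No property of `ζ` enters, so the equality holds at every `s`.
theorem simpleFactor_neg_sub (q : ℕ) (w : P.weylGroup) (s : ℂ) :
    b.simpleFactor q p w (-c - s) = b.simpleFactor q p (w₀ * w * wp) s := by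
  unfold simpleFactor
  refine Finset.prod_equiv (negSmulPerm wp) (fun i => ?_) fun i _ => ?_
  · simp only [Finset.mem_filter, Finset.mem_univ, true_and]
    rw [b.corootHeight_smul_negSmulPerm hw₀, b.corootHeight_negSmulPerm hwpk hwph,
      b.corootCoeff_negSmulPerm hwpk, neg_eq_zero]
    refine and_congr_right fun _ => not_congr ?_
    constructor
    · rintro ⟨h1, h2⟩; simp [h1, h2]
    · rintro ⟨h1, h2⟩; rw [h2] at h1; exact ⟨by simpa using h1, h2⟩
  · rw [b.corootHeight_negSmulPerm hwpk hwph, b.corootCoeff_negSmulPerm hwpk]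
    push_cast
    ring_nf

include hw₀ hwpk hwph in
theorem leviFactor_eq (ζ : ℂ → ℂ) (w : P.weylGroup) :
    b.leviFactor ζ p (w₀ * w * wp) = b.leviFactor ζ p w := by
  unfold leviFactor
  symm
  congr 1
  · refine Finset.prod_equiv (negSmulPerm wp) (fun i => ?_) fun i hi => ?_
    · simp only [Finset.mem_filter, Finset.mem_univ, true_and]
      rw [b.corootHeight_smul_negSmulPerm hw₀, b.corootHeight_negSmulPerm hwpk hwph,
        b.corootCoeff_negSmulPerm hwpk, neg_eq_zero]
      refine and_congr_right fun h => ?_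
      rw [h, mul_zero, sub_zero]
    · simp only [Finset.mem_filter, Finset.mem_univ, true_and] at hi
      rw [b.corootHeight_negSmulPerm hwpk hwph, hi.1, mul_zero, sub_zero]
  · refine Finset.prod_equiv (negSmulPerm wp) (fun i => ?_) fun i hi => ?_
    · simp only [Finset.mem_filter, Finset.mem_univ, true_and]
      rw [b.corootHeight_smul_negSmulPerm hw₀, b.corootHeight_negSmulPerm hwpk hwph,
        b.corootCoeff_negSmulPerm hwpk, neg_eq_zero]
      refine and_congr_right fun h => ?_
      rw [h, mul_zero, sub_zero]
    · simp only [Finset.mem_filter, Finset.mem_univ, true_and] at hi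
      rw [b.corootHeight_negSmulPerm hwpk hwph, hi.1, mul_zero, sub_zero]

theorem eventually_zeta_ne_zero {ζ : ℂ → ℂ} (hζ : IsZetaLike ζ) (p : b.support) (d : ℂ) :
    ∀ᶠ s in codiscrete ℂ, ∀ i, 0 < b.corootCoeff i p →
      ζ (b.corootCoeff i p * s + b.corootHeight i + d) ≠ 0 := by
  rw [eventually_all]
  intro i
  by_cases hi : 0 < b.corootCoeff i p
  · have := hζ.eventually_ne_zero.comp_affine (a := b.corootCoeff i p)
      (by exact_mod_cast hi.ne') (b.corootHeight i + d)
    filter_upwards [this] with s hs _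
    rwa [add_assoc]
  · simp [hi]

include hw₀ hwpk hwph in
-- If `w_p⁻¹ α` has height `h' = c k - h`, then `k (-c - s) + h = 1 - (k s + h' + 1)`. So `ζ(1 - s)
-- = ζ(s)` turns the quotient at `α` into the inverse of the quotient at `w_p⁻¹ α`.
theorem radicalFactor_neg_sub {ζ : ℂ → ℂ} (hζ : IsZetaLike ζ) :
    ∀ᶠ s in codiscrete ℂ, ∀ w : P.weylGroup, b.radicalFactor ζ p w (-c - s) =
      b.radicalQuotient ζ p s * b.radicalFactor ζ p (w₀ * w * wp) s := by
  have hfe : ∀ᶠ s in codiscrete ℂ, ∀ i, 0 < b.corootCoeff i p →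
      ζ (b.corootCoeff i p * (-c - s) + b.corootHeight i) =
        ζ (b.corootCoeff (wp⁻¹ • i) p * s + b.corootHeight (wp⁻¹ • i) + 1) ∧
      ζ (b.corootCoeff i p * (-c - s) + b.corootHeight i + 1) =
        ζ (b.corootCoeff (wp⁻¹ • i) p * s + b.corootHeight (wp⁻¹ • i)) := by
    rw [eventually_all]
    intro i
    by_cases hi : 0 < b.corootCoeff i p
    · have h1 := hζ.one_sub.comp_affine (a := b.corootCoeff i p)
        (by exact_mod_cast hi.ne') (b.corootHeight (wp⁻¹ • i) + 1)
      have h2 := hζ.one_sub.comp_affine (a := b.corootCoeff i p)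
        (by exact_mod_cast hi.ne') (b.corootHeight (wp⁻¹ • i))
      filter_upwards [h1, h2] with s hs1 hs2 _
      rw [b.corootCoeff_inv_smul hwpk, add_assoc (_ * s), ← hs1, ← hs2,
        b.corootHeight_inv_smul hwpk hwph]
      push_cast
      constructor <;> · congr 1; ring
    · simp [hi]
  have hn0 := b.eventually_zeta_ne_zero hζ p 0
  have hn1 := b.eventually_zeta_ne_zero hζ p 1
  filter_upwards [hfe, hn0, hn1] with s hs hs0 hs1 w
  simp only [add_zero] at hs0
  -- The inverted quotients run over the radical roots that are not inversions of `w₀ w w_p`.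
  have h1 : b.radicalFactor ζ p w (-c - s) =
      ∏ i with 0 < b.corootCoeff i p ∧ ¬ b.corootHeight ((w₀ * w * wp) • i) < 0,
        ζ (b.corootCoeff i p * s + b.corootHeight i + 1) /
          ζ (b.corootCoeff i p * s + b.corootHeight i) := by
    unfold radicalFactor
    refine Finset.prod_equiv (MulAction.toPerm wp⁻¹) (fun i => ?_) fun i hi => ?_
    · simp only [Finset.mem_filter, Finset.mem_univ, true_and, MulAction.toPerm_apply]
      rw [b.corootCoeff_inv_smul hwpk, b.corootHeight_smul_inv_smul hw₀]
      have := b.corootHeight_ne_zero (w • i)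
      refine and_congr_right fun _ => ?_
      lia
    · simp only [Finset.mem_filter, Finset.mem_univ, true_and] at hi
      rw [MulAction.toPerm_apply, (hs i hi.1).1, (hs i hi.1).2]
  -- The product over all radical roots is split along inversions of `w₀ w w_p`; the part over the
  -- inversions cancels against the radical factor of `w₀ w w_p`.
  have h2 : b.radicalQuotient ζ p s =
      (∏ i with 0 < b.corootCoeff i p ∧ b.corootHeight ((w₀ * w * wp) • i) < 0,
        ζ (b.corootCoeff i p * s + b.corootHeight i + 1) /
          ζ (b.corootCoeff i p * s + b.corootHeight i)) *
      ∏ i with 0 < b.corootCoeff i p ∧ ¬ b.corootHeight ((w₀ * w * wp) • i) < 0,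
        ζ (b.corootCoeff i p * s + b.corootHeight i + 1) /
          ζ (b.corootCoeff i p * s + b.corootHeight i) := by
    unfold radicalQuotient
    rw [← Finset.filter_filter, ← Finset.filter_filter, Finset.prod_filter_mul_prod_filter_not]
  rw [h1, h2, mul_right_comm]
  unfold radicalFactor
  rw [← Finset.prod_mul_distrib]
  refine (one_mul _).symm.trans (congrArg (· * _) (Finset.prod_eq_one fun i hi => ?_).symm)
  simp only [Finset.mem_filter, Finset.mem_univ, true_and] at hi
  have a0 := hs0 i hi.1
  have a1 := hs1 i hi.1
  field_simp

/-- The iterated residue of the term of `w`, as an explicit function. -/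
noncomputable def explicitTerm (q : ℕ) (ζ : ℂ → ℂ) (e r : ℂ) (p : b.support) (w : P.weylGroup)
    (s : ℂ) : ℂ :=
  b.residueConstant e r p w * b.simpleFactor q p w s * b.leviFactor ζ p w *
    b.radicalFactor ζ p w s

include hw₀ hwpk hwph in
theorem sum_explicitTerm_neg_sub (q : ℕ) {ζ : ℂ → ℂ} (hζ : IsZetaLike ζ) (e r : ℂ) :
    ∀ᶠ s in codiscrete ℂ, ∑ w, b.explicitTerm q ζ e r p w (-c - s) =
      b.radicalQuotient ζ p s * ∑ w, b.explicitTerm q ζ e r p w s := by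
  filter_upwards [b.radicalFactor_neg_sub hw₀ hwpk hwph hζ] with s hs
  rw [Finset.mul_sum, ← Equiv.sum_comp ((Equiv.mulRight wp).trans (Equiv.mulLeft w₀))
    fun w => b.radicalQuotient ζ p s * b.explicitTerm q ζ e r p w s]
  refine Finset.sum_congr rfl fun w _ => ?_
  have : ((Equiv.mulRight wp).trans (Equiv.mulLeft w₀)) w = w₀ * w * wp := by
    simp [mul_assoc]
  rw [this]
  unfold explicitTerm
  rw [hs w, b.simpleFactor_neg_sub hw₀ hwpk hwph, b.leviFactor_eq hw₀ hwpk hwph,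
    b.residueConstant_eq hw₀ hwpk hwph]
  ring

end FunctionalEquation

end RootPairing.Base

/-! ### The minimal clearing family and its duality. -/

namespace RootPairing.Base

variable {ι V N : Type*} [Fintype ι] [AddCommGroup V] [Module ℂ V] [AddCommGroup N] [Module ℂ N]
  {P : RootPairing ι ℂ V N} (b : P.Base) [P.IsRootSystem] [P.IsCrystallographic] [P.IsReduced]

section Multiset

open scoped Classical in
/-- The smallest family of zeta factors clearing the denominators of all terms in a set. -/
noncomputable def clearingFamily (p : b.support) (G : P.weylGroup → Prop) : Multiset (ℂ × ℂ) :=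
  (Finset.univ.filter G).sup fun w => b.zetaDenominators p w - b.zetaNumerators p w

/-- For multisets, `A ≤ S + B` is equivalent to `A - B ≤ S`. So the clearing families are those
above a supremum, and comparing cardinalities leaves only the supremum itself. -/
theorem isMinimalClearing_iff {q : ℕ} {ζ : ℂ → ℂ} {p : b.support} {l : List b.support}
    {G : P.weylGroup → Prop}
    (hG : ∀ w, ¬ (b.parabolicPeriodTerm q ζ p l w =ᶠ[codiscrete ℂ] 0) ↔ G w)
    (S : Multiset (ℂ × ℂ)) :
    b.IsMinimalClearing q ζ p l S ↔ S = b.clearingFamily p G := by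
  classical
  have key : ∀ S, b.ClearsDenominators q ζ p l S ↔ b.clearingFamily p G ≤ S := by
    intro S
    simp only [ClearsDenominators, clearingFamily, hG, Finset.sup_le_iff, Finset.mem_filter,
      Finset.mem_univ, true_and, tsub_le_iff_right]
  unfold IsMinimalClearing
  simp only [key]
  constructor
  · rintro ⟨h1, h2⟩
    exact (Multiset.eq_of_le_of_card_le h1 (h2 _ le_rfl)).symm
  · rintro rfl
    exact ⟨le_rfl, fun T hT => Multiset.card_le_card hT⟩

variable {p : b.support} {c : ℤ} {w₀ wp : P.weylGroup}
  (hw₀ : ∀ i, b.corootHeight (w₀ • i) = -b.corootHeight i)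
  (hwpk : ∀ i, b.corootCoeff (wp • i) p = b.corootCoeff i p)
  (hwph : ∀ i, b.corootHeight (wp • i) = c * b.corootCoeff i p - b.corootHeight i)

theorem mem_inversions_iff_corootHeight {w : P.weylGroup} {i : ι} :
    i ∈ b.inversions w ↔ 0 < b.corootHeight i ∧ b.corootHeight (w • i) < 0 := by
  rw [mem_inversions, ← corootHeight_pos_iff, ← corootHeight_pos_iff]
  have := b.corootHeight_ne_zero (w • i)
  refine and_congr_right fun _ => ?_
  lia

/-- Levi roots give pairs with first entry `0`. Away from these only radical roots count, and the
exclusion of the simple Levi roots plays no role. -/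
theorem count_zetaNumerators (w : P.weylGroup) {x : ℂ × ℂ} (hx : x.1 ≠ 0) :
    (b.zetaNumerators p w).count x =
      (Finset.univ.filter fun i => (0 < b.corootCoeff i p ∧ b.corootHeight (w • i) < 0) ∧
        x = ((b.corootCoeff i p : ℂ), (b.corootHeight i : ℂ))).card := by
  classical
  rw [zetaNumerators, Multiset.count_map, Finset.card_def]
  congr 1
  rw [← Finset.filter_val, Finset.filter_filter, Finset.val_inj]
  ext i
  simp only [Finset.mem_filter, Finset.mem_univ, true_and, mem_inversions_iff_corootHeight,
    pairing_weylVector, pairing_fundamentalWeight_eq, mem_support_and_ne_iff]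
  constructor
  · rintro ⟨⟨h1, h2⟩, h3, rfl⟩
    have hk : b.corootCoeff i p ≠ 0 := fun h => hx (by simp [h])
    have := b.corootCoeff_nonneg_of_corootHeight_pos p h1
    exact ⟨⟨by lia, h2⟩, rfl⟩
  · rintro ⟨⟨h1, h2⟩, h3⟩
    exact ⟨⟨b.corootHeight_pos_of_corootCoeff_pos h1, h2⟩, fun h => by lia, h3⟩

theorem count_zetaDenominators (w : P.weylGroup) {x : ℂ × ℂ}
    (hx : x.1 ≠ 0) :
    (b.zetaDenominators p w).count x =
      (Finset.univ.filter fun i => (0 < b.corootCoeff i p ∧ b.corootHeight (w • i) < 0) ∧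
        x = ((b.corootCoeff i p : ℂ), (b.corootHeight i + 1 : ℂ))).card := by
  classical
  rw [zetaDenominators, Multiset.count_map, Finset.card_def]
  congr 1
  rw [← Finset.filter_val, Finset.val_inj]
  ext i
  simp only [Finset.mem_filter, Finset.mem_univ, true_and, mem_inversions_iff_corootHeight,
    pairing_weylVector, pairing_fundamentalWeight_eq]
  constructor
  · rintro ⟨⟨h1, h2⟩, rfl⟩
    have hk : b.corootCoeff i p ≠ 0 := fun h => hx (by simp [h])
    have := b.corootCoeff_nonneg_of_corootHeight_pos p h1
    exact ⟨⟨by lia, h2⟩, rfl⟩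
  · rintro ⟨⟨h1, h2⟩, h3⟩
    exact ⟨⟨b.corootHeight_pos_of_corootCoeff_pos h1, h2⟩, h3⟩

/-- The zeta factors of the unipotent radical, in the numerator. -/
noncomputable def radicalNumerators (p : b.support) : Multiset (ℂ × ℂ) :=
  (Finset.univ.filter fun i => 0 < b.corootCoeff i p).val.map fun i =>
    ((b.corootCoeff i p : ℂ), (b.corootHeight i : ℂ))

/-- The zeta factors of the unipotent radical, in the denominator. -/
noncomputable def radicalDenominators (p : b.support) : Multiset (ℂ × ℂ) :=
  (Finset.univ.filter fun i => 0 < b.corootCoeff i p).val.map fun i =>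
    ((b.corootCoeff i p : ℂ), (b.corootHeight i + 1 : ℂ))

/-- The involution of the pairs `(a, b)` induced by `ζ(1 - s) = ζ(s)` and `s ↦ -c - s`. -/
def dualPair (c : ℂ) (x : ℂ × ℂ) : ℂ × ℂ := (x.1, x.1 * c - x.2 + 1)

theorem dualPair_dualPair (c : ℂ) (x : ℂ × ℂ) : dualPair c (dualPair c x) = x := by
  ext
  · rfl
  · simp only [dualPair]
    ring

include hw₀ hwpk hwph in
-- Numerators for `w`, dualised, are the denominators at the radical roots outside `Φ_{w₀ w w_p}`:
-- `w_p⁻¹` sends `(k, h)` to `(k, c k - h)`, and the duality adds the missing `1`.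
theorem count_zetaDenominators_add (w : P.weylGroup) {x : ℂ × ℂ}
    (hx : x.1 ≠ 0) :
    (b.zetaDenominators p (w₀ * w * wp)).count x + (b.zetaNumerators p w).count (dualPair c x) =
      (b.radicalDenominators p).count x := by
  classical
  have h2 : (b.zetaNumerators p w).count (dualPair c x) =
      (Finset.univ.filter fun i => (0 < b.corootCoeff i p ∧
        ¬ b.corootHeight ((w₀ * w * wp) • i) < 0) ∧
        x = ((b.corootCoeff i p : ℂ), (b.corootHeight i + 1 : ℂ))).card := by
    rw [b.count_zetaNumerators w (x := dualPair c x) hx]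
    refine Finset.card_equiv (MulAction.toPerm wp⁻¹) fun i => ?_
    simp only [Finset.mem_filter, Finset.mem_univ, true_and, MulAction.toPerm_apply]
    rw [b.corootCoeff_inv_smul hwpk, b.corootHeight_smul_inv_smul hw₀,
      b.corootHeight_inv_smul hwpk hwph]
    have := b.corootHeight_ne_zero (w • i)
    refine and_congr (and_congr_right fun _ => by lia) ?_
    rw [Prod.ext_iff, Prod.ext_iff]
    refine and_congr_right fun h => ?_
    simp only [dualPair] at h ⊢
    push_cast
    rw [h]
    constructor
    · intro h'; rw [← h']; ring
    · intro h'; rw [h']; ring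
  rw [h2, b.count_zetaDenominators _ hx, radicalDenominators, Multiset.count_map,
    ← Finset.filter_val, ← Finset.card_def, Finset.filter_filter,
    ← Finset.card_filter_add_card_filter_not (s := Finset.univ.filter fun i =>
      0 < b.corootCoeff i p ∧ x = ((b.corootCoeff i p : ℂ), (b.corootHeight i + 1 : ℂ)))
      (fun i => b.corootHeight ((w₀ * w * wp) • i) < 0), Finset.filter_filter,
    Finset.filter_filter]
  congr 3 <;> · ext i; tauto

include hw₀ hwpk hwph in
theorem count_zetaNumerators_add (w : P.weylGroup) {x : ℂ × ℂ}
    (hx : x.1 ≠ 0) :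
    (b.zetaNumerators p (w₀ * w * wp)).count x + (b.zetaDenominators p w).count (dualPair c x) =
      (b.radicalNumerators p).count x := by
  classical
  have h2 : (b.zetaDenominators p w).count (dualPair c x) =
      (Finset.univ.filter fun i => (0 < b.corootCoeff i p ∧
        ¬ b.corootHeight ((w₀ * w * wp) • i) < 0) ∧
        x = ((b.corootCoeff i p : ℂ), (b.corootHeight i : ℂ))).card := by
    rw [b.count_zetaDenominators w (x := dualPair c x) hx]
    refine Finset.card_equiv (MulAction.toPerm wp⁻¹) fun i => ?_
    simp only [Finset.mem_filter, Finset.mem_univ, true_and, MulAction.toPerm_apply]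
    rw [b.corootCoeff_inv_smul hwpk, b.corootHeight_smul_inv_smul hw₀,
      b.corootHeight_inv_smul hwpk hwph]
    have := b.corootHeight_ne_zero (w • i)
    refine and_congr (and_congr_right fun _ => by lia) ?_
    rw [Prod.ext_iff, Prod.ext_iff]
    refine and_congr_right fun h => ?_
    simp only [dualPair] at h ⊢
    push_cast
    rw [h]
    constructor
    · intro h'; linear_combination -h'
    · intro h'; rw [h']; ring
  rw [h2, b.count_zetaNumerators _ hx, radicalNumerators, Multiset.count_map,
    ← Finset.filter_val, ← Finset.card_def, Finset.filter_filter,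
    ← Finset.card_filter_add_card_filter_not (s := Finset.univ.filter fun i =>
      0 < b.corootCoeff i p ∧ x = ((b.corootCoeff i p : ℂ), (b.corootHeight i : ℂ)))
      (fun i => b.corootHeight ((w₀ * w * wp) • i) < 0), Finset.filter_filter,
    Finset.filter_filter]
  congr 3 <;> · ext i; tauto

theorem isContributing_one (p : b.support) : b.IsContributing p 1 := fun i hi _ => by
  rw [one_smul]; exact Or.inl hi

include hw₀ hwpk hwph in
-- For each `w`, the excess of denominators over numerators of `w₀ w w_p` at `x` is that of `w` at
-- the dual pair plus a quantity independent of `w`. The contributing elements are stable under `w ↦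
-- w₀ w w_p`, so the maxima differ by the same quantity.
theorem count_clearingFamily_add {x : ℂ × ℂ} (hx : x.1 ≠ 0) :
    (b.clearingFamily p (b.IsContributing p)).count x + (b.radicalNumerators p).count x =
      (b.clearingFamily p (b.IsContributing p)).count (dualPair c x) +
        (b.radicalDenominators p).count x := by
  classical
  have hsup : ∀ x, (b.clearingFamily p (b.IsContributing p)).count x =
      (Finset.univ.filter (b.IsContributing p)).sup fun w =>
        (b.zetaDenominators p w).count x - (b.zetaNumerators p w).count x := by
    intro x
    rw [clearingFamily, Multiset.count_finset_sup]
    simp only [Multiset.count_sub]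
  -- The identity contributes and has excess `0`, so the maximum of the integer excesses is
  -- nonnegative and the truncated subtraction in the supremum is harmless.
  have hinv : ∀ x, (b.zetaDenominators p (1 : P.weylGroup)).count x = 0 := by
    intro x
    have : b.inversions (1 : P.weylGroup) = ∅ := by
      ext i; simp [mem_inversions]
    simp [zetaDenominators, this]
  have hinv' : ∀ x, (b.zetaNumerators p (1 : P.weylGroup)).count x = 0 := by
    intro x
    have : b.inversions (1 : P.weylGroup) = ∅ := by
      ext i; simp [mem_inversions]
    simp [zetaNumerators, this]
  have hle : ∀ x, ∀ w, b.IsContributing p w → (b.zetaDenominators p w).count x ≤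
      (b.clearingFamily p (b.IsContributing p)).count x + (b.zetaNumerators p w).count x := by
    intro x w hw
    rw [← tsub_le_iff_right, hsup]
    exact Finset.le_sup (f := fun w =>
      (b.zetaDenominators p w).count x - (b.zetaNumerators p w).count x) (by simpa using hw)
  have hex : ∀ x, ∃ w, b.IsContributing p w ∧
      (b.clearingFamily p (b.IsContributing p)).count x + (b.zetaNumerators p w).count x =
        (b.zetaDenominators p w).count x := by
    intro x
    obtain ⟨w, hw, hwx⟩ := Finset.exists_mem_eq_sup (Finset.univ.filter (b.IsContributing p))
      ⟨1, by simpa using b.isContributing_one p⟩ fun w =>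
        (b.zetaDenominators p w).count x - (b.zetaNumerators p w).count x
    rw [← hsup] at hwx
    -- If the supremum is `0` it is attained without truncation at `w = 1`; if it is positive, the
    -- subtraction at a maximising `w` is not truncated.
    rcases Nat.eq_zero_or_pos ((b.clearingFamily p (b.IsContributing p)).count x) with h | h
    · exact ⟨1, b.isContributing_one p, by rw [h, hinv, hinv']⟩
    · exact ⟨w, by simpa using hw, by lia⟩
  have hx' : (dualPair c x).1 ≠ 0 := hx
  have hdd := dualPair_dualPair c x
  refine le_antisymm ?_ ?_
  · obtain ⟨w, hw, hwx⟩ := hex x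
    -- `w = w₀ * w' * wp` for `w' = w₀⁻¹ * w * wp⁻¹`
    have hw' : w = w₀ * (w₀⁻¹ * w * wp⁻¹) * wp := by group
    set w' := w₀⁻¹ * w * wp⁻¹
    rw [hw', b.isContributing_iff hw₀ hwpk hwph] at hw
    have h1 := b.count_zetaDenominators_add hw₀ hwpk hwph w' hx
    have h2 := b.count_zetaNumerators_add hw₀ hwpk hwph w' hx
    have h3 := hle (dualPair c x) w' hw
    rw [hw'] at hwx
    lia
  · obtain ⟨w, hw, hwx⟩ := hex (dualPair c x)
    have h1 := b.count_zetaDenominators_add hw₀ hwpk hwph w hx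
    have h2 := b.count_zetaNumerators_add hw₀ hwpk hwph w hx
    have h3 := hle x _ ((b.isContributing_iff hw₀ hwpk hwph w).2 hw)
    lia

/-- The product of the zeta factors in a family. -/
noncomputable def zetaProduct (ζ : ℂ → ℂ) (S : Multiset (ℂ × ℂ)) (s : ℂ) : ℂ :=
  (S.map fun ab => ζ (ab.1 * s + ab.2)).prod

theorem zetaProduct_add (ζ : ℂ → ℂ) (S T : Multiset (ℂ × ℂ)) (s : ℂ) :
    zetaProduct ζ (S + T) s = zetaProduct ζ S s * zetaProduct ζ T s := by
  simp [zetaProduct]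

theorem zetaProduct_neg_sub {ζ : ℂ → ℂ} (hζ : IsZetaLike ζ) (c : ℂ) (S : Multiset (ℂ × ℂ))
    (hS : ∀ x ∈ S, x.1 ≠ 0) :
    ∀ᶠ s in codiscrete ℂ, zetaProduct ζ S (-c - s) = zetaProduct ζ (S.map (dualPair c)) s := by
  classical
  have : ∀ᶠ s in codiscrete ℂ, ∀ x ∈ S.toFinset,
      ζ (x.1 * (-c - s) + x.2) = ζ (x.1 * s + (x.1 * c - x.2 + 1)) := by
    rw [Filter.eventually_all_finset]
    intro x hx
    filter_upwards [hζ.one_sub.comp_affine (hS x (by simpa using hx)) (x.1 * c - x.2 + 1)]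
      with s hs
    rw [← hs]
    congr 1
    ring
  filter_upwards [this] with s hs
  unfold zetaProduct
  rw [Multiset.map_map]
  refine congrArg Multiset.prod (Multiset.map_congr rfl fun x hx => ?_)
  exact hs x (by simpa using hx)

include hw₀ hwpk hwph in
-- Up to constants, `s ↦ -c - s` replaces the family by its dual, and the dual differs from the
-- family exactly by the zeta factors of `radicalQuotient`.
theorem zetaProduct_clearingFamily {ζ : ℂ → ℂ} (hζ : IsZetaLike ζ) :
    ∀ᶠ s in codiscrete ℂ,
      zetaProduct ζ (b.clearingFamily p (b.IsContributing p)) (-c - s) * b.radicalQuotient ζ p s =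
        zetaProduct ζ (b.clearingFamily p (b.IsContributing p)) s := by
  classical
  set T := b.clearingFamily p (b.IsContributing p)
  -- Pairs `(0, b)` come from Levi roots and give factors constant in `s`; they are kept apart
  -- because the duality of multiplicities is only available for `a ≠ 0`.
  have hT : T = T.filter (fun x => x.1 ≠ 0) + T.filter fun x => ¬ x.1 ≠ 0 :=
    (Multiset.filter_add_not _ _).symm
  have hmul : T.filter (fun x => x.1 ≠ 0) + b.radicalNumerators p =
      (T.filter fun x => x.1 ≠ 0).map (dualPair c) + b.radicalDenominators p := by
    ext x
    have hinj : Function.Injective (dualPair (c : ℂ)) :=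
      Function.LeftInverse.injective (dualPair_dualPair (c : ℂ))
    have h1 : ((T.filter fun x => x.1 ≠ 0).map (dualPair c)).count x =
        (T.filter fun x => x.1 ≠ 0).count (dualPair c x) := by
      conv_lhs => rw [← dualPair_dualPair c x]
      exact Multiset.count_map_eq_count' _ _ hinj _
    rw [Multiset.count_add, Multiset.count_add, h1]
    by_cases hx : x.1 = 0
    · have h2 : ∀ y : ℂ × ℂ, y.1 = 0 → (T.filter fun x => x.1 ≠ 0).count y = 0 := fun y hy => by
        rw [Multiset.count_eq_zero, Multiset.mem_filter]
        exact fun h => h.2 hy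
      rw [h2 x hx, h2 (dualPair c x) hx]
      have h3 : ∀ i, 0 < b.corootCoeff i p → (b.corootCoeff i p : ℂ) ≠ 0 := fun i hi => by
        exact_mod_cast hi.ne'
      congr 1
      rw [Multiset.count_eq_zero.2, Multiset.count_eq_zero.2]
      · simp only [radicalDenominators, Multiset.mem_map, Finset.mem_val, Finset.mem_filter,
          Finset.mem_univ, true_and, not_exists, not_and]
        rintro i hi rfl
        exact h3 i hi hx
      · simp only [radicalNumerators, Multiset.mem_map, Finset.mem_val, Finset.mem_filter,
          Finset.mem_univ, true_and, not_exists, not_and]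
        rintro i hi rfl
        exact h3 i hi hx
    · have h2 : ∀ y : ℂ × ℂ, y.1 ≠ 0 → (T.filter fun x => x.1 ≠ 0).count y = T.count y :=
        fun y hy => Multiset.count_filter_of_pos hy
      rw [h2 x hx, h2 (dualPair c x) hx]
      exact b.count_clearingFamily_add hw₀ hwpk hwph hx
  filter_upwards [zetaProduct_neg_sub hζ c (T.filter fun x => x.1 ≠ 0)
    (fun x hx => (Multiset.mem_filter.1 hx).2), b.eventually_zeta_ne_zero hζ p 0] with s hs hn
  simp only [add_zero] at hn
  have h0 : zetaProduct ζ (T.filter fun x => ¬ x.1 ≠ 0) (-c - s) =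
      zetaProduct ζ (T.filter fun x => ¬ x.1 ≠ 0) s := by
    unfold zetaProduct
    refine congrArg Multiset.prod (Multiset.map_congr rfl fun x hx => ?_)
    have : x.1 = 0 := not_not.1 (Multiset.mem_filter.1 hx).2
    rw [this, zero_mul, zero_mul]
  have hq : b.radicalQuotient ζ p s * zetaProduct ζ (b.radicalNumerators p) s =
      zetaProduct ζ (b.radicalDenominators p) s := by
    unfold radicalQuotient zetaProduct radicalNumerators radicalDenominators
    rw [Multiset.map_map, Multiset.map_map, ← Finset.prod_eq_multiset_prod,
      ← Finset.prod_eq_multiset_prod, ← Finset.prod_mul_distrib]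
    refine Finset.prod_congr rfl fun i hi => ?_
    simp only [Finset.mem_filter, Finset.mem_univ, true_and] at hi
    simp only [Function.comp_apply, ← add_assoc]
    exact div_mul_cancel₀ _ (hn i hi)
  have hN : zetaProduct ζ (b.radicalNumerators p) s ≠ 0 := by
    unfold zetaProduct radicalNumerators
    rw [Multiset.map_map, ← Finset.prod_eq_multiset_prod, Finset.prod_ne_zero_iff]
    intro i hi
    simp only [Finset.mem_filter, Finset.mem_univ, true_and] at hi
    exact hn i hi
  have hm := congrArg (fun S => zetaProduct ζ S s) hmul
  simp only [zetaProduct_add] at hm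
  rw [hT, zetaProduct_add, zetaProduct_add, hs, h0]
  refine mul_right_cancel₀ hN ?_
  rw [mul_assoc, hq, mul_right_comm, ← hm]
  ring

end Multiset

end RootPairing.Base

/-! ### Polar and regular parts of the terms, and the iterated residue of the period. -/

theorem one_sub_natCast_cpow_ne_zero {q : ℕ} (hq : 2 ≤ q) {n : ℤ} (hn : n ≠ 0) :
    1 - (q : ℂ) ^ (-(n : ℂ)) ≠ 0 := by
  rw [sub_ne_zero, ← Int.cast_neg, Complex.cpow_intCast]
  intro h
  have h1 : (1 : ℝ) = (q : ℝ) ^ (-n) := by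
    have := congrArg norm h
    simpa using this
  rw [eq_comm, zpow_eq_one_iff_right₀ (by positivity)
    (by exact_mod_cast (by lia : q ≠ 1))] at h1
  lia

theorem analyticAt_natCast_cpow_neg {q : ℕ} (hq : 2 ≤ q) (z : ℂ) :
    AnalyticAt ℂ (fun z : ℂ => (q : ℂ) ^ (-z)) z := by
  have h0 : (q : ℂ) ≠ 0 := by exact_mod_cast (by lia : q ≠ 0)
  simp only [Complex.cpow_def_of_ne_zero h0]
  fun_prop

theorem eventually_one_sub_natCast_cpow_ne_zero {q : ℕ} (hq : 2 ≤ q) :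
    ∀ᶠ s in codiscrete ℂ, 1 - (q : ℂ) ^ (-s) ≠ 0 := by
  have ha : ∀ z, AnalyticAt ℂ (fun z : ℂ => 1 - (q : ℂ) ^ (-z)) z := fun z =>
    analyticAt_const.sub (analyticAt_natCast_cpow_neg hq z)
  refine Meromorphic.eventually_ne_zero_codiscrete (z := 1) (fun z => (ha z).meromorphicAt)
    (ha 1) ?_
  simpa using one_sub_natCast_cpow_ne_zero hq (n := 1) one_ne_zero

/-- `(1 - q^{-z})⁻¹` has a simple pole at `0`, with residue `1 / log q`. -/
theorem exists_inv_one_sub_natCast_cpow {q : ℕ} (hq : 2 ≤ q) :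
    ∃ ε : ℂ → ℂ, AnalyticAt ℂ ε 0 ∧ ε 0 ≠ 0 ∧
      ∀ z, z ≠ 0 → (1 - (q : ℂ) ^ (-z))⁻¹ = z⁻¹ * ε z := by
  have h0 : (q : ℂ) ≠ 0 := by exact_mod_cast (by lia : q ≠ 0)
  have hlog : Complex.log q ≠ 0 := by
    rw [Complex.natCast_log.symm]
    exact_mod_cast (Real.log_pos (by exact_mod_cast (by lia : 1 < q))).ne'
  have ha : AnalyticAt ℂ (fun z : ℂ => 1 - (q : ℂ) ^ (-z)) 0 :=
    analyticAt_const.sub (analyticAt_natCast_cpow_neg hq 0)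
  -- The divided difference removes the simple zero at `0`. It is analytic there with value the
  -- derivative `log q`, which is nonzero, so its inverse is the regular part.
  set d := dslope (fun z : ℂ => 1 - (q : ℂ) ^ (-z)) 0
  have hd0 : d 0 = Complex.log q := by
    have h1 : HasDerivAt (fun z : ℂ => 1 - Complex.exp (Complex.log q * -z)) (Complex.log q) 0 := by
      have h2 := ((((hasDerivAt_id (0 : ℂ)).neg).const_mul (Complex.log q)).cexp).const_sub 1
      simpa using h2
    have h3 : (fun z : ℂ => 1 - (q : ℂ) ^ (-z)) =
        fun z : ℂ => 1 - Complex.exp (Complex.log q * -z) := by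
      funext z
      rw [Complex.cpow_def_of_ne_zero h0]
    simp only [d, dslope_same, h3]
    exact h1.deriv
  have hda : AnalyticAt ℂ d 0 := by
    obtain ⟨p, hp⟩ := ha
    exact ⟨_, hp.has_fpower_series_dslope_fslope⟩
  refine ⟨fun z => (d z)⁻¹, hda.inv (by rwa [hd0]), by simpa [hd0] using hlog, fun z hz => ?_⟩
  have : d z = z⁻¹ * (1 - (q : ℂ) ^ (-z)) := by
    simp [d, dslope_of_ne _ hz, slope_def_field, div_eq_inv_mul]
  change _ = z⁻¹ * (d z)⁻¹
  rw [this, mul_inv, inv_inv, inv_mul_cancel_left₀ hz]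

namespace RootPairing.Base

variable {ι V N : Type*} [Fintype ι] [AddCommGroup V] [Module ℂ V] [AddCommGroup N] [Module ℂ N]
  {P : RootPairing ι ℂ V N} (b : P.Base) [P.IsRootSystem] [P.IsCrystallographic] [P.IsReduced]

/-- The pairing of `λ = ∑_j (1 + s_j) λ_j` with a coroot. -/
noncomputable def coordPairing (x : b.support → ℂ) (i : ι) : ℂ :=
  ∑ j, b.corootCoeff i j * (1 + x j)

theorem pairing_weightOfCoords (x : b.support → ℂ) (i : ι) :
    P.toLinearMap (b.weightOfCoords x) (P.coroot i) = b.coordPairing x i := by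
  simp only [weightOfCoords, coordPairing, map_sum, LinearMap.sum_apply, map_smul,
    LinearMap.smul_apply, pairing_fundamentalWeight_eq, smul_eq_mul]
  exact Finset.sum_congr rfl fun j _ => mul_comm _ _

theorem coordPairing_single [DecidableEq b.support] (p : b.support) (s : ℂ) (i : ι) :
    b.coordPairing (Pi.single p s) i = b.corootCoeff i p * s + b.corootHeight i := by
  simp only [coordPairing, mul_add, mul_one, Finset.sum_add_distrib, Pi.single_apply, mul_ite,
    mul_zero, Finset.sum_ite_eq', Finset.mem_univ, if_true, corootHeight, Int.cast_sum]
  rw [add_comm]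

theorem coordPairing_simple (x : b.support → ℂ) (j : b.support) :
    b.coordPairing x j = 1 + x j := by
  classical
  simp [coordPairing, corootCoeff_simple]

theorem analyticAt_coordPairing (x₀ : b.support → ℂ) (i : ι) :
    AnalyticAt ℂ (fun x => b.coordPairing x i) x₀ := by
  unfold coordPairing
  refine Finset.analyticAt_fun_sum _ fun j _ => analyticAt_const.mul (analyticAt_const.add ?_)
  exact (ContinuousLinearMap.proj (R := ℂ) (φ := fun _ : b.support => ℂ) j).analyticAt x₀

/-- Reindexing the product over simple roots by `w⁻¹` moves `w` from `λ` to the index set, so that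
all factors become functions of the same pairings with `λ`. -/
theorem periodTerm_weightOfCoords (q : ℕ) (ζ : ℂ → ℂ) (w : P.weylGroup) (x : b.support → ℂ) :
    b.periodTerm q ζ w (b.weightOfCoords x) =
      (∏ i with b.corootHeight (w • i) = 1, (1 - (q : ℂ) ^ (-(b.coordPairing x i - 1)))⁻¹) *
        ∏ i with 0 < b.corootHeight i ∧ b.corootHeight (w • i) < 0,
          ζ (b.coordPairing x i) / ζ (b.coordPairing x i + 1) := by
  classical
  unfold periodTerm
  congr 1
  · rw [one_div, ← Finset.prod_inv_distrib]
    refine Finset.prod_equiv (MulAction.toPerm w⁻¹) (fun i => ?_) fun i hi => ?_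
    · simp only [Finset.mem_filter, Finset.mem_univ, true_and, MulAction.toPerm_apply,
        smul_inv_smul, corootHeight_eq_one_iff]
    · rw [map_sub, LinearMap.sub_apply, weylGroup_smul_pairing', pairing_weightOfCoords,
        pairing_weylVector, b.corootHeight_eq_one_iff.2 hi, MulAction.toPerm_apply, Int.cast_one]
  · refine Finset.prod_congr ?_ fun i _ => by rw [pairing_weightOfCoords]
    ext i
    simp [mem_inversions_iff_corootHeight]

/-- The regular part of the term of `w` near `s_j = 0`, `j ≠ p`, where `ε` and `φ` are the regular
parts of `(1 - q^{-z})⁻¹` at `0` and of `ζ` at `1`. -/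
noncomputable def regularTerm (q : ℕ) (ζ ε φ : ℂ → ℂ) (p : b.support) (w : P.weylGroup)
    (y : ι → ℂ) : ℂ :=
  (∏ i with b.corootHeight i = 1 ∧ b.corootCoeff i p = 0,
    if b.corootHeight (w • i) = 1 then ε (y i - 1) else
      if b.corootHeight (w • i) < 0 then φ (y i - 1) else y i - 1) *
  (∏ i with b.corootHeight (w • i) = 1 ∧ ¬ (b.corootHeight i = 1 ∧ b.corootCoeff i p = 0),
    (1 - (q : ℂ) ^ (-(y i - 1)))⁻¹) *
  ((∏ i with b.corootCoeff i p = 0 ∧ 1 < b.corootHeight i ∧ b.corootHeight (w • i) < 0,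
      ζ (y i)) *
    ∏ i with b.corootCoeff i p = 0 ∧ 0 < b.corootHeight i ∧ b.corootHeight (w • i) < 0,
      (ζ (y i + 1))⁻¹) *
  ∏ i with 0 < b.corootCoeff i p ∧ b.corootHeight (w • i) < 0, ζ (y i) / ζ (y i + 1)

theorem regularTerm_single [DecidableEq b.support] (q : ℕ) (ζ ε φ : ℂ → ℂ) (p : b.support)
    (w : P.weylGroup) (s : ℂ) :
    b.regularTerm q ζ ε φ p w (b.coordPairing (Pi.single p s)) =
      b.explicitTerm q ζ (ε 0) (φ 0) p w s := by
  unfold regularTerm explicitTerm residueConstant simpleFactor leviFactor radicalFactor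
  simp only [coordPairing_single]
  congr 3
  · refine Finset.prod_congr rfl fun i hi => ?_
    simp only [Finset.mem_filter, Finset.mem_univ, true_and] at hi
    simp [hi.1, hi.2]
  · refine Finset.prod_congr rfl fun i hi => ?_
    simp only [Finset.mem_filter, Finset.mem_univ, true_and] at hi
    simp [hi.1]
  · refine Finset.prod_congr rfl fun i hi => ?_
    simp only [Finset.mem_filter, Finset.mem_univ, true_and] at hi
    simp [hi.1]

theorem prod_inv_coord {p : b.support} {l : List b.support} (hl : l.Nodup)
    (hlp : ∀ j, j ∈ l ↔ j ≠ p) (x : b.support → ℂ) :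
    (l.map fun j => (x j)⁻¹).prod =
      ∏ i with b.corootHeight i = 1 ∧ b.corootCoeff i p = 0, (b.coordPairing x i - 1)⁻¹ := by
  classical
  rw [← List.prod_toFinset _ hl]
  refine Finset.prod_bij (fun j _ => (j : ι)) (fun j hj => ?_) (fun i _ j _ h => Subtype.ext h)
    (fun i hi => ?_) fun j _ => by simp [coordPairing_simple]
  · simp only [Finset.mem_filter, Finset.mem_univ, true_and, ← mem_support_and_ne_iff]
    refine ⟨j.2, fun h => ?_⟩
    exact (hlp j).1 (by simpa using hj) (Subtype.ext h)
  · simp only [Finset.mem_filter, Finset.mem_univ, true_and, ← mem_support_and_ne_iff] at hi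
    refine ⟨⟨i, hi.1⟩, ?_, rfl⟩
    rw [List.mem_toFinset, hlp]
    exact fun h => hi.2 (congrArg Subtype.val h)

/-- The comparison is made root by root: a simple Levi root carries the factor `s_j⁻¹`, and every
other root falls in exactly the products prescribed by the signs of `k`, `h` and the height of `w
α`. The denominator `ζ(s_j + 2)` of a simple Levi root stays among the Levi factors. -/
theorem periodTerm_eq_mul_regularTerm {q : ℕ} {ζ ε φ : ℂ → ℂ} {p : b.support}
    {l : List b.support} (hl : l.Nodup) (hlp : ∀ j, j ∈ l ↔ j ≠ p) (w : P.weylGroup)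
    (x : b.support → ℂ)
    (hx : ∀ i, b.corootHeight i = 1 → b.corootCoeff i p = 0 → b.coordPairing x i - 1 ≠ 0 ∧
      (1 - (q : ℂ) ^ (-(b.coordPairing x i - 1)))⁻¹ =
        (b.coordPairing x i - 1)⁻¹ * ε (b.coordPairing x i - 1) ∧
      ζ (b.coordPairing x i) = (b.coordPairing x i - 1)⁻¹ * φ (b.coordPairing x i - 1)) :
    b.periodTerm q ζ w (b.weightOfCoords x) =
      (l.map fun j => (x j)⁻¹).prod * b.regularTerm q ζ ε φ p w (b.coordPairing x) := by
  rw [b.prod_inv_coord hl hlp, periodTerm_weightOfCoords]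
  unfold regularTerm
  simp only [Finset.prod_filter, ← Finset.prod_mul_distrib]
  refine Finset.prod_congr rfl fun i _ => ?_
  by_cases hA : b.corootHeight i = 1 ∧ b.corootCoeff i p = 0
  · obtain ⟨h0, h1, h2⟩ := hx i hA.1 hA.2
    rcases lt_trichotomy (b.corootHeight (w • i)) 0 with hw | hw | hw
    · have : b.corootHeight (w • i) ≠ 1 := by lia
      simp [hA.1, hA.2, hw, this, h2, div_eq_mul_inv, mul_assoc]
    · exact absurd hw (b.corootHeight_ne_zero _)
    -- If `w α_j` is positive but not simple, the term has no pole along `s_j = 0`. The regular part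
    -- then contains `y i - 1 = s_j`, which cancels the extracted `s_j⁻¹` and makes the residue
    -- vanish.
    · by_cases hw1 : b.corootHeight (w • i) = 1
      · simp [hA.1, hA.2, hw1, ← h1]
      · simp [hA.1, hA.2, hw1, not_lt.2 hw.le, h0]
  · have hk : 0 < b.corootHeight i → 0 ≤ b.corootCoeff i p :=
      b.corootCoeff_nonneg_of_corootHeight_pos p
    have hk' : 0 < b.corootCoeff i p → 0 < b.corootHeight i :=
      b.corootHeight_pos_of_corootCoeff_pos
    simp only [hA, if_false, one_mul, not_false_eq_true, and_true]
    rw [mul_assoc]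
    congr 1
    by_cases hw : b.corootHeight (w • i) < 0
    · simp only [hw, and_true]
      rcases lt_trichotomy (b.corootCoeff i p) 0 with hc | hc | hc
      · have h1 : ¬ 0 < b.corootHeight i := by lia
        have h2 : ¬ 0 < b.corootCoeff i p := by lia
        simp [h1, h2, hc.ne]
      · by_cases hh : 0 < b.corootHeight i
        · have h1 : 1 < b.corootHeight i := by
            have : b.corootHeight i ≠ 1 := fun h => hA ⟨h, hc⟩
            lia
          simp [hc, hh, h1, div_eq_mul_inv]
        · have h1 : ¬ 1 < b.corootHeight i := by lia
          simp [hc, hh, h1]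
      · simp [hc, hc.ne', hk' hc]
    · simp [hw]

end RootPairing.Base

theorem IsZetaLike.analyticAt_intCast {ζ : ℂ → ℂ} (hζ : IsZetaLike ζ) {n : ℤ} (hn : 2 ≤ n) :
    AnalyticAt ℂ ζ n := by
  lift n to ℕ using by lia
  exact_mod_cast hζ.analyticAt_natCast n (by lia)

theorem IsZetaLike.intCast_ne_zero {ζ : ℂ → ℂ} (hζ : IsZetaLike ζ) {n : ℤ} (hn : 2 ≤ n) :
    ζ n ≠ 0 := by
  lift n to ℕ using by lia
  exact_mod_cast hζ.natCast_ne_zero n (by lia)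

namespace RootPairing.Base

variable {ι V N : Type*} [Fintype ι] [AddCommGroup V] [Module ℂ V] [AddCommGroup N] [Module ℂ N]
  {P : RootPairing ι ℂ V N} (b : P.Base) [P.IsRootSystem] [P.IsCrystallographic] [P.IsReduced]

/-- All factors of the terms of the period, except for those with a pole along `s_j = 0`, are
regular at `λ = ρ + s λ_p`. -/
def IsGeneric (q : ℕ) (ζ : ℂ → ℂ) (p : b.support) (s : ℂ) : Prop :=
  ∀ i, (¬ (b.corootHeight i = 1 ∧ b.corootCoeff i p = 0) →
      1 - (q : ℂ) ^ (-(b.corootCoeff i p * s + b.corootHeight i - 1)) ≠ 0) ∧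
    (0 < b.corootCoeff i p → AnalyticAt ℂ ζ (b.corootCoeff i p * s + b.corootHeight i) ∧
      AnalyticAt ℂ ζ (b.corootCoeff i p * s + b.corootHeight i + 1) ∧
      ζ (b.corootCoeff i p * s + b.corootHeight i) ≠ 0 ∧
      ζ (b.corootCoeff i p * s + b.corootHeight i + 1) ≠ 0)

theorem eventually_isGeneric {q : ℕ} (hq : 2 ≤ q) {ζ : ℂ → ℂ} (hζ : IsZetaLike ζ)
    (p : b.support) : ∀ᶠ s in codiscrete ℂ, b.IsGeneric q ζ p s := by
  unfold IsGeneric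
  rw [eventually_all]
  intro i
  refine Eventually.and ?_ ?_
  · by_cases hk : b.corootCoeff i p = 0
    · refine Eventually.of_forall fun s h => ?_
      have h1 : b.corootHeight i - 1 ≠ 0 := fun h1 => h ⟨by lia, hk⟩
      simpa [hk] using one_sub_natCast_cpow_ne_zero hq h1
    · filter_upwards [(eventually_one_sub_natCast_cpow_ne_zero hq).comp_affine
        (a := b.corootCoeff i p) (by exact_mod_cast hk) (b.corootHeight i - 1)] with s hs _
      rwa [add_sub_assoc]
  · by_cases hk : 0 < b.corootCoeff i p
    · have hk' : (b.corootCoeff i p : ℂ) ≠ 0 := by exact_mod_cast hk.ne'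
      have h1 := hζ.meromorphic.eventually_analyticAt_codiscrete.comp_affine hk'
      have h2 := hζ.eventually_ne_zero.comp_affine hk'
      filter_upwards [h1 (b.corootHeight i), h1 (b.corootHeight i + 1), h2 (b.corootHeight i),
        h2 (b.corootHeight i + 1)] with s a1 a2 a3 a4 _
      rw [add_assoc]
      exact ⟨a1, a2, a3, a4⟩
    · simp [hk]

theorem analyticAt_comp_coordPairing [DecidableEq b.support] {f : ℂ → ℂ} {p : b.support} {s : ℂ}
    {i : ι} (hf : AnalyticAt ℂ f (b.corootCoeff i p * s + b.corootHeight i)) :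
    AnalyticAt ℂ (fun x => f (b.coordPairing x i)) (Pi.single p s) :=
  AnalyticAt.comp_of_eq hf (b.analyticAt_coordPairing _ i) (b.coordPairing_single p s i)

theorem analyticAt_regularTerm [DecidableEq b.support] {q : ℕ} (hq : 2 ≤ q) {ζ ε φ : ℂ → ℂ}
    (hζ : IsZetaLike ζ) (hε : AnalyticAt ℂ ε 0) (hφ : AnalyticAt ℂ φ 0) {p : b.support}
    {s : ℂ} (hs : b.IsGeneric q ζ p s) (w : P.weylGroup) :
    AnalyticAt ℂ (fun x => b.regularTerm q ζ ε φ p w (b.coordPairing x)) (Pi.single p s) := by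
  have hshift : ∀ (d z : ℂ) {f : ℂ → ℂ}, AnalyticAt ℂ f (z + d) →
      AnalyticAt ℂ (fun z => f (z + d)) z := fun d z f hf =>
    AnalyticAt.comp_of_eq hf (analyticAt_id.add analyticAt_const) rfl
  unfold regularTerm
  refine AnalyticAt.mul (AnalyticAt.mul (AnalyticAt.mul ?_ ?_) (AnalyticAt.mul ?_ ?_)) ?_
  · refine Finset.analyticAt_fun_prod _ fun i hi => ?_
    simp only [Finset.mem_filter, Finset.mem_univ, true_and] at hi
    have hL : AnalyticAt ℂ (fun x => b.coordPairing x i - 1) (Pi.single p s) :=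
      (b.analyticAt_coordPairing _ i).sub analyticAt_const
    have hL0 : b.coordPairing (Pi.single p s) i - 1 = 0 := by
      rw [coordPairing_single, hi.1, hi.2]; simp
    split_ifs
    · exact AnalyticAt.comp_of_eq hε hL hL0
    · exact AnalyticAt.comp_of_eq hφ hL hL0
    · exact hL
  · refine Finset.analyticAt_fun_prod _ fun i hi => ?_
    simp only [Finset.mem_filter, Finset.mem_univ, true_and] at hi
    refine b.analyticAt_comp_coordPairing (f := fun z => (1 - (q : ℂ) ^ (-(z - 1)))⁻¹) ?_
    refine AnalyticAt.inv ?_ ((hs i).1 hi.2)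
    exact analyticAt_const.sub (hshift (-1) _ (analyticAt_natCast_cpow_neg hq _))
  · refine Finset.analyticAt_fun_prod _ fun i hi => ?_
    simp only [Finset.mem_filter, Finset.mem_univ, true_and] at hi
    refine b.analyticAt_comp_coordPairing ?_
    simpa [hi.1] using hζ.analyticAt_intCast (by lia : 2 ≤ b.corootHeight i)
  · refine Finset.analyticAt_fun_prod _ fun i hi => ?_
    simp only [Finset.mem_filter, Finset.mem_univ, true_and] at hi
    refine b.analyticAt_comp_coordPairing (f := fun z => (ζ (z + 1))⁻¹) ?_
    refine AnalyticAt.inv (hshift 1 _ ?_) ?_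
    · simpa [hi.1] using hζ.analyticAt_intCast (by lia : 2 ≤ b.corootHeight i + 1)
    · simpa [hi.1] using hζ.intCast_ne_zero (by lia : 2 ≤ b.corootHeight i + 1)
  · refine Finset.analyticAt_fun_prod _ fun i hi => ?_
    simp only [Finset.mem_filter, Finset.mem_univ, true_and] at hi
    refine b.analyticAt_comp_coordPairing (f := fun z => ζ z / ζ (z + 1)) ?_
    obtain ⟨h1, h2, -, h4⟩ := (hs i).2 hi.1
    exact h1.div (hshift 1 _ h2) h4

section Residue

variable {q : ℕ} (hq : 2 ≤ q) {ζ ε φ : ℂ → ℂ} (hζ : IsZetaLike ζ) (hε : AnalyticAt ℂ ε 0)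
  (hεq : ∀ z, z ≠ 0 → (1 - (q : ℂ) ^ (-z))⁻¹ = z⁻¹ * ε z)
  (hφ : AnalyticAt ℂ φ 0) (hφζ : ∀ᶠ z in 𝓝[≠] 0, ζ (1 + z) = z⁻¹ * φ z)
  {p : b.support} {l : List b.support} (hl : l.Nodup) (hlp : ∀ j, j ∈ l ↔ j ≠ p)

include hq hζ hε hεq hφ hφζ hl hlp in
/-- The iterated residue of a sum of terms of the period. -/
theorem iteratedResidue_sum_periodTerm [DecidableEq b.support] (W : Finset P.weylGroup) {s : ℂ}
    (hs : b.IsGeneric q ζ p s) :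
    iteratedResidue l (fun x => ∑ w ∈ W, b.periodTerm q ζ w (b.weightOfCoords x))
      (Pi.single p s) = ∑ w ∈ W, b.explicitTerm q ζ (ε 0) (φ 0) p w s := by
  have han : AnalyticAt ℂ (fun x => ∑ w ∈ W, b.regularTerm q ζ ε φ p w (b.coordPairing x))
      (Pi.single p s) := Finset.analyticAt_fun_sum _ fun w _ =>
    b.analyticAt_regularTerm hq hζ hε hφ hs w
  have h1 : ∀ᶠ x in 𝓝 (Pi.single p s : b.support → ℂ), ∀ i, b.corootHeight i = 1 →
      b.corootCoeff i p = 0 → b.coordPairing x i - 1 ≠ 0 →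
      ζ (b.coordPairing x i) = (b.coordPairing x i - 1)⁻¹ * φ (b.coordPairing x i - 1) := by
    rw [eventually_all]
    intro i
    by_cases hi : b.corootHeight i = 1 ∧ b.corootCoeff i p = 0
    · have hL : Tendsto (fun x : b.support → ℂ => b.coordPairing x i - 1) (𝓝 (Pi.single p s))
          (𝓝 0) := by
        have hc : ContinuousAt (fun x : b.support → ℂ => b.coordPairing x i - 1)
            (Pi.single p s) :=
          (b.analyticAt_coordPairing (Pi.single p s) i).continuousAt.sub continuousAt_const
        have := hc.tendsto
        simpa [coordPairing_single, hi.1, hi.2] using this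
      filter_upwards [hL.eventually (eventually_nhdsWithin_iff.1 hφζ)] with x hx _ _ h0
      simpa using hx h0
    · exact Eventually.of_forall fun x ha hb => absurd ⟨ha, hb⟩ hi
  -- One polydisc serves all terms: on it the sum of regular parts is analytic and the expansion of
  -- `ζ` at `1` holds for every simple Levi coordinate. Genericity of `s` keeps the other
  -- singularities away.
  obtain ⟨r, hr, hball⟩ := Metric.eventually_nhds_iff_ball.1
    (han.eventually_analyticAt.and h1)
  rw [iteratedResidue_eq (Pi.single p s) hr l hl _
    (fun x => ∑ w ∈ W, b.regularTerm q ζ ε φ p w (b.coordPairing x))]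
  · exact Finset.sum_congr rfl fun w _ => b.regularTerm_single q ζ ε φ p w s
  · intro j hj
    simp [(hlp j).1 hj]
  · exact fun x hx => (hball x hx).1.differentiableAt.differentiableWithinAt
  · intro x hx hxl
    rw [Finset.mul_sum]
    refine Finset.sum_congr rfl fun w _ => ?_
    refine b.periodTerm_eq_mul_regularTerm hl hlp w x fun i hi1 hi2 => ?_
    have h0 : b.coordPairing x i - 1 ≠ 0 := by
      obtain ⟨hi, hip⟩ := (b.mem_support_and_ne_iff p i).2 ⟨hi1, hi2⟩
      have := b.coordPairing_simple x ⟨i, hi⟩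
      rw [this, add_sub_cancel_left]
      exact hxl _ ((hlp _).2 fun h => hip (congrArg Subtype.val h))
    exact ⟨h0, hεq _ h0, (hball x hx).2 i hi1 hi2 h0⟩

include hq hζ hε hεq hφ hφζ hl hlp in
theorem parabolicPeriodTerm_eq (w : P.weylGroup) :
    b.parabolicPeriodTerm q ζ p l w =ᶠ[codiscrete ℂ] b.explicitTerm q ζ (ε 0) (φ 0) p w := by
  classical
  filter_upwards [b.eventually_isGeneric hq hζ p] with s hs
  have := b.iteratedResidue_sum_periodTerm hq hζ hε hεq hφ hφζ hl hlp {w} hs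
  simp only [Finset.sum_singleton] at this
  rw [← this, parabolicPeriodTerm]

include hq hζ hε hεq hφ hφζ hl hlp in
theorem parabolicPeriod_eq :
    b.parabolicPeriod q ζ p l =ᶠ[codiscrete ℂ]
      fun s => ∑ w, b.explicitTerm q ζ (ε 0) (φ 0) p w s := by
  classical
  filter_upwards [b.eventually_isGeneric hq hζ p] with s hs
  rw [← b.iteratedResidue_sum_periodTerm hq hζ hε hεq hφ hφζ hl hlp Finset.univ hs,
    parabolicPeriod]
  congr!

include hq hζ hε hεq hφ hφζ hl hlp in
-- At a generic `s` all factors of the explicit term other than the residue constant are nonzero.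
-- This makes the analytic condition in the clearing property a purely combinatorial one.
theorem parabolicPeriodTerm_ne_zero_iff (hε0 : ε 0 ≠ 0) (hφ0 : φ 0 ≠ 0) (w : P.weylGroup) :
    ¬ (b.parabolicPeriodTerm q ζ p l w =ᶠ[codiscrete ℂ] 0) ↔ b.IsContributing p w := by
  have heq := b.parabolicPeriodTerm_eq hq hζ hε hεq hφ hφζ hl hlp w
  rw [← b.residueConstant_ne_zero_iff hε0 hφ0]
  constructor
  · intro h hc
    refine h (heq.trans (Eventually.of_forall fun s => ?_))
    simp [explicitTerm, hc]
  · intro hc h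
    have hev := (heq.symm.trans h).and (b.eventually_isGeneric hq hζ p)
    have : (codiscrete ℂ).NeBot := by
      refine ⟨fun hbot => ?_⟩
      have h1 : ∀ᶠ s in codiscrete ℂ, (fun _ : ℂ => False) s := by
        rw [hbot]; exact eventually_bot
      rw [eventually_codiscrete_iff] at h1
      exact (h1 0).exists.elim fun _ => id
    obtain ⟨s, hs0, hs⟩ := hev.exists
    refine absurd hs0 ?_
    change b.explicitTerm q ζ (ε 0) (φ 0) p w s ≠ 0
    unfold explicitTerm simpleFactor leviFactor radicalFactor
    refine mul_ne_zero (mul_ne_zero (mul_ne_zero hc ?_) (mul_ne_zero ?_ ?_)) ?_ <;>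
      rw [Finset.prod_ne_zero_iff] <;> intro i hi <;>
      simp only [Finset.mem_filter, Finset.mem_univ, true_and] at hi
    · exact inv_ne_zero ((hs i).1 hi.2)
    · exact hζ.intCast_ne_zero (by lia)
    · exact inv_ne_zero (by exact_mod_cast hζ.intCast_ne_zero (by lia : 2 ≤ b.corootHeight i + 1))
    · exact div_ne_zero ((hs i).2 hi.1).2.2.1 ((hs i).2 hi.1).2.2.2

end Residue

/-! ### Meromorphy and the functional equation over an abstract zeta function. -/

theorem meromorphic_comp_affine {f : ℂ → ℂ} (hf : Meromorphic f) (a b : ℂ) :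
    Meromorphic fun s => f (a * s + b) := fun s =>
  (hf (a * s + b)).comp_analyticAt (g := fun s => a * s + b) (by fun_prop)

theorem meromorphic_zetaProduct {ζ : ℂ → ℂ} (hζ : Meromorphic ζ) (S : Multiset (ℂ × ℂ)) :
    Meromorphic (zetaProduct ζ S) := by
  induction S using Multiset.induction_on with
  | empty =>
    have : zetaProduct ζ 0 = fun _ => 1 := by
      funext s; simp [zetaProduct]
    rw [this]
    exact fun x => MeromorphicAt.const 1 x
  | cons a S ih =>
    have : zetaProduct ζ (a ::ₘ S) = fun s => ζ (a.1 * s + a.2) * zetaProduct ζ S s := by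
      funext s; simp [zetaProduct]
    rw [this]
    exact fun x => (meromorphic_comp_affine hζ _ _ x).mul (ih x)

theorem meromorphic_explicitTerm {q : ℕ} (hq : 2 ≤ q) {ζ : ℂ → ℂ} (hζ : Meromorphic ζ) (e r : ℂ)
    (p : b.support) (w : P.weylGroup) : Meromorphic (b.explicitTerm q ζ e r p w) := by
  intro x
  unfold explicitTerm simpleFactor radicalFactor
  refine MeromorphicAt.mul (MeromorphicAt.mul (MeromorphicAt.mul (MeromorphicAt.const _ _) ?_)
    (MeromorphicAt.const _ _)) ?_
  · refine MeromorphicAt.fun_prod fun i _ => MeromorphicAt.inv ?_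
    refine (MeromorphicAt.const 1 x).sub ?_
    have := meromorphic_comp_affine (fun z => (analyticAt_natCast_cpow_neg hq z).meromorphicAt)
      (b.corootCoeff i p) (b.corootHeight i - 1) x
    simpa only [← add_sub_assoc] using this
  · refine MeromorphicAt.fun_prod fun i _ => MeromorphicAt.div ?_ ?_
    · exact meromorphic_comp_affine hζ _ _ x
    · simpa only [← add_assoc] using
        meromorphic_comp_affine hζ (b.corootCoeff i p) (b.corootHeight i + 1) x

/-- Functional equation of the zeta function of `(G, P)` built from a zeta function `ζ`. -/
theorem functionalEquation {q : ℕ} (hq : 2 ≤ q) {ζ : ℂ → ℂ} (hζ : IsZetaLike ζ) (p : b.support)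
    {l : List b.support} (hl : l.Nodup) (hlp : ∀ j, j ∈ l ↔ j ≠ p) :
    (∃! S : Multiset (ℂ × ℂ), b.IsMinimalClearing q ζ p l S) ∧
    ∀ S : Multiset (ℂ × ℂ), b.IsMinimalClearing q ζ p l S →
      Meromorphic (b.parabolicZeta q ζ p l S) ∧
      ∀ᶠ s in codiscrete ℂ,
        b.parabolicZeta q ζ p l S (-b.levelConstant p - s) = b.parabolicZeta q ζ p l S s := by
  obtain ⟨ε, hε, hε0, hεq⟩ := exists_inv_one_sub_natCast_cpow hq
  obtain ⟨φ, hφ, hφ0, hφζ⟩ := hζ.simple_pole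
  obtain ⟨w₀, hw₀⟩ := b.exists_corootHeight_smul_eq_neg
  obtain ⟨c, wp, hc, hwpk, hwph⟩ := b.exists_levi_longest p
  have hmin := b.isMinimalClearing_iff (q := q) (ζ := ζ) (l := l)
    (b.parabolicPeriodTerm_ne_zero_iff hq hζ hε hεq hφ hφζ hl hlp hε0 hφ0)
  refine ⟨⟨_, (hmin _).2 rfl, fun S hS => (hmin S).1 hS⟩, fun S hS => ?_⟩
  rw [(hmin S).1 hS]
  have heq : b.parabolicZeta q ζ p l (b.clearingFamily p (b.IsContributing p)) =ᶠ[codiscrete ℂ]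
      fun s => zetaProduct ζ (b.clearingFamily p (b.IsContributing p)) s *
        ∑ w, b.explicitTerm q ζ (ε 0) (φ 0) p w s := by
    filter_upwards [b.parabolicPeriod_eq hq hζ hε hεq hφ hφζ hl hlp] with s hs
    rw [parabolicZeta, hs, zetaProduct]
  constructor
  · refine Meromorphic.congr_codiscrete (fun x => ?_) heq.symm
    refine (meromorphic_zetaProduct hζ.meromorphic _ x).mul ?_
    exact MeromorphicAt.fun_sum fun w _ => b.meromorphic_explicitTerm hq hζ.meromorphic _ _ p w x
  · rw [hc]
    have heq' : ∀ᶠ s in codiscrete ℂ,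
        b.parabolicZeta q ζ p l (b.clearingFamily p (b.IsContributing p)) (-c - s) =
          zetaProduct ζ (b.clearingFamily p (b.IsContributing p)) (-c - s) *
            ∑ w, b.explicitTerm q ζ (ε 0) (φ 0) p w (-c - s) := by
      have := Eventually.comp_affine heq (a := -1) (by simp) (-c)
      filter_upwards [this] with s hs
      have h1 : (-c - s : ℂ) = -1 * s + -c := by ring
      rw [h1]
      exact hs
    -- The period gains `radicalQuotient` at `s`, and the product over the clearing family loses it.
    filter_upwards [heq, heq', b.sum_explicitTerm_neg_sub hw₀ hwpk hwph q hζ (ε 0) (φ 0),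
      b.zetaProduct_clearingFamily hw₀ hwpk hwph hζ] with s h1 h2 h3 h4
    rw [h1, h2, h3, ← h4]
    ring

end RootPairing.Base

/-! ### Function fields: relations over `k(x)`, and finiteness over every transcendental element. -/

section FunctionField

variable {k F : Type*} [Field k] [Field F] [Algebra k F]

open scoped IntermediateField.algebraAdjoinAdjoin in
/-- Elements linearly dependent over `k(x)` satisfy a relation with coefficients in `k[x]` not all
of which vanish at `x = 0`. -/
theorem exists_polynomial_relation {x : F} (hx : Transcendental k x) {ι : Type*} [Fintype ι]
    {f : ι → F} (hf : ¬ LinearIndependent (IntermediateField.adjoin k {x}) f) :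
    ∃ p : ι → Polynomial k, ∑ i, Polynomial.aeval x (p i) * f i = 0 ∧ ∃ i, (p i).coeff 0 ≠ 0 := by
  have hx0 : x ≠ 0 := by rintro rfl; exact hx isAlgebraic_zero
  have h1 : ¬ LinearIndependent (Algebra.adjoin k {x}) f := by
    rwa [LinearIndependent.iff_fractionRing (R := Algebra.adjoin k {x})
      (K := IntermediateField.adjoin k {x})]
  rw [Fintype.not_linearIndependent_iff] at h1
  obtain ⟨g, hg, i₀, hi₀⟩ := h1
  have h2 : ∀ i, ∃ p : Polynomial k, Polynomial.aeval x p = (g i : F) := fun i => by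
    have h : ∀ y ∈ Algebra.adjoin k {x}, ∃ p : Polynomial k, Polynomial.aeval x p = y := by
      rw [Algebra.adjoin_singleton_eq_range_aeval]
      exact fun y hy => hy
    exact h _ (g i).2
  choose p hp using h2
  have h3 : ∑ i, Polynomial.aeval x (p i) * f i = 0 := by
    rw [← hg]
    exact Finset.sum_congr rfl fun i _ => by rw [hp, Algebra.smul_def]; rfl
  have h4 : p i₀ ≠ 0 := by
    intro h
    apply hi₀
    ext
    rw [← hp, h]; simp
  clear hp hi₀ hg
  -- A relation all of whose coefficients vanish at `0` can be divided by `x`, which lowers the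
  -- degree of a fixed nonzero coefficient; the process must stop.
  generalize hn : (p i₀).natDegree = n
  induction n using Nat.strong_induction_on generalizing p with
  | _ n ih =>
    by_cases h : ∃ i, (p i).coeff 0 ≠ 0
    · exact ⟨p, h3, h⟩
    push Not at h
    have h5 : ∀ i, ∃ r, p i = Polynomial.X * r := fun i => Polynomial.X_dvd_iff.2 (h i)
    choose r hr using h5
    have hr0 : r i₀ ≠ 0 := fun h => h4 (by rw [hr, h, mul_zero])
    refine ih (r i₀).natDegree ?_ r ?_ hr0 rfl
    · rw [← hn, hr, Polynomial.natDegree_X_mul hr0]; omega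
    · refine (mul_eq_zero.1 ?_).resolve_left hx0
      rw [Finset.mul_sum, ← h3]
      refine Finset.sum_congr rfl fun i _ => ?_
      rw [hr]; simp [mul_assoc]

open scoped IntermediateField.algebraAdjoinAdjoin in
theorem eq_zero_of_sum_aeval_mul_eq_zero {x : F} (hx : Transcendental k x) {ι : Type*} [Fintype ι]
    {f : ι → F} (hf : LinearIndependent (IntermediateField.adjoin k {x}) f)
    {p : ι → Polynomial k} (hp : ∑ i, Polynomial.aeval x (p i) * f i = 0) : p = 0 := by
  have h1 : LinearIndependent (Algebra.adjoin k {x}) f := by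
    rwa [LinearIndependent.iff_fractionRing (R := Algebra.adjoin k {x})
      (K := IntermediateField.adjoin k {x})]
  rw [Fintype.linearIndependent_iff] at h1
  have h2 := h1 (fun i => ⟨Polynomial.aeval x (p i), Polynomial.aeval_mem_adjoin_singleton k x⟩) (by
    rw [← hp]
    exact Finset.sum_congr rfl fun i _ => by rw [Algebra.smul_def]; rfl)
  funext i
  have h3 : Polynomial.aeval x (p i) = 0 := congrArg Subtype.val (h2 i)
  by_contra h
  exact hx ⟨p i, h, h3⟩

open scoped IntermediateField.algebraAdjoinAdjoin in
-- The transcendence degree is at most one, so any transcendental `z` is a transcendence basis. Then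
-- `F` is algebraic and finitely generated over `k(z)`.
theorem IsFunctionFieldOfOneVariable.finiteDimensional_adjoin
    (hF : IsFunctionFieldOfOneVariable k F) {z : F} (hz : Transcendental k z) :
    FiniteDimensional (IntermediateField.adjoin k {z}) F := by
  obtain ⟨x, hx, hfin⟩ := hF
  have : Algebra.EssFiniteType k (IntermediateField.adjoin k {x}) :=
    IntermediateField.essFiniteType_iff.2 ⟨{x}, by simp⟩
  have : Algebra.EssFiniteType k F := Algebra.EssFiniteType.comp k (IntermediateField.adjoin k {x}) F
  have : Algebra.EssFiniteType (IntermediateField.adjoin k {z}) F := Algebra.EssFiniteType.of_comp k _ F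
  have : Algebra.IsAlgebraic (Algebra.adjoin k {x}) F :=
    Algebra.IsAlgebraic.trans _ (IntermediateField.adjoin k {x}) _
  have h1 : Algebra.trdeg k F ≤ Cardinal.mk ({x} : Set F) := Algebra.IsAlgebraic.trdeg_le_cardinalMk k {x}
  have h2 := (algebraicIndependent_unique_type_iff (ι := ({z} : Set F)) (R := k) (x := Subtype.val)).2 hz
  have h3 : IsTranscendenceBasis k (Subtype.val : ({z} : Set F) → F) :=
    h2.isTranscendenceBasis_of_trdeg_le_of_finite (by simpa using h1)
  have h4 := h3.isAlgebraic_field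
  rw [Subtype.range_coe] at h4
  obtain ⟨S, hS⟩ := IntermediateField.fg_top (IntermediateField.adjoin k {z}) F
  have h5 := IntermediateField.finiteDimensional_adjoin (K := IntermediateField.adjoin k {z})
    (S := (S : Set F)) fun y _ => (h4.isAlgebraic y).isIntegral
  rw [hS] at h5
  exact Module.Finite.equiv IntermediateField.topEquiv.toLinearEquiv

end FunctionField

/-! ### Places: existence of poles. -/

section Places

variable {k F : Type*} [Field k] [Field F] [Algebra k F]

theorem Valuation.isTrivialOn_of_le_one {Γ : Type*} [LinearOrderedCommGroupWithZero Γ]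
    {v : Valuation F Γ} (hv : ∀ c : k, v (algebraMap k F c) ≤ 1) : v.IsTrivialOn k where
  eq_one c hc := by
    refine le_antisymm (hv c) ?_
    have h := hv c⁻¹
    rw [map_inv₀, map_inv₀] at h
    have h0 : v (algebraMap k F c) ≠ 0 := by simpa using hc
    exact (inv_le_one₀ (zero_lt_iff.2 h0)).1 h

theorem Valuation.aeval_le_one {Γ : Type*} [LinearOrderedCommGroupWithZero Γ]
    {v : Valuation F Γ} (hv : ∀ c : k, v (algebraMap k F c) ≤ 1) {x : F} (hx : v x ≤ 1)
    (p : Polynomial k) : v (Polynomial.aeval x p) ≤ 1 := by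
  rw [Polynomial.aeval_eq_sum_range]
  refine v.map_sum_le fun i _ => ?_
  rw [Algebra.smul_def, map_mul, map_pow]
  exact mul_le_one' (hv _) (pow_le_one' hx i)

theorem Valuation.aeval_le_of_coeff_zero_eq_zero {Γ : Type*} [LinearOrderedCommGroupWithZero Γ]
    {v : Valuation F Γ} (hv : ∀ c : k, v (algebraMap k F c) ≤ 1) {x : F} (hx : v x ≤ 1)
    {p : Polynomial k} (hp : p.coeff 0 = 0) : v (Polynomial.aeval x p) ≤ v x := by
  obtain ⟨r, rfl⟩ := Polynomial.X_dvd_iff.2 hp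
  rw [map_mul, Polynomial.aeval_X, map_mul]
  exact mul_le_of_le_one_right' (Valuation.aeval_le_one hv hx r)

theorem Valuation.aeval_eq_one_of_coeff_zero_ne_zero {Γ : Type*}
    [LinearOrderedCommGroupWithZero Γ]
    {v : Valuation F Γ} (hv : ∀ c : k, v (algebraMap k F c) ≤ 1) {x : F} (hx : v x < 1)
    {p : Polynomial k} (hp : p.coeff 0 ≠ 0) : v (Polynomial.aeval x p) = 1 := by
  have := Valuation.isTrivialOn_of_le_one hv
  have h1 : v (Polynomial.aeval x (p - Polynomial.C (p.coeff 0))) < 1 :=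
    (Valuation.aeval_le_of_coeff_zero_eq_zero hv hx.le (by simp)).trans_lt hx
  have h2 : v (algebraMap k F (p.coeff 0)) = 1 := Valuation.IsTrivialOn.eq_one _ hp
  have h3 : Polynomial.aeval x p =
      Polynomial.aeval x (p - Polynomial.C (p.coeff 0)) + algebraMap k F (p.coeff 0) := by simp
  rw [h3, Valuation.map_add_eq_of_lt_right _ (by rwa [h2]), h2]

/-- Elements with distinct values in the interval `(v x, 1]` are linearly independent over
`k(x)`. -/
theorem Valuation.linearIndependent_of_injective {Γ : Type*} [LinearOrderedCommGroupWithZero Γ]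
    {v : Valuation F Γ} (hv : ∀ c : k, v (algebraMap k F c) ≤ 1) {x : F} (hx0 : x ≠ 0)
    (hx : v x < 1) {ι : Type*} [Fintype ι] {a : ι → F} (ha : Function.Injective fun i => v (a i))
    (ha1 : ∀ i, v x < v (a i)) (ha2 : ∀ i, v (a i) ≤ 1) :
    LinearIndependent (IntermediateField.adjoin k {x}) a := by
  classical
  by_contra h
  have := Valuation.isTrivialOn_of_le_one hv
  obtain ⟨p, hp, i, hi⟩ := exists_polynomial_relation
    (Valuation.transcendental_of_ne_one k x hx0 hx.ne) h
  -- Among the terms whose coefficient is a unit at `x = 0`, the one with the largest value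
  -- dominates: the remaining coefficients are divisible by `x` and give values at most `v x`. So
  -- the sum cannot vanish.
  obtain ⟨j, hj, hj'⟩ := Finset.exists_max_image (Finset.univ.filter fun i => (p i).coeff 0 ≠ 0)
    (fun i => v (a i)) ⟨i, by simpa using hi⟩
  simp only [Finset.mem_filter, Finset.mem_univ, true_and] at hj hj'
  have h1 : v (Polynomial.aeval x (p j) * a j) = v (a j) := by
    rw [map_mul, Valuation.aeval_eq_one_of_coeff_zero_ne_zero hv hx hj, one_mul]
  have h2 : v (∑ i, Polynomial.aeval x (p i) * a i) = v (a j) := by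
    rw [← h1]
    refine Valuation.map_sum_eq_of_lt _ (Finset.mem_univ j) fun i hi => ?_
    rw [h1, map_mul]
    by_cases h : (p i).coeff 0 = 0
    · calc _ ≤ v x * 1 := mul_le_mul' (Valuation.aeval_le_of_coeff_zero_eq_zero hv hx.le h) (ha2 i)
        _ = v x := mul_one _
        _ < _ := ha1 j
    · rw [Valuation.aeval_eq_one_of_coeff_zero_ne_zero hv hx h, one_mul]
      refine lt_of_le_of_ne (hj' i h) fun h' => ?_
      simp only [Finset.mem_sdiff, Finset.mem_univ, Finset.mem_singleton, true_and] at hi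
      exact hi (ha h')
  rw [hp, map_zero] at h2
  exact absurd (ha1 j) (by simp [← h2])

/-- An infinite ascending chain of ideals yields elements `a n` of strictly increasing value,
bounded by `1`. All later ones lie in `(v (a 1), 1]`, so more than `[F : k(a 1)]` of them would be
independent over `k(a 1)`. -/
theorem ValuationSubring.isNoetherianRing_of_isFunctionField
    (hF : IsFunctionFieldOfOneVariable k F) (B : ValuationSubring F)
    (hB : ∀ c : k, algebraMap k F c ∈ B) : IsNoetherianRing B := by
  have hv : ∀ c : k, B.valuation (algebraMap k F c) ≤ 1 := fun c => (B.valuation_le_one_iff _).2 (hB c)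
  rw [isNoetherianRing_iff, isNoetherian_iff']
  by_contra h
  rw [WellFoundedGT, isWellFounded_iff, wellFounded_iff_isEmpty_descending_chain, not_isEmpty_iff] at h
  obtain ⟨I, hI⟩ := h
  have h1 : ∀ n, ∃ a : B, a ∈ I (n + 1) ∧ a ∉ I n := fun n => SetLike.exists_of_lt (hI n)
  choose a ha ha' using h1
  have h2 : ∀ n, B.valuation (a n) < B.valuation (a (n + 1)) := by
    intro n
    by_contra! h
    obtain ⟨c, hc⟩ := (B.valuation_le_iff _ _).1 h
    apply ha' (n + 1)
    have : a (n + 1) = c * a n := Subtype.ext hc.symm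
    rw [this]
    exact Ideal.mul_mem_left _ _ (ha n)
  have h3 : StrictMono fun n => B.valuation (a n : F) := strictMono_nat_of_lt_succ h2
  have h4 : ∀ n, B.valuation (a n : F) ≤ 1 := fun n => B.valuation_le_one _
  have h5 : (a 1 : F) ≠ 0 := by
    intro h
    have := h2 0
    simp [h] at this
  have h6 : B.valuation (a 1 : F) < 1 := (h2 1).trans_le (h4 2)
  have := Valuation.isTrivialOn_of_le_one hv
  have h7 := hF.finiteDimensional_adjoin (Valuation.transcendental_of_ne_one k _ h5 h6.ne)
  have h8 := Valuation.linearIndependent_of_injective hv h5 h6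
    (a := fun i : Fin (Module.finrank (IntermediateField.adjoin k {(a 1 : F)}) F + 1) =>
      (a (i + 2) : F)) (fun i j hij => by
        have := h3.injective hij
        exact Fin.ext (by simpa using this))
    (fun i => h3 (by omega)) (fun i => h4 _)
  have h9 := h8.fintype_card_le_finrank
  simp at h9

/-- The valuation of a closed point. -/
def CurvePoint.valuation (v : CurvePoint k F) : Valuation F ℤᵐ⁰ := v.1

/-- A zero of `y = f⁻¹` is found. The ideal `(y)` of `k[y]` is proper since `y` is transcendental,
so some valuation ring has `y` as a nonunit; being Noetherian and not a field, it is a discrete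
valuation ring, and its normalised valuation is the point. -/
theorem CurvePoint.exists_one_lt (hF : IsFunctionFieldOfOneVariable k F) {f : F}
    (hf : Transcendental k f) : ∃ v : CurvePoint k F, 1 < v.valuation f := by
  set y := f⁻¹ with hy
  have hyt : Transcendental k y := by rwa [hy, Transcendental, IsAlgebraic.inv_iff]
  have hy0 : y ≠ 0 := by rintro h; rw [h] at hyt; exact hyt isAlgebraic_zero
  let A : Subring F := (Algebra.adjoin k {y}).toSubring
  let y' : A := ⟨y, Algebra.self_mem_adjoin_singleton k y⟩
  have hI : Ideal.span {y'} ≠ ⊤ := by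
    rw [Ne, Ideal.span_singleton_eq_top]
    intro h
    obtain ⟨z, hz⟩ := h.exists_right_inv
    have hz2 : (z : F) ∈ Algebra.adjoin k {y} := z.2
    rw [Algebra.adjoin_singleton_eq_range_aeval] at hz2
    obtain ⟨p, hp⟩ := hz2
    have h1 : Polynomial.aeval y (Polynomial.X * p - 1) = 0 := by
      have h2 : y * (z : F) = 1 := congrArg Subtype.val hz
      have h3 : Polynomial.aeval y p = (z : F) := hp
      rw [map_sub, map_mul, Polynomial.aeval_X, h3, h2, map_one, sub_self]
    refine hyt ⟨_, fun h => ?_, h1⟩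
    have := congrArg (fun p => p.coeff 0) h
    simp at this
  obtain ⟨B, hAB, hB⟩ := Ideal.image_subset_nonunits_valuationSubring _ hI
  have hBk : ∀ c : k, algebraMap k F c ∈ B := fun c => hAB (Subalgebra.algebraMap_mem _ c)
  have hyB : y ∈ B := hAB y'.2
  have hyn : y ∈ B.nonunits := hB ⟨y', Ideal.mem_span_singleton_self _, rfl⟩
  have := B.isNoetherianRing_of_isFunctionField hF hBk
  have hpid : IsPrincipalIdealRing B := inferInstance
  have hymax : (⟨y, hyB⟩ : B) ∈ IsLocalRing.maximalIdeal B := by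
    rw [IsLocalRing.mem_maximalIdeal]
    exact (B.coe_mem_nonunits_iff (a := ⟨y, hyB⟩)).1 hyn
  have hdvr : IsDiscreteValuationRing B :=
    { not_a_field' := by
        intro h
        rw [h] at hymax
        exact hy0 (congrArg Subtype.val ((Submodule.mem_bot B).1 hymax)) }
  let P : IsDedekindDomain.HeightOneSpectrum B := IsDiscreteValuationRing.maximalIdeal B
  refine ⟨⟨P.valuation F, P.valuation_surjective F, fun c => ?_⟩, ?_⟩
  · exact P.valuation_le_one (K := F) ⟨_, hBk c⟩
  · have h1 : P.valuation F y < 1 :=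
      (P.valuation_lt_one_iff_mem (K := F) ⟨y, hyB⟩).2 hymax
    change 1 < P.valuation F f
    rw [← inv_inv f, ← hy, map_inv₀]
    exact (one_lt_inv₀ (zero_lt_iff.2 (by simpa using hy0))).2 h1

end Places

/-! ### Absolute values of closed points and weak approximation. -/

namespace CurvePoint

variable {k F : Type*} [Field k] [Field F] [Algebra k F]

/-- The absolute value of a closed point. -/
noncomputable def absoluteValue (v : CurvePoint k F) : AbsoluteValue F ℝ where
  toFun f := (WithZeroMulInt.toNNReal two_ne_zero (v.valuation f) : ℝ)
  map_mul' f g := by simp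
  nonneg' f := NNReal.coe_nonneg _
  eq_zero' f := by simp
  add_le' f g := by
    rw [← NNReal.coe_add, NNReal.coe_le_coe]
    have h := (WithZeroMulInt.toNNReal_strictMono (e := 2) one_lt_two).monotone (v.valuation.map_add f g)
    refine h.trans ?_
    rw [(WithZeroMulInt.toNNReal_strictMono (e := 2) one_lt_two).monotone.map_max]
    exact max_le_add_of_nonneg zero_le zero_le

theorem absoluteValue_apply (v : CurvePoint k F) (f : F) :
    v.absoluteValue f = (WithZeroMulInt.toNNReal two_ne_zero (v.valuation f) : ℝ) := rfl

theorem absoluteValue_le_absoluteValue_iff (v : CurvePoint k F) {f g : F} :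
    v.absoluteValue f ≤ v.absoluteValue g ↔ v.valuation f ≤ v.valuation g := by
  rw [absoluteValue_apply, absoluteValue_apply, NNReal.coe_le_coe]
  exact (WithZeroMulInt.toNNReal_strictMono (e := 2) one_lt_two).le_iff_le

theorem surjective_valuation (v : CurvePoint k F) : Function.Surjective v.valuation := v.2.1

theorem valuation_algebraMap_le_one (v : CurvePoint k F) (c : k) :
    v.valuation (algebraMap k F c) ≤ 1 := v.2.2 c

theorem ext_valuation {v w : CurvePoint k F} (h : v.valuation = w.valuation) : v = w :=
  Subtype.ext h

theorem exists_apply_eq_exp (v : CurvePoint k F) (n : ℤ) : ∃ f : F, f ≠ 0 ∧ v.valuation f = WithZero.exp n := by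
  obtain ⟨f, hf⟩ := v.surjective_valuation (WithZero.exp n)
  refine ⟨f, ?_, hf⟩
  rintro rfl
  rw [map_zero] at hf
  exact WithZero.exp_ne_zero hf.symm

/-- Equivalence forces `log w = m · log v`, with `m` the logarithm of `w` at an element where `log v
= 1`. Since `w` is normalised, `m` divides `1`, and it is positive. -/
theorem eq_of_isEquiv {v w : CurvePoint k F} (h : v.absoluteValue.IsEquiv w.absoluteValue) :
    v = w := by
  have hle : ∀ f g, v.valuation f ≤ v.valuation g ↔ w.valuation f ≤ w.valuation g := fun f g => by
    rw [← absoluteValue_le_absoluteValue_iff, ← absoluteValue_le_absoluteValue_iff]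
    exact h f g
  have heq : ∀ f g, v.valuation f = v.valuation g → w.valuation f = w.valuation g := fun f g h' =>
    le_antisymm ((hle _ _).1 h'.le) ((hle _ _).1 h'.ge)
  obtain ⟨x, hx0, hx⟩ := v.exists_apply_eq_exp 1
  have hxw : w.valuation x = WithZero.exp (WithZero.log (w.valuation x)) :=
    (WithZero.exp_log (by simpa using hx0)).symm
  set m := WithZero.log (w.valuation x)
  have h1 : ∀ f, f ≠ 0 → w.valuation f = WithZero.exp (WithZero.log (v.valuation f) * m) := by
    intro f hf
    have h2 : v.valuation f = v.valuation (x ^ WithZero.log (v.valuation f)) := by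
      rw [map_zpow₀, hx, ← WithZero.exp_zsmul, smul_eq_mul, mul_one,
        WithZero.exp_log (by simpa using hf)]
    rw [heq _ _ h2, map_zpow₀, hxw, ← WithZero.exp_zsmul, smul_eq_mul]
  have hm : m = 1 := by
    obtain ⟨y, hy0, hy⟩ := w.exists_apply_eq_exp 1
    have h2 := h1 y hy0
    rw [hy, WithZero.exp_inj] at h2
    have h3 : 1 ≤ m := by
      have h4 : ¬ w.valuation x ≤ w.valuation 1 := fun h' => by
        have := (hle _ _).2 h'
        rw [hx, map_one, ← WithZero.exp_zero, WithZero.exp_le_exp] at this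
        omega
      rw [map_one, ← WithZero.exp_zero, hxw, WithZero.exp_le_exp] at h4
      omega
    exact Int.eq_one_of_mul_eq_one_left (by omega) h2.symm
  refine ext_valuation (Valuation.ext fun f => ?_)
  by_cases hf : f = 0
  · simp [hf]
  · rw [h1 f hf, hm, mul_one, WithZero.exp_log (by simpa using hf)]

/-- Weak approximation. -/
theorem exists_sub_le (S : Finset (CurvePoint k F)) (g : CurvePoint k F → F)
    (n : CurvePoint k F → ℤ) : ∃ f : F, ∀ v ∈ S, v.valuation (f - g v) ≤ WithZero.exp (n v) := by
  have h1 := AbsoluteValue.denseRange_algebraMap_pi (F := F) (ι := S)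
    (v := fun v => v.1.absoluteValue) (fun v => by
      obtain ⟨x, hx0, hx⟩ := v.1.exists_apply_eq_exp 1
      refine ⟨x, hx0, fun h => ?_⟩
      have h2 := (v.1.absoluteValue_le_absoluteValue_iff (f := x) (g := 1)).1 (by simp [h])
      rw [hx, map_one, ← WithZero.exp_zero, WithZero.exp_le_exp] at h2
      omega) (fun v w hvw h => hvw (Subtype.ext (eq_of_isEquiv h)))
  choose c hc0 hc using fun v : CurvePoint k F => v.exists_apply_eq_exp (n v)
  let U : Set ((v : S) → WithAbs v.1.absoluteValue) :=
    Set.univ.pi fun v => Metric.ball (WithAbs.toAbs _ (g v)) (v.1.absoluteValue (c v))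
  have hU : IsOpen U := isOpen_set_pi Set.finite_univ fun v _ => Metric.isOpen_ball
  obtain ⟨f, hf⟩ := h1.exists_mem_open hU ⟨fun v => WithAbs.toAbs _ (g v), fun v _ =>
    Metric.mem_ball_self (v.1.absoluteValue.pos (hc0 v))⟩
  refine ⟨f, fun v hv => ?_⟩
  have h2 := hf ⟨v, hv⟩ trivial
  rw [Metric.mem_ball, dist_eq_norm] at h2
  have h3 : v.absoluteValue (f - g v) < v.absoluteValue (c v) := h2
  rw [← hc v]
  exact v.absoluteValue_le_absoluteValue_iff.1 h3.le

end CurvePoint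

/-! ### Indices of additive groups, residue degrees, and the number of zeros of a function. -/

namespace CurvePoint

variable {k F : Type*} [Field k] [Field F] [Algebra k F]

/-- The elements of order at least `-n` at a closed point. -/
def ball (v : CurvePoint k F) (n : ℤ) : AddSubgroup F where
  carrier := {f | v.valuation f ≤ WithZero.exp n}
  zero_mem' := by simp
  add_mem' {f g} hf hg := (v.valuation.map_add f g).trans (max_le hf hg)
  neg_mem' {f} hf := by simpa [Valuation.map_neg] using hf

theorem mem_ball {v : CurvePoint k F} {n : ℤ} {f : F} :
    f ∈ v.ball n ↔ v.valuation f ≤ WithZero.exp n := Iff.rfl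

theorem ball_mono (v : CurvePoint k F) {m n : ℤ} (h : m ≤ n) : v.ball m ≤ v.ball n :=
  fun _ hf => (mem_ball.1 hf).trans (WithZero.exp_le_exp.2 h)

theorem map_mulLeft_ball (v : CurvePoint k F) {x : F} {m : ℤ}
    (hx : v.valuation x = WithZero.exp m) (n : ℤ) :
    (v.ball n).map (AddMonoidHom.mulLeft x) = v.ball (m + n) := by
  have hx0 : x ≠ 0 := by rintro rfl; rw [map_zero] at hx; exact WithZero.exp_ne_zero hx.symm
  ext f
  simp only [AddSubgroup.mem_map, AddMonoidHom.coe_mulLeft, mem_ball]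
  constructor
  · rintro ⟨g, hg, rfl⟩
    rw [map_mul, hx, WithZero.exp_add]
    exact mul_le_mul_right hg _
  · intro hf
    refine ⟨x⁻¹ * f, ?_, by field_simp⟩
    rw [map_mul, map_inv₀, hx, ← WithZero.exp_neg]
    calc _ ≤ WithZero.exp (-m) * WithZero.exp (m + n) := mul_le_mul_right hf _
      _ = _ := by rw [← WithZero.exp_add]; congr 1; ring

/-- The number of elements of the residue field of a closed point. -/
noncomputable def residueCard (v : CurvePoint k F) : ℕ := (v.ball (-1)).relIndex (v.ball 0)

theorem relIndex_ball_add_one (v : CurvePoint k F) (n : ℤ) :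
    (v.ball n).relIndex (v.ball (n + 1)) = v.residueCard := by
  obtain ⟨x, hx0, hx⟩ := v.exists_apply_eq_exp (n + 1)
  have h1 := map_mulLeft_ball v hx (-1)
  have h2 := map_mulLeft_ball v hx 0
  rw [show n + 1 + -1 = n by ring] at h1
  rw [add_zero] at h2
  rw [residueCard, ← h1, ← h2, AddSubgroup.relIndex_map_map_of_injective]
  exact mul_right_injective₀ hx0

theorem relIndex_ball_add_natCast (v : CurvePoint k F) (n : ℤ) (d : ℕ) :
    (v.ball n).relIndex (v.ball (n + d)) = v.residueCard ^ d := by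
  induction d with
  | zero => simp
  | succ d ih =>
    rw [← AddSubgroup.relIndex_mul_relIndex _ (v.ball (n + d)) _ (v.ball_mono (by simp))
      (v.ball_mono (by push_cast; omega)), ih, pow_succ]
    congr 1
    push_cast
    rw [← add_assoc]
    exact v.relIndex_ball_add_one _

theorem natCard_residueField (v : CurvePoint k F) :
    Nat.card (IsLocalRing.ResidueField v.valuation.valuationSubring) = v.residueCard := by
  let O := v.valuation.valuationSubring
  let i : O →+ F := O.subtype.toAddMonoidHom
  let r : O →+ IsLocalRing.ResidueField O := (IsLocalRing.residue O).toAddMonoidHom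
  have h1 : (v.ball 0) = (⊤ : AddSubgroup O).map i := by
    ext f
    rw [AddSubgroup.mem_map, mem_ball, WithZero.exp_zero]
    exact ⟨fun h => ⟨⟨f, h⟩, trivial, rfl⟩, by rintro ⟨g, -, rfl⟩; exact g.2⟩
  have h2 : (v.ball (-1)).comap i = r.ker := by
    ext f
    rw [AddMonoidHom.mem_ker, AddSubgroup.mem_comap, mem_ball]
    have h3 : r f = 0 ↔ f ∈ IsLocalRing.maximalIdeal O := IsLocalRing.residue_eq_zero_iff f
    have h4 : IsUnit f ↔ v.valuation (f : F) = 1 := Valuation.Integers.isUnit_iff_valuation_eq_one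
      (Valuation.integer.integers v.valuation) (x := f)
    rw [h3, IsLocalRing.mem_maximalIdeal, mem_nonunits_iff, h4]
    have h4 : v.valuation (f : F) ≤ 1 := f.2
    change v.valuation (f : F) ≤ _ ↔ ¬ v.valuation (f : F) = 1
    constructor
    · intro h h'
      rw [h', ← WithZero.exp_zero, WithZero.exp_le_exp] at h
      omega
    · intro h
      by_cases h0 : v.valuation (f : F) = 0
      · rw [h0]; exact zero_le
      · have h5 := lt_of_le_of_ne h4 h
        rw [← WithZero.exp_log h0, ← WithZero.exp_zero, WithZero.exp_lt_exp] at h5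
        rw [← WithZero.exp_log h0, WithZero.exp_le_exp]
        omega
  rw [residueCard, h1, ← AddSubgroup.relIndex_comap, h2, AddSubgroup.relIndex_top_right,
    AddSubgroup.index_ker, AddMonoidHom.range_eq_top.2 IsLocalRing.residue_surjective]
  exact (Nat.card_congr (AddSubgroup.topEquiv.toEquiv)).symm

/-- The families with order at least `-D v` at every closed point `v`. -/
def box (D : CurvePoint k F → ℤ) : AddSubgroup (CurvePoint k F → F) :=
  AddSubgroup.pi Set.univ fun v => v.ball (D v)

theorem mem_box {D : CurvePoint k F → ℤ} {a : CurvePoint k F → F} :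
    a ∈ box D ↔ ∀ v, v.valuation (a v) ≤ WithZero.exp (D v) := by
  simp [box, AddSubgroup.mem_pi, mem_ball]

theorem box_mono {D E : CurvePoint k F → ℤ} (h : D ≤ E) : box D ≤ box E :=
  fun _ ha => mem_box.2 fun v => (mem_box.1 ha v).trans (WithZero.exp_le_exp.2 (h v))

/-- The smaller box is cut out of the larger one by the condition at `v` alone, so evaluation at `v`
reduces the index to that of two balls. -/
theorem relIndex_box_of_eq_off (v : CurvePoint k F) (d : ℕ) {D E : CurvePoint k F → ℤ}
    (hv : E v = D v + d) (hE : ∀ w ≠ v, E w = D w) :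
    (box D).relIndex (box E) = v.residueCard ^ d := by
  classical
  have h1 : (v.ball (D v)).comap (Pi.evalAddMonoidHom (fun _ : CurvePoint k F => F) v) ⊓ box E =
      box D := by
    ext a
    simp only [AddSubgroup.mem_inf, AddSubgroup.mem_comap, mem_box, mem_ball,
      Pi.evalAddMonoidHom_apply]
    constructor
    · rintro ⟨h, h'⟩ w
      by_cases hw : w = v
      · rw [hw]; exact h
      · rw [← hE w hw]; exact h' w
    · refine fun h => ⟨h v, fun w => (h w).trans (WithZero.exp_le_exp.2 ?_)⟩
      by_cases hw : w = v
      · rw [hw, hv]; omega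
      · rw [hE w hw]
  have h2 : (box E).map (Pi.evalAddMonoidHom (fun _ : CurvePoint k F => F) v) = v.ball (D v + d) := by
    ext f
    simp only [AddSubgroup.mem_map, mem_box, mem_ball, Pi.evalAddMonoidHom_apply]
    constructor
    · rintro ⟨a, ha, rfl⟩
      rw [← hv]; exact ha v
    · intro hf
      refine ⟨Pi.single v f, fun w => ?_, by simp⟩
      by_cases hw : w = v
      · subst hw; rw [hv]; simpa using hf
      · simp [hw]
  rw [← h1, AddSubgroup.inf_relIndex_right, AddSubgroup.relIndex_comap, h2,
    relIndex_ball_add_natCast]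

theorem relIndex_box_add (D : CurvePoint k F → ℤ) (E : CurvePoint k F →₀ ℕ) :
    (box D).relIndex (box fun v => D v + E v) = E.prod fun v n => v.residueCard ^ n := by
  classical
  induction E using Finsupp.induction with
  | zero => simp
  | single_add v n E hv hn ih =>
    rw [Finsupp.prod_add_index' (fun _ => pow_zero _) (fun _ _ _ => pow_add _ _ _),
      Finsupp.prod_single_index (h := fun (v : CurvePoint k F) n => v.residueCard ^ n) (pow_zero _),
      ← ih, mul_comm,
      ← AddSubgroup.relIndex_mul_relIndex _ (box fun v => D v + E v) _
        (box_mono fun v => by simp) (box_mono fun v => by simp)]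
    congr 1
    refine relIndex_box_of_eq_off v n ?_ fun w hw => ?_
    · simp; ring
    · simp [hw.symm]

end CurvePoint

/-- The hypothesis says that any `n + 1` vectors of `O` are dependent modulo `I`, so the quotient
has dimension at most `n` and at most `|k| ^ n` elements. -/
theorem Submodule.relIndex_le_pow {k V : Type*} [Field k] [Finite k] [AddCommGroup V] [Module k V]
    {I O : Submodule k V} {n : ℕ}
    (h : ∀ g : Fin (n + 1) → V, (∀ i, g i ∈ O) → ∃ c : Fin (n + 1) → k, c ≠ 0 ∧ ∑ i, c i • g i ∈ I) :
    I.toAddSubgroup.relIndex O.toAddSubgroup ≠ 0 ∧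
      I.toAddSubgroup.relIndex O.toAddSubgroup ≤ Nat.card k ^ n := by
  let Q := O ⧸ I.submoduleOf O
  have h1 : I.toAddSubgroup.relIndex O.toAddSubgroup = Nat.card Q := rfl
  have h2 : Module.rank k Q ≤ n := by
    refine _root_.rank_le fun s hs => ?_
    by_contra! hcard
    obtain ⟨t, hts, ht⟩ := Finset.exists_subset_card_eq (show n + 1 ≤ s.card from hcard)
    let e : Fin (n + 1) ≃ t := (finCongr ht.symm).trans t.equivFin.symm
    have hli : LinearIndependent k (fun i : Fin (n + 1) => ((e i : t) : Q)) := by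
      have h3 : LinearIndependent k (fun i : t => (i : Q)) :=
        hs.comp (fun i : t => (⟨i, hts i.2⟩ : s)) fun i j hij =>
          Subtype.ext (congrArg (fun z : s => (z : Q)) hij)
      exact h3.comp e e.injective
    choose g hg using fun i => Submodule.mkQ_surjective (I.submoduleOf O) ((e i : t) : Q)
    obtain ⟨c, hc0, hc⟩ := h (fun i => (g i : V)) (fun i => (g i).2)
    refine hc0 (funext fun i => Fintype.linearIndependent_iff.1 hli c ?_ i)
    have h4 : ∑ i, c i • ((e i : t) : Q) = (I.submoduleOf O).mkQ (∑ i, c i • g i) := by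
      rw [map_sum]
      exact Finset.sum_congr rfl fun i _ => by rw [map_smul, hg]
    rw [h4, Submodule.mkQ_apply, Submodule.Quotient.mk_eq_zero]
    change ((∑ i, c i • g i : O) : V) ∈ I
    simpa using hc
  have h3 : Module.Finite k Q :=
    Module.rank_lt_aleph0_iff.1 (h2.trans_lt (Cardinal.natCast_lt_aleph0))
  have h4 : Module.finrank k Q ≤ n := Module.finrank_le_of_rank_le h2
  have : 1 < Nat.card k := Finite.one_lt_card
  rw [h1, Module.natCard_eq_pow_finrank (K := k)]
  exact ⟨by positivity, Nat.pow_le_pow_right (by omega) h4⟩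

namespace CurvePoint

variable {k F : Type*} [Field k] [Field F] [Algebra k F]

/-- The elements `f` with `v f ≤ exp (n v)` at all places `v ∈ S`. -/
def semilocal (S : Finset (CurvePoint k F)) (n : CurvePoint k F → ℤ) : Submodule k F where
  carrier := {f | ∀ v ∈ S, v.valuation f ≤ WithZero.exp (n v)}
  zero_mem' := by simp
  add_mem' {f g} hf hg v hv := (v.valuation.map_add f g).trans (max_le (hf v hv) (hg v hv))
  smul_mem' c f hf v hv := by
    rw [Algebra.smul_def, map_mul]
    exact (mul_le_of_le_one_left' (v.valuation_algebraMap_le_one c)).trans (hf v hv)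

theorem mem_semilocal {S : Finset (CurvePoint k F)} {n : CurvePoint k F → ℤ} {f : F} :
    f ∈ semilocal S n ↔ ∀ v ∈ S, v.valuation f ≤ WithZero.exp (n v) := Iff.rfl

/-- This is the Chinese remainder theorem: by weak approximation the diagonal image of the semilocal
ring surjects onto the product of the local quotients at the points of `S`. -/
theorem relIndex_semilocal (S : Finset (CurvePoint k F)) (e : CurvePoint k F → ℕ) :
    (semilocal S fun v => -(e v : ℤ)).toAddSubgroup.relIndex (semilocal S 0).toAddSubgroup =
      ∏ v ∈ S, v.residueCard ^ e v := by
  classical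
  let δ : F →+ (CurvePoint k F → F) :=
    { toFun := fun f v => if v ∈ S then f else 0
      map_zero' := by ext v; simp
      map_add' := fun f g => by ext v; by_cases h : v ∈ S <;> simp [h] }
  let D : CurvePoint k F → ℤ := fun v => if v ∈ S then -(e v : ℤ) else 0
  let E : CurvePoint k F →₀ ℕ := Finsupp.onFinset S (fun v => if v ∈ S then e v else 0)
    fun v hv => by by_contra h; simp [h] at hv
  have h1 : (box D).comap δ = (semilocal S fun v => -(e v : ℤ)).toAddSubgroup := by
    ext f
    rw [AddSubgroup.mem_comap, mem_box, Submodule.mem_toAddSubgroup, mem_semilocal]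
    refine forall_congr' fun v => ?_
    by_cases h : v ∈ S <;> simp [h, δ, D]
  have h2 : (semilocal S 0).toAddSubgroup.map δ ⊔ box D = box (fun v => D v + E v) := by
    have hDE : ∀ v, D v + E v = 0 := fun v => by by_cases h : v ∈ S <;> simp [h, D, E]
    simp_rw [hDE]
    apply le_antisymm
    · refine sup_le ?_ (box_mono fun v => ?_)
      · rintro _ ⟨f, hf, rfl⟩
        refine mem_box.2 fun v => ?_
        by_cases h : v ∈ S
        · simpa [δ, h] using mem_semilocal.1 hf v h
        · simp [δ, h]
      · by_cases h : v ∈ S <;> simp [h, D]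
    · intro a ha
      obtain ⟨f, hf⟩ := exists_sub_le S a fun v => -(e v : ℤ)
      rw [← sub_add_cancel a (δ f), add_comm]
      have hmem : δ f - a ∈ box D := by
        refine mem_box.2 fun v => ?_
        by_cases h : v ∈ S
        · simpa [δ, D, h] using hf v h
        · simpa [δ, D, h, Valuation.map_neg] using mem_box.1 ha v
      refine add_mem (AddSubgroup.mem_sup_left (AddSubgroup.mem_map_of_mem _ ?_))
        (AddSubgroup.mem_sup_right (by simpa using neg_mem hmem))
      refine mem_semilocal.2 fun v hv => ?_
      have h3 := v.valuation.map_add (f - a v) (a v)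
      rw [sub_add_cancel] at h3
      refine h3.trans (max_le ((hf v hv).trans (WithZero.exp_le_exp.2 ?_)) (mem_box.1 ha v))
      simp
  rw [← h1, AddSubgroup.relIndex_comap, ← AddSubgroup.relIndex_sup_right, h2, relIndex_box_add,
    Finsupp.onFinset_prod _ (fun _ => pow_zero _)]
  exact Finset.prod_congr rfl fun v hv => by simp [hv]

variable [Finite k]

/-- Any `[F : k(x)] + 1` elements satisfy a relation over `k[x]` whose constant terms `p i (0)` are
not all zero. Modulo multiples of `x` it is a nontrivial `k`-linear relation, so the semilocal ring
modulo `x` has dimension at most `[F : k(x)]`. -/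
theorem relIndex_semilocal_bound (hF : IsFunctionFieldOfOneVariable k F) {x : F}
    (hx : Transcendental k x) {S : Finset (CurvePoint k F)} {e : CurvePoint k F → ℕ}
    (he : ∀ v ∈ S, v.valuation x = WithZero.exp (-(e v : ℤ))) :
    ∏ v ∈ S, v.residueCard ^ e v ≠ 0 ∧
      ∏ v ∈ S, v.residueCard ^ e v ≤
        Nat.card k ^ Module.finrank (IntermediateField.adjoin k {x}) F := by
  rw [← relIndex_semilocal]
  refine Submodule.relIndex_le_pow fun g hg => ?_
  have := hF.finiteDimensional_adjoin hx
  obtain ⟨p, hp, i, hi⟩ := exists_polynomial_relation hx (f := g) (fun h => by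
    have := h.fintype_card_le_finrank
    simp at this)
  refine ⟨fun i => (p i).coeff 0, fun h => hi (congrFun h i), mem_semilocal.2 fun v hv => ?_⟩
  have hx1 : v.valuation x ≤ 1 := by
    rw [he v hv, ← WithZero.exp_zero, WithZero.exp_le_exp]; omega
  have h1 : ∑ i, (p i).coeff 0 • g i =
      - ∑ i, Polynomial.aeval x (p i - Polynomial.C ((p i).coeff 0)) * g i := by
    rw [eq_neg_iff_add_eq_zero, ← hp, ← Finset.sum_add_distrib]
    refine Finset.sum_congr rfl fun i _ => ?_
    rw [map_sub, Polynomial.aeval_C, Algebra.smul_def]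
    ring
  rw [h1, Valuation.map_neg, ← he v hv]
  refine Valuation.map_sum_le _ fun i _ => ?_
  rw [map_mul]
  calc _ ≤ v.valuation x * 1 := mul_le_mul'
        (Valuation.aeval_le_of_coeff_zero_eq_zero v.valuation_algebraMap_le_one hx1 (by simp))
        (by simpa using mem_semilocal.1 (hg i) v hv)
    _ = _ := mul_one _

theorem transcendental_of_apply_ne_one (v : CurvePoint k F) {x : F} (hx0 : x ≠ 0)
    (hx : v.valuation x ≠ 1) : Transcendental k x := by
  have := Valuation.isTrivialOn_of_le_one v.valuation_algebraMap_le_one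
  exact Valuation.transcendental_of_ne_one k x hx0 hx

theorem residueCard_ne_zero (hF : IsFunctionFieldOfOneVariable k F) (v : CurvePoint k F) :
    v.residueCard ≠ 0 := by
  obtain ⟨x, hx0, hx⟩ := v.exists_apply_eq_exp (-1)
  have h1 := (relIndex_semilocal_bound hF (v.transcendental_of_apply_ne_one hx0 (by rw [hx]; simp))
    (S := {v}) (e := fun _ => 1) (by simpa using hx)).1
  simpa using h1

theorem residueCard_eq_and_degree_pos (hF : IsFunctionFieldOfOneVariable k F)
    (v : CurvePoint k F) : v.residueCard = Nat.card k ^ v.degree ∧ 0 < v.degree := by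
  have h0 := v.residueCard_ne_zero hF
  rw [← natCard_residueField] at h0 ⊢
  have : Finite (IsLocalRing.ResidueField v.1.valuationSubring) := Nat.finite_of_card_ne_zero h0
  let _ := v.constHom.toAlgebra
  have : Module.Finite k (IsLocalRing.ResidueField v.1.valuationSubring) := inferInstance
  exact ⟨Module.natCard_eq_pow_finrank (K := k) (V := IsLocalRing.ResidueField v.1.valuationSubring),
    Module.finrank_pos (R := k) (M := IsLocalRing.ResidueField v.1.valuationSubring)⟩

theorem residueCard_eq (hF : IsFunctionFieldOfOneVariable k F)
    (v : CurvePoint k F) : v.residueCard = Nat.card k ^ v.degree :=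
  (v.residueCard_eq_and_degree_pos hF).1

theorem degree_pos (hF : IsFunctionFieldOfOneVariable k F) (v : CurvePoint k F) : 0 < v.degree :=
  (v.residueCard_eq_and_degree_pos hF).2

theorem sum_zeros_le_finrank (hF : IsFunctionFieldOfOneVariable k F) {x : F}
    (hx : Transcendental k x) {S : Finset (CurvePoint k F)} {e : CurvePoint k F → ℕ}
    (he : ∀ v ∈ S, v.valuation x = WithZero.exp (-(e v : ℤ))) :
    ∑ v ∈ S, e v * v.degree ≤ Module.finrank (IntermediateField.adjoin k {x}) F := by
  have h1 := (relIndex_semilocal_bound hF hx he).2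
  have h2 : ∏ v ∈ S, v.residueCard ^ e v = Nat.card k ^ ∑ v ∈ S, e v * v.degree := by
    rw [← Finset.prod_pow_eq_pow_sum]
    refine Finset.prod_congr rfl fun v _ => ?_
    rw [v.residueCard_eq hF, ← pow_mul, mul_comm]
  rw [h2] at h1
  exact (Nat.pow_le_pow_iff_right Finite.one_lt_card).1 h1

/-- Each zero adds at least `1` to a sum bounded by `[F : k(x)]`. -/
theorem finite_setOf_lt_one (hF : IsFunctionFieldOfOneVariable k F) {x : F} (hx : x ≠ 0) :
    {v : CurvePoint k F | v.valuation x < 1}.Finite := by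
  by_contra h
  obtain ⟨v, hv⟩ := Set.Infinite.nonempty h
  have hxt := v.transcendental_of_apply_ne_one hx (ne_of_lt hv)
  obtain ⟨S, hS, hcard⟩ := Set.Infinite.exists_subset_card_eq h
    (Module.finrank (IntermediateField.adjoin k {x}) F + 1)
  have hneg : ∀ v ∈ S, WithZero.log (v.valuation x) < 0 := fun v hv => by
    have : v.valuation x < 1 := hS hv
    rwa [← WithZero.exp_log (show v.valuation x ≠ 0 by simpa using hx), ← WithZero.exp_zero,
      WithZero.exp_lt_exp] at this
  have h1 := sum_zeros_le_finrank hF hxt (S := S)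
    (e := fun v => (-WithZero.log (v.valuation x)).toNat) (fun v hv => by
      have := hneg v hv
      rw [Int.toNat_of_nonneg (by omega), neg_neg, WithZero.exp_log (by simpa using hx)])
  have h2 : S.card ≤ ∑ v ∈ S, (-WithZero.log (v.valuation x)).toNat * v.degree := by
    rw [Finset.card_eq_sum_ones]
    refine Finset.sum_le_sum fun v hv => ?_
    have h3 := hneg v hv
    have h4 := v.degree_pos hF
    exact Nat.mul_pos (by omega) h4
  omega

theorem finite_setOf_one_lt (hF : IsFunctionFieldOfOneVariable k F) (x : F) :
    {v : CurvePoint k F | 1 < v.valuation x}.Finite := by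
  by_cases hx : x = 0
  · simp [hx]
  · have h : {v : CurvePoint k F | 1 < v.valuation x} = {v | v.valuation x⁻¹ < 1} := by
      ext v
      rw [Set.mem_ofPred_eq, Set.mem_ofPred_eq, map_inv₀,
        inv_lt_one₀ (zero_lt_iff.2 (by simpa using hx))]
    rw [h]
    exact finite_setOf_lt_one hF (inv_ne_zero hx)

end CurvePoint

/-! ### Riemann-Roch spaces, principal divisors and Riemann's inequality. -/

namespace CurvePoint

variable {k F : Type*} [Field k] [Field F] [Algebra k F]

/-- The degree of a divisor. -/
noncomputable def divisorDegree : (CurvePoint k F →₀ ℤ) →+ ℤ :=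
  Finsupp.liftAddHom fun v => AddMonoidHom.mulRight (v.degree : ℤ)

theorem divisorDegree_eq_sum (D : CurvePoint k F →₀ ℤ) :
    divisorDegree D = D.sum fun v n => n * (v.degree : ℤ) := rfl

theorem divisorDegree_single (v : CurvePoint k F) (n : ℤ) :
    divisorDegree (Finsupp.single v n) = n * v.degree := by
  rw [divisorDegree_eq_sum, Finsupp.sum_single_index (by simp)]

theorem divisorDegree_mapRange (G : CurvePoint k F →₀ ℕ) :
    divisorDegree (G.mapRange Nat.cast Nat.cast_zero) = (G.sum fun v n => n * v.degree : ℕ) := by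
  rw [divisorDegree_eq_sum, Finsupp.sum_mapRange_index (by simp), Finsupp.sum, Finsupp.sum]
  push_cast
  rfl

theorem divisorDegree_nonneg {D : CurvePoint k F →₀ ℤ} (h : 0 ≤ D) : 0 ≤ divisorDegree D := by
  rw [divisorDegree_eq_sum]
  exact Finset.sum_nonneg fun v _ => mul_nonneg (h v) (Int.natCast_nonneg _)

theorem divisorDegree_mono {D E : CurvePoint k F →₀ ℤ} (h : D ≤ E) :
    divisorDegree D ≤ divisorDegree E := by
  have := divisorDegree_nonneg (sub_nonneg.2 h)
  rw [map_sub] at this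
  omega

/-- The dimension of the Riemann-Roch space. -/
noncomputable def dimension (D : CurvePoint k F →₀ ℤ) : ℕ := Module.finrank k (riemannRochSpace D)

theorem mem_riemannRochSpace {D : CurvePoint k F →₀ ℤ} {x : F} :
    x ∈ riemannRochSpace D ↔ ∀ v : CurvePoint k F, v.valuation x ≤ WithZero.exp (D v) := Iff.rfl

theorem riemannRochSpace_mono {D E : CurvePoint k F →₀ ℤ} (h : D ≤ E) :
    riemannRochSpace D ≤ riemannRochSpace E :=
  fun _ hx v => (hx v).trans (WithZero.exp_le_exp.2 (h v))

variable (k F) in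
/-- The diagonal embedding of the function field. -/
def diagonal : F →+ (CurvePoint k F → F) := Pi.constAddMonoidHom _ _

theorem comap_diagonal_box (D : CurvePoint k F →₀ ℤ) :
    (box D).comap (diagonal k F) = (riemannRochSpace D).toAddSubgroup := by
  ext x
  rw [AddSubgroup.mem_comap, mem_box]
  exact Iff.rfl

variable [Finite k]

theorem relIndex_box (hF : IsFunctionFieldOfOneVariable k F) {D E : CurvePoint k F →₀ ℤ}
    (h : D ≤ E) :
    (box D).relIndex (box E) = Nat.card k ^ (divisorDegree E - divisorDegree D).toNat := by
  obtain ⟨G, h1⟩ : ∃ G : CurvePoint k F →₀ ℕ, ∀ v, (G v : ℤ) = E v - D v :=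
    ⟨(E - D).mapRange Int.toNat rfl, fun v => by
      have := h v
      simp only [Finsupp.mapRange_apply, Finsupp.sub_apply]
      omega⟩
  have h2 : (E : CurvePoint k F → ℤ) = fun v => D v + G v := by
    funext v; rw [h1]; ring
  have h3 : divisorDegree E - divisorDegree D = (G.sum fun v n => n * v.degree : ℕ) := by
    have h4 : E - D = G.mapRange Nat.cast Nat.cast_zero := by
      ext v; rw [Finsupp.mapRange_apply, h1, Finsupp.sub_apply]
    rw [← map_sub, h4, divisorDegree_mapRange]
  rw [h2, relIndex_box_add, h3, Int.toNat_natCast, Finsupp.sum, ← Finset.prod_pow_eq_pow_sum]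
  refine Finset.prod_congr rfl fun v _ => ?_
  simp only [v.residueCard_eq hF, ← pow_mul, mul_comm]

/-- The spaces are the traces of the boxes on the diagonal field, so their quotient embeds in the
quotient of the boxes. -/
theorem relIndex_riemannRochSpace (hF : IsFunctionFieldOfOneVariable k F)
    {D E : CurvePoint k F →₀ ℤ} (h : D ≤ E) :
    (riemannRochSpace D).toAddSubgroup.relIndex (riemannRochSpace E).toAddSubgroup ≠ 0 ∧
    (riemannRochSpace D).toAddSubgroup.relIndex (riemannRochSpace E).toAddSubgroup ≤
      Nat.card k ^ (divisorDegree E - divisorDegree D).toNat := by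
  have h0 : (box D).relIndex (box E) ≠ 0 := by
    rw [relIndex_box hF h]; exact pow_ne_zero _ Nat.card_pos.ne'
  have h1 : (riemannRochSpace E).toAddSubgroup.map (diagonal k F) ≤ box E := by
    rw [← comap_diagonal_box]; exact AddSubgroup.map_comap_le _ _
  rw [← comap_diagonal_box D, AddSubgroup.relIndex_comap, ← relIndex_box hF h]
  exact ⟨fun h2 => h0 (AddSubgroup.relIndex_eq_zero_of_le_right h1 h2),
    AddSubgroup.relIndex_le_of_le_right h1 h0⟩

theorem nonempty (hF : IsFunctionFieldOfOneVariable k F) : Nonempty (CurvePoint k F) := by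
  obtain ⟨x, hx, -⟩ := id hF
  obtain ⟨v, -⟩ := exists_one_lt hF hx
  exact ⟨v⟩

/-- A nonzero element would have a zero but no pole; a zero makes it transcendental, and
transcendental elements have poles. The degree of principal divisors is not yet available at this
point. -/
theorem riemannRochSpace_eq_bot (hF : IsFunctionFieldOfOneVariable k F)
    {D : CurvePoint k F →₀ ℤ} (hD : D < 0) : riemannRochSpace D = ⊥ := by
  rw [eq_bot_iff]
  intro x hx
  rw [mem_riemannRochSpace] at hx
  by_contra hx0
  rw [Submodule.mem_bot] at hx0
  have hx1 : ∀ v : CurvePoint k F, v.valuation x ≤ 1 := fun v =>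
    (hx v).trans (by rw [← WithZero.exp_zero, WithZero.exp_le_exp]; exact hD.le v)
  obtain ⟨v, hv⟩ : ∃ v, D v < 0 := by
    by_contra! h
    exact hD.not_ge h
  have h1 : v.valuation x < 1 :=
    (hx v).trans_lt (by rwa [← WithZero.exp_zero, WithZero.exp_lt_exp])
  obtain ⟨w, hw⟩ := exists_one_lt hF (v.transcendental_of_apply_ne_one hx0 h1.ne)
  exact hw.not_ge (hx1 w)

theorem finite_riemannRochSpace (hF : IsFunctionFieldOfOneVariable k F)
    (D : CurvePoint k F →₀ ℤ) : Finite (riemannRochSpace D) := by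
  obtain ⟨v⟩ := nonempty hF
  -- A negative divisor below `D`: its space is zero and has finite index in that of `D`.
  have h1 : D ⊓ (-Finsupp.single v 1) < 0 := by
    refine lt_of_le_of_lt inf_le_right ?_
    rw [neg_lt_zero]
    exact lt_of_le_of_ne (by simp) (by simp [eq_comm])
  have h2 := (relIndex_riemannRochSpace hF (inf_le_left : D ⊓ (-Finsupp.single v 1) ≤ D)).1
  rw [riemannRochSpace_eq_bot hF h1, Submodule.bot_toAddSubgroup, AddSubgroup.relIndex_bot_left] at h2
  exact Nat.finite_of_card_ne_zero h2

theorem card_riemannRochSpace (hF : IsFunctionFieldOfOneVariable k F)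
    (D : CurvePoint k F →₀ ℤ) : Nat.card (riemannRochSpace D) = Nat.card k ^ dimension D := by
  have := finite_riemannRochSpace hF D
  exact Module.natCard_eq_pow_finrank

theorem relIndex_riemannRochSpace_mul (hF : IsFunctionFieldOfOneVariable k F)
    {D E : CurvePoint k F →₀ ℤ} (h : D ≤ E) :
    Nat.card k ^ dimension D *
      (riemannRochSpace D).toAddSubgroup.relIndex (riemannRochSpace E).toAddSubgroup =
      Nat.card k ^ dimension E := by
  rw [← card_riemannRochSpace hF, ← card_riemannRochSpace hF]
  have h1 := AddSubgroup.relIndex_mul_relIndex ⊥ (riemannRochSpace D).toAddSubgroup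
    (riemannRochSpace E).toAddSubgroup bot_le (riemannRochSpace_mono h)
  rwa [AddSubgroup.relIndex_bot_left, AddSubgroup.relIndex_bot_left] at h1

theorem dimension_mono (hF : IsFunctionFieldOfOneVariable k F)
    {D E : CurvePoint k F →₀ ℤ} (h : D ≤ E) : dimension D ≤ dimension E := by
  have := finite_riemannRochSpace hF E
  exact Submodule.finrank_mono (riemannRochSpace_mono h)

theorem dimension_sub_le (hF : IsFunctionFieldOfOneVariable k F)
    {D E : CurvePoint k F →₀ ℤ} (h : D ≤ E) :
    (dimension E : ℤ) - dimension D ≤ divisorDegree E - divisorDegree D := by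
  have h1 := relIndex_riemannRochSpace_mul hF h
  have h2 := (relIndex_riemannRochSpace hF h).2
  have h3 := divisorDegree_mono h
  have h4 : Nat.card k ^ dimension E ≤
      Nat.card k ^ (dimension D + (divisorDegree E - divisorDegree D).toNat) := by
    rw [← h1, pow_add]
    exact Nat.mul_le_mul_left _ h2
  have h5 := (Nat.pow_le_pow_iff_right (Finite.one_lt_card (α := k))).1 h4
  omega

end CurvePoint

namespace CurvePoint

variable {k F : Type*} [Field k] [Field F] [Algebra k F]

open scoped Classical in
/-- The divisor `∑ (- ord_v x) v`. -/
noncomputable def poleDivisor (x : F) : CurvePoint k F →₀ ℤ :=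
  if h : (Function.support fun v : CurvePoint k F => WithZero.log (v.valuation x)).Finite then
    Finsupp.ofSupportFinite _ h else 0

variable [Finite k]

theorem poleDivisor_apply (hF : IsFunctionFieldOfOneVariable k F) (x : F) (v : CurvePoint k F) :
    poleDivisor x v = WithZero.log (v.valuation x) := by
  have h : (Function.support fun v : CurvePoint k F => WithZero.log (v.valuation x)).Finite := by
    by_cases hx : x = 0
    · subst hx; simp
    · refine ((finite_setOf_lt_one hF hx).union (finite_setOf_one_lt hF x)).subset fun v hv => ?_
      rcases lt_trichotomy (v.valuation x) 1 with h | h | h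
      · exact Or.inl h
      · rw [Function.mem_support, h] at hv; exact absurd WithZero.log_one hv
      · exact Or.inr h
  rw [poleDivisor, dif_pos h]
  rfl

theorem valuation_eq_exp_poleDivisor (hF : IsFunctionFieldOfOneVariable k F) {x : F} (hx : x ≠ 0)
    (v : CurvePoint k F) : v.valuation x = WithZero.exp (poleDivisor x v) := by
  rw [poleDivisor_apply hF, WithZero.exp_log (by simpa using hx)]

theorem mem_riemannRochSpace_iff (hF : IsFunctionFieldOfOneVariable k F)
    {D : CurvePoint k F →₀ ℤ} {x : F} (hx : x ≠ 0) :
    x ∈ riemannRochSpace D ↔ poleDivisor x ≤ D := by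
  rw [mem_riemannRochSpace]
  exact forall_congr' fun v => by
    rw [valuation_eq_exp_poleDivisor hF hx, WithZero.exp_le_exp]

theorem poleDivisor_mul (hF : IsFunctionFieldOfOneVariable k F) {x y : F} (hx : x ≠ 0)
    (hy : y ≠ 0) : (poleDivisor (x * y) : CurvePoint k F →₀ ℤ) = poleDivisor x + poleDivisor y := by
  ext v
  rw [Finsupp.add_apply, poleDivisor_apply hF, poleDivisor_apply hF, poleDivisor_apply hF, map_mul,
    WithZero.log_mul (by simpa using hx) (by simpa using hy)]

theorem poleDivisor_inv (hF : IsFunctionFieldOfOneVariable k F) (x : F) :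
    (poleDivisor x⁻¹ : CurvePoint k F →₀ ℤ) = - poleDivisor x := by
  ext v
  rw [Finsupp.neg_apply, poleDivisor_apply hF, poleDivisor_apply hF, map_inv₀, WithZero.log_inv]

theorem map_mulLeft_riemannRochSpace (hF : IsFunctionFieldOfOneVariable k F) {x : F} (hx : x ≠ 0)
    (D : CurvePoint k F →₀ ℤ) :
    (riemannRochSpace D).map (LinearMap.mulLeft k x) = riemannRochSpace (D + poleDivisor x) := by
  ext y
  simp only [Submodule.mem_map, LinearMap.mulLeft_apply, mem_riemannRochSpace]
  constructor
  · rintro ⟨z, hz, rfl⟩ v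
    rw [map_mul, Finsupp.add_apply, WithZero.exp_add, valuation_eq_exp_poleDivisor hF hx, mul_comm]
    exact mul_le_mul_left (hz v) _
  · intro hy
    refine ⟨x⁻¹ * y, fun v => ?_, by field_simp⟩
    rw [map_mul, map_inv₀, valuation_eq_exp_poleDivisor hF hx, ← WithZero.exp_neg]
    refine (mul_le_mul_right (hy v) _).trans_eq ?_
    rw [← WithZero.exp_add, Finsupp.add_apply]
    congr 1
    ring

theorem dimension_add_poleDivisor (hF : IsFunctionFieldOfOneVariable k F) {x : F} (hx : x ≠ 0)
    (D : CurvePoint k F →₀ ℤ) : dimension (D + poleDivisor x) = dimension D := by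
  rw [dimension, ← map_mulLeft_riemannRochSpace hF hx]
  exact ((riemannRochSpace D).equivMapOfInjective _ (mul_right_injective₀ hx)).finrank_eq.symm

theorem aeval_mem_riemannRochSpace (hF : IsFunctionFieldOfOneVariable k F) {x : F}
    {r : ℕ} {p : Polynomial k} (hp : p.natDegree ≤ r) :
    Polynomial.aeval x p ∈ riemannRochSpace (r • (poleDivisor x ⊔ 0 : CurvePoint k F →₀ ℤ)) := by
  rw [Polynomial.aeval_eq_sum_range]
  refine Submodule.sum_mem _ fun i hi => Submodule.smul_mem _ _ fun v => ?_
  change v.valuation _ ≤ _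
  rw [map_pow]
  have hi' : i ≤ r := by rw [Finset.mem_range] at hi; omega
  have h1 : v.valuation x ≤ WithZero.exp (poleDivisor x v ⊔ 0) := by
    by_cases hx : x = 0
    · simp [hx]
    · rw [valuation_eq_exp_poleDivisor hF hx, WithZero.exp_le_exp]
      exact le_sup_left
  calc v.valuation x ^ i ≤ WithZero.exp (poleDivisor x v ⊔ 0) ^ i := pow_le_pow_left' h1 i
    _ = WithZero.exp (i • (poleDivisor x v ⊔ 0)) := (WithZero.exp_nsmul _ _).symm
    _ ≤ WithZero.exp (r • (poleDivisor x v ⊔ 0)) :=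
        WithZero.exp_le_exp.2 (nsmul_le_nsmul_left le_sup_right hi')

/-- For a basis `f j` of `F` over `k(x)`, the elements `x ^ i * f j` with `i ≤ r` are independent
over `k`; their poles are bounded by `r` times the poles of `x` plus a fixed `C` collecting the
poles of the `f j`. -/
theorem exists_mul_le_dimension (hF : IsFunctionFieldOfOneVariable k F) {x : F}
    (hx : Transcendental k x) : ∃ C : CurvePoint k F →₀ ℤ, 0 ≤ C ∧ ∀ r : ℕ,
      Module.finrank (IntermediateField.adjoin k {x}) F * (r + 1) ≤
        dimension (r • (poleDivisor x ⊔ 0 : CurvePoint k F →₀ ℤ) + C) := by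
  have := hF.finiteDimensional_adjoin hx
  set n := Module.finrank (IntermediateField.adjoin k {x}) F
  let f : Module.Basis (Fin n) (IntermediateField.adjoin k {x}) F := Module.finBasis _ _
  have hC0 : ∀ j, 0 ≤ (poleDivisor (f j) ⊔ 0 : CurvePoint k F →₀ ℤ) := fun j => le_sup_right
  refine ⟨∑ j, (poleDivisor (f j) ⊔ 0), Finset.sum_nonneg fun j _ => hC0 j, fun r => ?_⟩
  set B := (poleDivisor x ⊔ 0 : CurvePoint k F →₀ ℤ)
  set C := ∑ j, (poleDivisor (f j) ⊔ 0 : CurvePoint k F →₀ ℤ)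
  let Φ : (Fin n → Polynomial.degreeLT k (r + 1)) →ₗ[k] F :=
    ∑ j, (LinearMap.mulRight k (f j)) ∘ₗ (Polynomial.aeval x).toLinearMap ∘ₗ
      (Polynomial.degreeLT k (r + 1)).subtype ∘ₗ LinearMap.proj j
  have hΦ : ∀ p, Φ p = ∑ j, Polynomial.aeval x (p j : Polynomial k) * f j := fun p => by
    simp [Φ, LinearMap.sum_apply]
  have hmem : ∀ p, Φ p ∈ riemannRochSpace (r • B + C) := fun p => by
    rw [hΦ]
    refine Submodule.sum_mem _ fun j _ v => ?_
    change v.valuation _ ≤ _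
    rw [map_mul, Finsupp.add_apply, WithZero.exp_add]
    refine mul_le_mul' (aeval_mem_riemannRochSpace hF ?_ v) ?_
    · have h1 := Polynomial.mem_degreeLT.1 (p j).2
      by_cases h0 : (p j : Polynomial k) = 0
      · rw [h0]; simp
      · rw [Polynomial.degree_eq_natDegree h0] at h1
        have : (p j : Polynomial k).natDegree < r + 1 := by exact_mod_cast h1
        omega
    · rw [valuation_eq_exp_poleDivisor hF (f.ne_zero j), WithZero.exp_le_exp]
      exact (le_sup_left : poleDivisor (f j) ≤ poleDivisor (f j) ⊔ 0).trans
        (Finset.single_le_sum (fun j _ => hC0 j) (Finset.mem_univ j)) v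
  have hinj : Function.Injective (Φ.codRestrict _ hmem) := by
    rw [← LinearMap.ker_eq_bot, LinearMap.ker_codRestrict, LinearMap.ker_eq_bot']
    intro p hp
    rw [hΦ] at hp
    have h1 := eq_zero_of_sum_aeval_mul_eq_zero hx f.linearIndependent hp
    funext j
    exact Subtype.ext (congrFun h1 j)
  have := finite_riemannRochSpace hF (r • B + C)
  have h1 := LinearMap.finrank_le_finrank_of_injective hinj
  have : Module.Finite k (Polynomial.degreeLT k (r + 1)) :=
    Module.Finite.equiv (Polynomial.degreeLTEquiv k (r + 1)).symm
  rw [Module.finrank_pi_fintype, (Polynomial.degreeLTEquiv k (r + 1)).finrank_eq] at h1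
  simpa [dimension] using h1

theorem adjoin_inv_eq (x : F) : IntermediateField.adjoin k {x⁻¹} = IntermediateField.adjoin k {x} := by
  apply le_antisymm <;> rw [IntermediateField.adjoin_simple_le_iff]
  · exact inv_mem (IntermediateField.mem_adjoin_simple_self k x)
  · rw [← inv_inv x, inv_inv x⁻¹]
    exact inv_mem (IntermediateField.mem_adjoin_simple_self k x⁻¹)

/-- One inequality bounds the zeros of `x⁻¹`. For the other, the dimension at `r B + C` grows at
least like `[F : k(x)] r` and at most like `r deg B`. -/
theorem divisorDegree_poleDivisor_sup_zero (hF : IsFunctionFieldOfOneVariable k F) {x : F}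
    (hx : Transcendental k x) :
    divisorDegree (poleDivisor x ⊔ 0 : CurvePoint k F →₀ ℤ) =
      Module.finrank (IntermediateField.adjoin k {x}) F := by
  have hx0 : x ≠ 0 := by rintro rfl; exact hx isAlgebraic_zero
  set B := (poleDivisor x ⊔ 0 : CurvePoint k F →₀ ℤ) with hB
  have hB0 : 0 ≤ B := le_sup_right
  apply le_antisymm
  · have hxi : Transcendental k x⁻¹ := by rwa [Transcendental, IsAlgebraic.inv_iff]
    have h1 := sum_zeros_le_finrank hF hxi (S := B.support) (e := fun v => (B v).toNat)
      fun v hv => by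
        rw [valuation_eq_exp_poleDivisor hF (inv_ne_zero hx0), poleDivisor_inv hF,
          Int.toNat_of_nonneg (hB0 v), Finsupp.neg_apply]
        have h2 : B v = poleDivisor x v ⊔ 0 := rfl
        rw [Finsupp.mem_support_iff, h2] at hv
        congr 2
        omega
    rw [adjoin_inv_eq] at h1
    rw [divisorDegree_eq_sum, Finsupp.sum]
    have h2 : ∑ v ∈ B.support, B v * (v.degree : ℤ) =
        ((∑ v ∈ B.support, (B v).toNat * v.degree : ℕ) : ℤ) := by
      push_cast
      exact Finset.sum_congr rfl fun v _ => by rw [Int.toNat_of_nonneg (hB0 v)]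
    rw [h2]
    exact_mod_cast h1
  · obtain ⟨C, hC, h⟩ := exists_mul_le_dimension hF hx
    set n := Module.finrank (IntermediateField.adjoin k {x}) F
    by_contra! hlt
    have h1 : ∀ r : ℕ, (n : ℤ) * (r + 1) ≤ dimension (0 : CurvePoint k F →₀ ℤ) +
        (r * divisorDegree B + divisorDegree C) := fun r => by
      have h2 := dimension_sub_le hF (add_nonneg (nsmul_nonneg hB0 r) hC : 0 ≤ r • B + C)
      rw [map_zero, map_add, map_nsmul, nsmul_eq_mul] at h2
      have h3 := h r
      zify at h3
      linarith
    have h2 := h1 (dimension (0 : CurvePoint k F →₀ ℤ) + (divisorDegree C).toNat + 1)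
    have h3 := divisorDegree_nonneg hC
    push_cast at h2
    rw [Int.toNat_of_nonneg h3] at h2
    nlinarith

/-- Zeros and poles of a transcendental `x` both have degree `[F : k(x)]`, since `x` and `x⁻¹`
generate the same subfield. An algebraic nonzero `x` has trivial value everywhere. -/
theorem divisorDegree_poleDivisor (hF : IsFunctionFieldOfOneVariable k F) (x : F) :
    divisorDegree (poleDivisor x : CurvePoint k F →₀ ℤ) = 0 := by
  by_cases hx0 : x = 0
  · have : (poleDivisor x : CurvePoint k F →₀ ℤ) = 0 := by
      ext v; rw [poleDivisor_apply hF, hx0]; simp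
    rw [this, map_zero]
  by_cases hx : Transcendental k x
  · have hxi : Transcendental k x⁻¹ := by rwa [Transcendental, IsAlgebraic.inv_iff]
    have h1 := divisorDegree_poleDivisor_sup_zero hF hx
    have h2 := divisorDegree_poleDivisor_sup_zero hF hxi
    rw [adjoin_inv_eq, ← h1, poleDivisor_inv hF] at h2
    have h3 : (poleDivisor x : CurvePoint k F →₀ ℤ) =
        (poleDivisor x ⊔ 0) - (-poleDivisor x ⊔ 0) := by
      ext v
      simp only [Finsupp.sub_apply, Finsupp.sup_apply, Finsupp.neg_apply, Finsupp.zero_apply]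
      omega
    rw [h3, map_sub, h2, sub_self]
  · have : (poleDivisor x : CurvePoint k F →₀ ℤ) = 0 := by
      ext v
      have : v.valuation x = 1 := by
        by_contra h
        exact hx (v.transcendental_of_apply_ne_one hx0 h)
      rw [poleDivisor_apply hF, this]; simp
    rw [this, map_zero]

theorem dimension_eq_zero_of_degree_neg (hF : IsFunctionFieldOfOneVariable k F)
    {D : CurvePoint k F →₀ ℤ} (hD : divisorDegree D < 0) : dimension D = 0 := by
  have : riemannRochSpace D = ⊥ := by
    rw [eq_bot_iff]
    intro x hx
    by_contra hx0
    have h1 := divisorDegree_mono ((mem_riemannRochSpace_iff hF hx0).1 hx)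
    rw [divisorDegree_poleDivisor hF] at h1
    omega
  rw [dimension, this, finrank_bot]

/-- Riemann's inequality. -/
theorem bddAbove_degree_sub_dimension (hF : IsFunctionFieldOfOneVariable k F) :
    BddAbove (Set.range fun D : CurvePoint k F →₀ ℤ =>
      divisorDegree D + 1 - (dimension D : ℤ)) := by
  obtain ⟨x, hx, -⟩ := id hF
  obtain ⟨C, hC, h⟩ := exists_mul_le_dimension hF hx
  have hB := divisorDegree_poleDivisor_sup_zero hF hx
  set n := Module.finrank (IntermediateField.adjoin k {x}) F
  set B := (poleDivisor x ⊔ 0 : CurvePoint k F →₀ ℤ) with hBdef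
  have hn : 0 < n := by
    have := hF.finiteDimensional_adjoin hx
    exact Module.finrank_pos
  have hB0 : 0 ≤ B := le_sup_right
  have h1 : ∀ r : ℕ, divisorDegree (r • B) - (dimension (r • B) : ℤ) ≤ divisorDegree C := fun r => by
    have h2 := dimension_sub_le hF (le_add_of_nonneg_right hC : r • B ≤ r • B + C)
    rw [map_add, map_nsmul, nsmul_eq_mul, hB] at h2
    rw [map_nsmul, nsmul_eq_mul, hB]
    have h3 := h r
    zify at h3
    nlinarith
  refine ⟨divisorDegree C + 1, ?_⟩
  rintro _ ⟨D, rfl⟩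
  have hDP : D ≤ D ⊔ 0 := le_sup_left
  have hP0 : 0 ≤ D ⊔ 0 := le_sup_right
  set P := D ⊔ 0
  -- This `r` makes the space of `r B - P` nonzero. An element `z` of it replaces `D` by the
  -- equivalent divisor `D + poleDivisor z ≤ r B`, and the bound for the multiples of `B` passes to
  -- smaller divisors.
  obtain ⟨r, hr⟩ : ∃ r : ℕ, divisorDegree P + divisorDegree C < r * n :=
    ⟨(divisorDegree P + divisorDegree C).toNat + 1, by
      have : (1 : ℤ) ≤ n := by exact_mod_cast hn
      push_cast
      nlinarith [Int.self_le_toNat (divisorDegree P + divisorDegree C),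
        Int.natCast_nonneg (divisorDegree P + divisorDegree C).toNat]⟩
  have h2 := dimension_sub_le hF (sub_le_self (r • B) hP0)
  have h3 := h1 r
  rw [map_sub] at h2
  rw [map_nsmul, nsmul_eq_mul, hB] at h2 h3
  have h4 : 0 < dimension (r • B - P) := by omega
  have := finite_riemannRochSpace hF (r • B - P)
  obtain ⟨⟨z, hz⟩, hz0⟩ := (Module.finrank_pos_iff_exists_ne_zero (R := k)).1 h4
  have hz0' : z ≠ 0 := fun h => hz0 (Subtype.ext h)
  have h5 := (mem_riemannRochSpace_iff hF hz0').1 hz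
  have h6 : D + poleDivisor z ≤ r • B := by
    calc D + poleDivisor z ≤ P + (r • B - P) := add_le_add hDP h5
      _ = r • B := by abel
  have h7 := dimension_sub_le hF h6
  rw [dimension_add_poleDivisor hF hz0', map_add, divisorDegree_poleDivisor hF, map_nsmul,
    nsmul_eq_mul, hB] at h7
  dsimp only
  omega

theorem exists_curveGenus_eq (hF : IsFunctionFieldOfOneVariable k F) :
    ∃ D : CurvePoint k F →₀ ℤ, curveGenus k F = divisorDegree D + 1 - dimension D := by
  obtain ⟨D, hD⟩ := Int.csSup_mem (Set.range_nonempty _) (bddAbove_degree_sub_dimension hF)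
  exact ⟨D, hD.symm⟩

theorem degree_sub_dimension_le (hF : IsFunctionFieldOfOneVariable k F) (D : CurvePoint k F →₀ ℤ) :
    divisorDegree D + 1 - dimension D ≤ curveGenus k F :=
  le_csSup (bddAbove_degree_sub_dimension hF) ⟨D, rfl⟩

end CurvePoint

/-! ### Adeles, Weil differentials and the Riemann-Roch theorem. -/

/-- The chain `A ≤ (A ⊔ f.range) ⊓ B ≤ B` splits the index. Applied to two boxes and the diagonal,
it relates adelic indices to dimensions and degrees. -/
theorem AddSubgroup.relIndex_sup_range_mul {G H : Type*} [AddCommGroup G] [AddCommGroup H]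
    (f : G →+ H) {A B : AddSubgroup H} (h : A ≤ B) :
    (A ⊔ f.range).relIndex (B ⊔ f.range) * (A.comap f).relIndex (B.comap f) = A.relIndex B := by
  have h1 : (A ⊔ f.range).relIndex (B ⊔ f.range) = (A ⊔ f.range).relIndex B := by
    have : B ⊔ f.range = B ⊔ (A ⊔ f.range) := by
      rw [← sup_assoc, sup_eq_left.2 h]
    rw [this, AddSubgroup.relIndex_sup_right]
  have h2 : (A.comap f).relIndex (B.comap f) = A.relIndex ((A ⊔ f.range) ⊓ B) := by
    rw [AddSubgroup.relIndex_comap, AddSubgroup.map_comap_eq, sup_inf_assoc_of_le _ h,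
      AddSubgroup.relIndex_sup_left]
  have h3 : (A ⊔ f.range).relIndex B = ((A ⊔ f.range) ⊓ B).relIndex B :=
    (AddSubgroup.inf_relIndex_right _ _).symm
  rw [h1, h2, h3, mul_comm, AddSubgroup.relIndex_mul_relIndex _ _ _ (le_inf le_sup_left h)
    inf_le_right]

namespace CurvePoint

variable {k F : Type*} [Field k] [Field F] [Algebra k F]

theorem smul_mem_box {D : CurvePoint k F → ℤ} {a : CurvePoint k F → F} (ha : a ∈ box D) (c : k) :
    c • a ∈ box D := by
  refine mem_box.2 fun v => ?_
  rw [Pi.smul_apply, Algebra.smul_def, map_mul]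
  exact (mul_le_of_le_one_left' (v.valuation_algebraMap_le_one c)).trans (mem_box.1 ha v)

variable (k F) in
/-- The adeles (repartitions) of the function field. -/
def adeles : Submodule k (CurvePoint k F → F) where
  carrier := {a | ∃ D : CurvePoint k F →₀ ℤ, a ∈ box D}
  zero_mem' := ⟨0, zero_mem _⟩
  add_mem' := by
    rintro a b ⟨D, hD⟩ ⟨E, hE⟩
    exact ⟨D ⊔ E, add_mem (box_mono (le_sup_left : D ≤ D ⊔ E) hD)
      (box_mono (le_sup_right : E ≤ D ⊔ E) hE)⟩
  smul_mem' := by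
    rintro c a ⟨D, hD⟩
    exact ⟨D, smul_mem_box hD c⟩

variable [Finite k]

theorem diagonal_mem_adeles (hF : IsFunctionFieldOfOneVariable k F) (x : F) :
    diagonal k F x ∈ adeles k F := by
  refine ⟨poleDivisor x, mem_box.2 fun v => ?_⟩
  change v.valuation x ≤ _
  by_cases hx : x = 0
  · simp [hx]
  · rw [valuation_eq_exp_poleDivisor hF hx]

/-- The quantity `deg D + 1 - dim D` is monotone and bounded by the genus, so from a divisor
attaining the genus onwards it is constant. There the index formula shows that enlarging the box
adds nothing modulo the field. -/
theorem exists_adeles_eq (hF : IsFunctionFieldOfOneVariable k F) :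
    ∃ D₀ : CurvePoint k F →₀ ℤ, ∀ E : CurvePoint k F →₀ ℤ, D₀ ≤ E →
      (dimension E : ℤ) = divisorDegree E + 1 - curveGenus k F ∧
      box E ⊔ (diagonal k F).range = (adeles k F).toAddSubgroup := by
  obtain ⟨D₀, hD₀⟩ := exists_curveGenus_eq hF
  have hdim : ∀ E : CurvePoint k F →₀ ℤ, D₀ ≤ E →
      (dimension E : ℤ) = divisorDegree E + 1 - curveGenus k F := fun E hE => by
    have h1 := degree_sub_dimension_le hF E
    have h2 := dimension_sub_le hF hE
    omega
  have hbox : ∀ E : CurvePoint k F →₀ ℤ, D₀ ≤ E → box E ≤ box D₀ ⊔ (diagonal k F).range := by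
    intro E hE
    have h1 := AddSubgroup.relIndex_sup_range_mul (diagonal k F) (box_mono hE)
    rw [comap_diagonal_box, comap_diagonal_box, relIndex_box hF hE] at h1
    have h2 := relIndex_riemannRochSpace_mul hF hE
    have h3 := hdim E hE
    have h4 := divisorDegree_mono hE
    have h5 : dimension E = dimension D₀ + (divisorDegree E - divisorDegree D₀).toNat := by omega
    rw [h5, pow_add] at h2
    have hq : 0 < Nat.card k := Nat.card_pos
    have h6 := Nat.eq_of_mul_eq_mul_left (pow_pos hq _) h2
    rw [h6] at h1
    have h7 := Nat.eq_of_mul_eq_mul_right (pow_pos hq _) (h1.trans (one_mul _).symm)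
    exact le_sup_left.trans (AddSubgroup.relIndex_eq_one.1 h7)
  refine ⟨D₀, fun E hE => ⟨hdim E hE, le_antisymm (sup_le (fun a ha => ⟨E, ha⟩) ?_) ?_⟩⟩
  · rintro _ ⟨x, rfl⟩
    exact diagonal_mem_adeles hF x
  · rintro a ⟨D, hD⟩
    exact sup_le_sup_right (box_mono hE) _
      (hbox (D ⊔ D₀) le_sup_right (box_mono (le_sup_left : D ≤ D ⊔ D₀) hD))

theorem relIndex_adeles (hF : IsFunctionFieldOfOneVariable k F) (D : CurvePoint k F →₀ ℤ) :
    (box D ⊔ (diagonal k F).range).relIndex (adeles k F).toAddSubgroup =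
      Nat.card k ^ (dimension D + curveGenus k F - 1 - divisorDegree D).toNat := by
  obtain ⟨D₀, h₀⟩ := exists_adeles_eq hF
  obtain ⟨h1, h2⟩ := h₀ (D ⊔ D₀) le_sup_right
  have hE : D ≤ D ⊔ D₀ := le_sup_left
  set E := D ⊔ D₀
  have h3 := AddSubgroup.relIndex_sup_range_mul (diagonal k F) (box_mono hE)
  rw [comap_diagonal_box, comap_diagonal_box, relIndex_box hF hE, h2] at h3
  have h4 := relIndex_riemannRochSpace_mul hF hE
  have h5 := degree_sub_dimension_le hF D
  have h6 := divisorDegree_mono hE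
  have hq : 0 < Nat.card k := Nat.card_pos
  have h7 := dimension_mono hF hE
  have h8 : (riemannRochSpace D).toAddSubgroup.relIndex (riemannRochSpace E).toAddSubgroup =
      Nat.card k ^ (dimension E - dimension D) := by
    refine Nat.eq_of_mul_eq_mul_left (pow_pos hq (dimension D)) (h4.trans ?_)
    rw [← pow_add]; congr 1; omega
  rw [h8] at h3
  refine Nat.eq_of_mul_eq_mul_right (pow_pos hq (dimension E - dimension D)) (h3.trans ?_)
  rw [← pow_add]
  congr 1
  omega

/-- The adeles of the form `a + x` with `a` in the box of `D` and `x` in the function field. -/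
def boxSupField (D : CurvePoint k F →₀ ℤ) : Submodule k (adeles k F) where
  carrier := {a | (a : CurvePoint k F → F) ∈ box D ⊔ (diagonal k F).range}
  zero_mem' := (box D ⊔ (diagonal k F).range).zero_mem
  add_mem' ha hb := (box D ⊔ (diagonal k F).range).add_mem ha hb
  smul_mem' c a ha := by
    obtain ⟨b, hb, _, ⟨x, rfl⟩, h⟩ := AddSubgroup.mem_sup.1 ha
    refine AddSubgroup.mem_sup.2 ⟨c • b, smul_mem_box hb c, _, ⟨c • x, rfl⟩, ?_⟩
    change _ = c • (a : CurvePoint k F → F)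
    rw [← h, smul_add]
    rfl

/-- The Weil differentials vanishing on the box of `D`. -/
def weilDifferentials (D : CurvePoint k F →₀ ℤ) : Submodule k (Module.Dual k (adeles k F)) :=
  (boxSupField D).dualAnnihilator

theorem mem_weilDifferentials {D : CurvePoint k F →₀ ℤ} {ω : Module.Dual k (adeles k F)} :
    ω ∈ weilDifferentials D ↔
      (∀ a : adeles k F, (a : CurvePoint k F → F) ∈ box D → ω a = 0) ∧
      ∀ (a : adeles k F) (x : F), (a : CurvePoint k F → F) = diagonal k F x → ω a = 0 := by
  rw [weilDifferentials, Submodule.mem_dualAnnihilator]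
  constructor
  · intro h
    constructor
    · intro a ha
      have h1 : (a : CurvePoint k F → F) ∈ box D ⊔ (diagonal k F).range :=
        AddSubgroup.mem_sup_left ha
      exact h a h1
    · intro a x hax
      have h1 : (a : CurvePoint k F → F) ∈ box D ⊔ (diagonal k F).range :=
        AddSubgroup.mem_sup_right ⟨x, hax.symm⟩
      exact h a h1
  · rintro ⟨h1, h2⟩ a ha
    have ha' : (a : CurvePoint k F → F) ∈ box D ⊔ (diagonal k F).range := ha
    obtain ⟨b, hb, c, ⟨x, rfl⟩, h⟩ := AddSubgroup.mem_sup.1 ha'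
    have hb' : b ∈ adeles k F := ⟨D, hb⟩
    have hx : diagonal k F x ∈ adeles k F := by
      have := (adeles k F).sub_mem a.2 hb'
      rwa [← h, add_sub_cancel_left] at this
    have h3 : a = (⟨b, hb'⟩ : adeles k F) + ⟨_, hx⟩ := Subtype.ext h.symm
    have h4 : ω ⟨b, hb'⟩ = 0 := h1 _ hb
    have h5 : ω ⟨_, hx⟩ = 0 := h2 _ x rfl
    rw [h3, map_add, h4, h5, add_zero]

theorem weilDifferentials_anti {D E : CurvePoint k F →₀ ℤ} (h : D ≤ E) :
    weilDifferentials E ≤ weilDifferentials D := fun ω hω => by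
  rw [mem_weilDifferentials] at hω ⊢
  exact ⟨fun a ha => hω.1 a (box_mono h ha), hω.2⟩

/-- The differentials are the dual of the finite quotient of the adeles by box plus field, so both
have the same dimension. -/
theorem card_weilDifferentials (hF : IsFunctionFieldOfOneVariable k F)
    (D : CurvePoint k F →₀ ℤ) : Finite (weilDifferentials D) ∧ Nat.card (weilDifferentials D) =
      Nat.card k ^ (dimension D + curveGenus k F - 1 - divisorDegree D).toNat := by
  have h1 : (box D ⊔ (diagonal k F).range).relIndex (adeles k F).toAddSubgroup =
      Nat.card (adeles k F ⧸ boxSupField D) := by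
    have h : (boxSupField D).toAddSubgroup =
      (box D ⊔ (diagonal k F).range).addSubgroupOf (adeles k F).toAddSubgroup := rfl
    rw [AddSubgroup.relIndex, ← h]
    rfl
  rw [← relIndex_adeles hF, h1]
  have h2 : Nat.card (adeles k F ⧸ boxSupField D) ≠ 0 := by
    rw [← h1, relIndex_adeles hF]
    exact pow_ne_zero _ Nat.card_pos.ne'
  have h3 := Nat.finite_of_card_ne_zero h2
  have h4 := Subspace.dual_finrank_eq (K := k) (V := adeles k F ⧸ boxSupField D)
  have e := (boxSupField D).dualQuotEquivDualAnnihilator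
  have h5 : Module.Finite k (weilDifferentials D) := Module.Finite.equiv e
  refine ⟨Module.finite_of_finite k, ?_⟩
  rw [Module.natCard_eq_pow_finrank (K := k) (V := weilDifferentials D),
    Module.natCard_eq_pow_finrank (K := k) (V := adeles k F ⧸ boxSupField D), ← h4]
  exact congrArg _ e.finrank_eq.symm

end CurvePoint

namespace CurvePoint

variable {k F : Type*} [Field k] [Field F] [Algebra k F] [Finite k]

theorem finite_weilDifferentials (hF : IsFunctionFieldOfOneVariable k F)
    (D : CurvePoint k F →₀ ℤ) : Module.Finite k (weilDifferentials D) := by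
  have := (card_weilDifferentials hF D).1
  exact Module.Finite.of_finite

theorem finrank_weilDifferentials (hF : IsFunctionFieldOfOneVariable k F)
    (D : CurvePoint k F →₀ ℤ) : (Module.finrank k (weilDifferentials D) : ℤ) =
      dimension D + curveGenus k F - 1 - divisorDegree D := by
  have := finite_weilDifferentials hF D
  have h2 := (card_weilDifferentials hF D).2
  rw [Module.natCard_eq_pow_finrank (K := k) (V := weilDifferentials D)] at h2
  have h3 := Nat.pow_right_injective (Finite.one_lt_card (α := k)) h2
  have h4 := degree_sub_dimension_le hF D
  omega

theorem smul_mem_box_iff (hF : IsFunctionFieldOfOneVariable k F) {x : F} (hx : x ≠ 0)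
    {D : CurvePoint k F →₀ ℤ} {a : CurvePoint k F → F} :
    x • a ∈ box (D + poleDivisor x : CurvePoint k F →₀ ℤ) ↔ a ∈ box D := by
  rw [mem_box, mem_box]
  refine forall_congr' fun v => ?_
  rw [Pi.smul_apply, smul_eq_mul, map_mul, valuation_eq_exp_poleDivisor hF hx, Finsupp.add_apply,
    add_comm, WithZero.exp_add]
  exact mul_le_mul_iff_right₀ WithZero.exp_pos

theorem smul_mem_adeles (hF : IsFunctionFieldOfOneVariable k F) (x : F)
    {a : CurvePoint k F → F} (ha : a ∈ adeles k F) : x • a ∈ adeles k F := by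
  by_cases hx : x = 0
  · rw [hx, zero_smul]; exact zero_mem _
  · obtain ⟨D, hD⟩ := ha
    exact ⟨D + poleDivisor x, (smul_mem_box_iff hF hx).2 hD⟩

/-- The action of the function field on linear forms on the adeles. -/
def twist (hF : IsFunctionFieldOfOneVariable k F) :
    F →ₗ[k] Module.Dual k (adeles k F) →ₗ[k] Module.Dual k (adeles k F) :=
  LinearMap.mk₂ k (fun x ω =>
    { toFun := fun a => ω ⟨x • (a : CurvePoint k F → F), smul_mem_adeles hF x a.2⟩
      map_add' := fun a b => by
        rw [← map_add]; congr 1; exact Subtype.ext (smul_add _ _ _)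
      map_smul' := fun c a => by
        rw [RingHom.id_apply, ← map_smul]; congr 1; exact Subtype.ext (smul_comm _ _ _) })
    (fun x y ω => by
      ext a
      change ω _ = ω _ + ω _
      rw [← map_add]; congr 1; exact Subtype.ext (add_smul _ _ _))
    (fun c x ω => by
      ext a
      change ω _ = c • ω _
      rw [← map_smul]; congr 1; exact Subtype.ext (smul_assoc _ _ _))
    (fun x ω η => rfl) (fun c x ω => rfl)

theorem twist_apply (hF : IsFunctionFieldOfOneVariable k F) (x : F)
    (ω : Module.Dual k (adeles k F)) (a : adeles k F) :
    twist hF x ω a = ω ⟨x • (a : CurvePoint k F → F), smul_mem_adeles hF x a.2⟩ := rfl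

theorem twist_twist (hF : IsFunctionFieldOfOneVariable k F) (x y : F)
    (ω : Module.Dual k (adeles k F)) : twist hF x (twist hF y ω) = twist hF (y * x) ω := by
  ext a
  rw [twist_apply, twist_apply, twist_apply]
  congr 1
  exact Subtype.ext (smul_smul _ _ _)

theorem twist_one (hF : IsFunctionFieldOfOneVariable k F)
    (ω : Module.Dual k (adeles k F)) : twist hF 1 ω = ω := by
  ext a
  rw [twist_apply]
  congr 1
  exact Subtype.ext (one_smul _ _)

theorem eq_zero_of_twist_eq_zero (hF : IsFunctionFieldOfOneVariable k F) {x : F} (hx : x ≠ 0)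
    {ω : Module.Dual k (adeles k F)} (h : twist hF x ω = 0) : ω = 0 := by
  rw [← twist_one hF ω, ← mul_inv_cancel₀ hx, ← twist_twist, h, map_zero]

theorem twist_mem_weilDifferentials_of (hF : IsFunctionFieldOfOneVariable k F) {x : F} (hx : x ≠ 0)
    {ω : Module.Dual k (adeles k F)} {D : CurvePoint k F →₀ ℤ}
    (h : ω ∈ weilDifferentials (D + poleDivisor x)) : twist hF x ω ∈ weilDifferentials D := by
  rw [mem_weilDifferentials] at h ⊢
  constructor
  · intro a ha
    rw [twist_apply]
    exact h.1 _ ((smul_mem_box_iff hF hx).2 ha)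
  · intro a y hay
    rw [twist_apply]
    refine h.2 _ (x * y) ?_
    change x • (a : CurvePoint k F → F) = _
    rw [hay]
    rfl

theorem twist_mem_weilDifferentials_iff (hF : IsFunctionFieldOfOneVariable k F) {x : F} (hx : x ≠ 0)
    {ω : Module.Dual k (adeles k F)} {D : CurvePoint k F →₀ ℤ} :
    twist hF x ω ∈ weilDifferentials D ↔ ω ∈ weilDifferentials (D + poleDivisor x) := by
  refine ⟨fun h => ?_, twist_mem_weilDifferentials_of hF hx⟩
  have h1 := twist_mem_weilDifferentials_of hF (inv_ne_zero hx) (ω := twist hF x ω)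
    (D := D + poleDivisor x) (by rwa [poleDivisor_inv hF, add_neg_cancel_right])
  rwa [twist_twist, mul_inv_cancel₀ hx, twist_one] at h1

/-- An adele in the box of `D ⊔ E` is a sum of one in the box of `D` and one in the box of `E`, each
component being assigned to one summand. -/
theorem mem_weilDifferentials_sup {ω : Module.Dual k (adeles k F)} {D E : CurvePoint k F →₀ ℤ}
    (hD : ω ∈ weilDifferentials D) (hE : ω ∈ weilDifferentials E) :
    ω ∈ weilDifferentials (D ⊔ E) := by
  classical
  rw [mem_weilDifferentials] at hD hE ⊢
  refine ⟨fun a ha => ?_, hD.2⟩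
  let b : CurvePoint k F → F := fun v => if v.valuation (a.1 v) ≤ WithZero.exp (D v) then a.1 v else 0
  let c : CurvePoint k F → F := fun v => if v.valuation (a.1 v) ≤ WithZero.exp (D v) then 0 else a.1 v
  have hb : b ∈ box D := mem_box.2 fun v => by
    by_cases h : v.valuation (a.1 v) ≤ WithZero.exp (D v) <;> simp [b, h]
  have hc : c ∈ box E := mem_box.2 fun v => by
    by_cases h : v.valuation (a.1 v) ≤ WithZero.exp (D v)
    · simp [c, h]
    · simp only [c, h, if_false]
      have h1 : v.valuation (a.1 v) ≤ WithZero.exp (D v ⊔ E v) := mem_box.1 ha v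
      rcases le_total (E v) (D v) with h2 | h2
      · rw [sup_eq_left.2 h2] at h1; exact absurd h1 h
      · rwa [sup_eq_right.2 h2] at h1
  have hb' : b ∈ adeles k F := ⟨D, hb⟩
  have hc' : c ∈ adeles k F := ⟨E, hc⟩
  have h3 : a = (⟨b, hb'⟩ : adeles k F) + ⟨c, hc'⟩ := by
    refine Subtype.ext (funext fun v => ?_)
    change a.1 v = b v + c v
    by_cases h : v.valuation (a.1 v) ≤ WithZero.exp (D v) <;> simp [b, c, h]
  have h4 : ω ⟨b, hb'⟩ = 0 := hD.1 _ hb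
  have h5 : ω ⟨c, hc'⟩ = 0 := hE.1 _ hc
  rw [h3, map_add, h4, h5, add_zero]

/-- Multiplication `x ↦ x ω` embeds the space of `D` in the differentials at `0`. With Riemann's
inequality this bounds the degrees of all `D` whose box is annihilated by `ω`. -/
theorem dimension_le_of_mem_weilDifferentials (hF : IsFunctionFieldOfOneVariable k F)
    {ω : Module.Dual k (adeles k F)} (hω : ω ≠ 0) {D : CurvePoint k F →₀ ℤ}
    (h : ω ∈ weilDifferentials D) :
    dimension D ≤ Module.finrank k (weilDifferentials (0 : CurvePoint k F →₀ ℤ)) := by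
  have := finite_weilDifferentials hF (0 : CurvePoint k F →₀ ℤ)
  have hmem : ∀ x : riemannRochSpace D, ((twist hF).flip ω ∘ₗ (riemannRochSpace D).subtype) x ∈
      weilDifferentials (0 : CurvePoint k F →₀ ℤ) := by
    intro x
    change twist hF (x : F) ω ∈ _
    by_cases hx : (x : F) = 0
    · rw [hx, map_zero]; exact zero_mem _
    · rw [twist_mem_weilDifferentials_iff hF hx, zero_add]
      exact weilDifferentials_anti ((mem_riemannRochSpace_iff hF hx).1 x.2) h
  refine LinearMap.finrank_le_finrank_of_injective (f := LinearMap.codRestrict _ _ hmem) ?_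
  refine (injective_iff_map_eq_zero _).2 fun x hx => ?_
  by_contra hx0
  exact hω (eq_zero_of_twist_eq_zero hF (fun h => hx0 (Subtype.ext h)) (congrArg Subtype.val hx))

theorem eq_zero_of_degree_nonpos (hF : IsFunctionFieldOfOneVariable k F)
    {D : CurvePoint k F →₀ ℤ} (h0 : 0 ≤ D) (hD : divisorDegree D ≤ 0) : D = 0 := by
  by_contra h
  obtain ⟨v, hv⟩ := Finsupp.ne_iff.1 h
  have h1 : Finsupp.single v 1 ≤ D := by
    intro w
    have h2 := h0 w
    have h3 := h0 v
    rw [Finsupp.zero_apply] at hv h2 h3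
    by_cases hw : v = w
    · subst hw; rw [Finsupp.single_eq_same]; omega
    · rwa [Finsupp.single_eq_of_ne' hw]
  have h2 := divisorDegree_mono h1
  rw [divisorDegree_single] at h2
  have := v.degree_pos hF
  omega

/-- The divisor of a nonzero Weil differential. -/
theorem exists_divisor_of_weilDifferential (hF : IsFunctionFieldOfOneVariable k F)
    {ω : Module.Dual k (adeles k F)} (hω : ω ≠ 0) {D₁ : CurvePoint k F →₀ ℤ}
    (h₁ : ω ∈ weilDifferentials D₁) :
    ∃ W : CurvePoint k F →₀ ℤ, ∀ D, ω ∈ weilDifferentials D ↔ D ≤ W := by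
  obtain ⟨m, ⟨W, hW, rfl⟩, hmax⟩ := Int.exists_greatest_of_bdd
    (P := fun m => ∃ D : CurvePoint k F →₀ ℤ, ω ∈ weilDifferentials D ∧ divisorDegree D = m)
    ⟨Module.finrank k (weilDifferentials (0 : CurvePoint k F →₀ ℤ)) + curveGenus k F - 1, by
      rintro _ ⟨D, hD, rfl⟩
      have h1 := dimension_le_of_mem_weilDifferentials hF hω hD
      have h2 := degree_sub_dimension_le hF D
      omega⟩ ⟨_, D₁, h₁, rfl⟩
  refine ⟨W, fun D => ⟨fun hD => ?_, fun hD => weilDifferentials_anti hD hW⟩⟩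
  -- By maximality of the degree of `W` the effective divisor `D ⊔ W - W` has nonpositive degree,
  -- hence is zero.
  have h1 := hmax _ ⟨D ⊔ W, mem_weilDifferentials_sup hD hW, rfl⟩
  have h2 : D ⊔ W - W = 0 := eq_zero_of_degree_nonpos hF (sub_nonneg.2 le_sup_right) (by
    rw [map_sub]; omega)
  rw [sub_eq_zero] at h2
  rw [← h2]
  exact le_sup_left

theorem exists_weilDifferential_ne_zero (hF : IsFunctionFieldOfOneVariable k F) :
    ∃ (D : CurvePoint k F →₀ ℤ), ∃ ω ∈ weilDifferentials D, ω ≠ 0 := by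
  obtain ⟨v⟩ := nonempty hF
  -- The dimension of the differentials at a divisor of degree at most `-m` is at least `g - 1 + m ≥
  -- 1`.
  let m : ℤ := max 0 (2 - curveGenus k F)
  let D : CurvePoint k F →₀ ℤ := Finsupp.single v (-m)
  have hdeg : divisorDegree D ≤ -m := by
    rw [divisorDegree_single]
    have h1 : (1 : ℤ) ≤ v.degree := by exact_mod_cast v.degree_pos hF
    have h2 : 0 ≤ m := le_max_left _ _
    nlinarith
  have hm : 2 - curveGenus k F ≤ m := le_max_right _ _
  obtain ⟨hfin, h1⟩ := card_weilDifferentials hF D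
  have h2 : 1 < Nat.card (weilDifferentials D) := by
    rw [h1]
    exact Nat.one_lt_pow (by omega) Finite.one_lt_card
  have h3 : Nontrivial (weilDifferentials D) := Finite.one_lt_card_iff_nontrivial.1 h2
  obtain ⟨ω, hω⟩ := exists_ne (0 : weilDifferentials D)
  exact ⟨D, ω, ω.2, fun h => hω (Subtype.ext h)⟩

/-- The space of Weil differentials is one-dimensional over the function field. -/
theorem exists_twist_eq (hF : IsFunctionFieldOfOneVariable k F)
    {ω η : Module.Dual k (adeles k F)} {D E : CurvePoint k F →₀ ℤ} (hω : ω ∈ weilDifferentials D)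
    (hω0 : ω ≠ 0) (hη : η ∈ weilDifferentials E) : ∃ x, η = twist hF x ω := by
  by_contra! hne
  -- If `η` is not a multiple of `ω`, then `(x, y) ↦ x ω + y η` is injective. As the degree of `C`
  -- tends to `-∞` its source grows at least like `-2 deg C`, but its target only like `-deg C`.
  have key : ∀ C : CurvePoint k F →₀ ℤ,
      dimension (D - C) + dimension (E - C) ≤ Module.finrank k (weilDifferentials C) := by
    intro C
    have := finite_weilDifferentials hF C
    have := finite_riemannRochSpace hF (D - C)
    have := finite_riemannRochSpace hF (E - C)
    have hmem : ∀ {θ : Module.Dual k (adeles k F)} {B : CurvePoint k F →₀ ℤ},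
        θ ∈ weilDifferentials B → ∀ x ∈ riemannRochSpace (B - C),
        twist hF x θ ∈ weilDifferentials C := by
      intro θ B hθ x hx
      by_cases hx0 : x = 0
      · rw [hx0, map_zero]; exact zero_mem _
      · rw [twist_mem_weilDifferentials_iff hF hx0]
        exact weilDifferentials_anti
          (le_sub_iff_add_le'.1 ((mem_riemannRochSpace_iff hF hx0).1 hx)) hθ
    let Φ : (riemannRochSpace (D - C) × riemannRochSpace (E - C)) →ₗ[k]
        Module.Dual k (adeles k F) :=
      ((twist hF).flip ω ∘ₗ (riemannRochSpace (D - C)).subtype).coprod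
        ((twist hF).flip η ∘ₗ (riemannRochSpace (E - C)).subtype)
    have hΦ : ∀ p, Φ p = twist hF p.1 ω + twist hF p.2 η := fun p => rfl
    have hΦmem : ∀ p, Φ p ∈ weilDifferentials C := fun p => by
      rw [hΦ]
      exact add_mem (hmem hω _ p.1.2) (hmem hη _ p.2.2)
    have h1 := LinearMap.finrank_le_finrank_of_injective (f := Φ.codRestrict _ hΦmem) (by
      refine (injective_iff_map_eq_zero _).2 fun p hp' => ?_
      have hp : Φ p = 0 := congrArg Subtype.val hp'
      rw [hΦ] at hp
      have h2 : (p.2 : F) = 0 := by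
        by_contra h0
        apply hne (-(p.1 : F) * (p.2 : F)⁻¹)
        rw [← twist_twist, map_neg, LinearMap.neg_apply, neg_eq_of_add_eq_zero_right hp,
          twist_twist, mul_inv_cancel₀ h0, twist_one]
      rw [h2, map_zero, LinearMap.zero_apply, add_zero] at hp
      have h3 : (p.1 : F) = 0 := by
        by_contra h0
        exact hω0 (eq_zero_of_twist_eq_zero hF h0 hp)
      exact Prod.ext (Subtype.ext h3) (Subtype.ext h2))
    rwa [Module.finrank_prod] at h1
  obtain ⟨v⟩ := nonempty hF
  -- The two dimensions on the left add up to at least `deg D + deg E - 2 deg C + 2 - 2 g`, while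
  -- the right side is `g - 1 - deg C`; this `m` exceeds the threshold for `-deg C`.
  set m : ℕ := (3 * curveGenus k F - 3 - divisorDegree D - divisorDegree E).toNat + 1 with hm
  let C : CurvePoint k F →₀ ℤ := Finsupp.single v (-(m : ℤ))
  have hdeg : divisorDegree C ≤ -m := by
    rw [divisorDegree_single]
    have h1 : (1 : ℤ) ≤ v.degree := by exact_mod_cast v.degree_pos hF
    nlinarith
  have h1 := key C
  have h2 := finrank_weilDifferentials hF C
  have h3 : dimension C = 0 := dimension_eq_zero_of_degree_neg hF (by omega)
  have h4 := degree_sub_dimension_le hF (D - C)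
  have h5 := degree_sub_dimension_le hF (E - C)
  rw [map_sub] at h4 h5
  zify at h1
  omega

/-- The Riemann-Roch theorem. -/
theorem riemannRoch (hF : IsFunctionFieldOfOneVariable k F) :
    ∃ W : CurvePoint k F →₀ ℤ, ∀ D : CurvePoint k F →₀ ℤ,
      (dimension D : ℤ) - dimension (W - D) = divisorDegree D + 1 - curveGenus k F := by
  obtain ⟨D₁, ω, hω, hω0⟩ := exists_weilDifferential_ne_zero hF
  obtain ⟨W, hW⟩ := exists_divisor_of_weilDifferential hF hω0 hω
  refine ⟨W, fun D => ?_⟩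
  have hmem : ∀ x : F, twist hF x ω ∈ weilDifferentials D ↔ x ∈ riemannRochSpace (W - D) := by
    intro x
    by_cases hx : x = 0
    · rw [hx, map_zero]; exact iff_of_true (zero_mem _) (zero_mem _)
    · rw [twist_mem_weilDifferentials_iff hF hx, hW, mem_riemannRochSpace_iff hF hx,
        le_sub_iff_add_le']
  -- With `W` the divisor of `ω`, multiplication of `ω` identifies the two spaces; surjectivity is
  -- the one-dimensionality of differentials.
  let Ψ : riemannRochSpace (W - D) → weilDifferentials D := fun x =>
    ⟨twist hF (x : F) ω, (hmem x).2 x.2⟩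
  have hbij : Function.Bijective Ψ := by
    constructor
    · intro x y hxy
      have h1 : twist hF (x : F) ω = twist hF (y : F) ω := congrArg Subtype.val hxy
      have h2 : twist hF (x : F) ω = twist hF ((x : F) - y) ω + twist hF (y : F) ω := by
        rw [← LinearMap.add_apply, ← map_add, sub_add_cancel]
      rw [h1, right_eq_add] at h2
      by_contra hxy0
      exact hω0 (eq_zero_of_twist_eq_zero hF (fun h => hxy0 (Subtype.ext (sub_eq_zero.1 h))) h2)
    · rintro ⟨η, hη⟩
      obtain ⟨x, rfl⟩ := exists_twist_eq hF hω hω0 hη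
      exact ⟨⟨x, (hmem x).1 hη⟩, rfl⟩
  have h1 := Nat.card_congr (Equiv.ofBijective _ hbij)
  obtain ⟨-, h2⟩ := card_weilDifferentials hF D
  rw [card_riemannRochSpace hF, h2] at h1
  have h3 := Nat.pow_right_injective (Finite.one_lt_card (α := k)) h1
  have h4 := degree_sub_dimension_le hF D
  omega

end CurvePoint

/-! ### Divisor classes and the count of effective divisors. -/

namespace CurvePoint

variable {k F : Type*} [Field k] [Field F] [Algebra k F]

variable (k F) in
/-- The principal divisors. -/
def principalDivisors : AddSubgroup (CurvePoint k F →₀ ℤ) where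
  carrier := {D | ∃ x : F, x ≠ 0 ∧ ∀ v : CurvePoint k F, v.valuation x = WithZero.exp (D v)}
  zero_mem' := ⟨1, one_ne_zero, fun v => by simp⟩
  add_mem' := by
    rintro D E ⟨x, hx, hxD⟩ ⟨y, hy, hyE⟩
    refine ⟨x * y, mul_ne_zero hx hy, fun v => ?_⟩
    rw [map_mul, hxD, hyE, Finsupp.add_apply, WithZero.exp_add]
  neg_mem' := by
    rintro D ⟨x, hx, hxD⟩
    refine ⟨x⁻¹, inv_ne_zero hx, fun v => ?_⟩
    rw [map_inv₀, hxD, Finsupp.neg_apply, WithZero.exp_neg]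

variable (k F) in
/-- The divisor class group. -/
abbrev DivisorClass : Type _ := (CurvePoint k F →₀ ℤ) ⧸ principalDivisors k F

/-- The degree of a divisor class. -/
noncomputable def classDegree (c : DivisorClass k F) : ℤ := divisorDegree c.out

/-- The dimension of the Riemann-Roch spaces of the divisors in a class. -/
noncomputable def classDimension (c : DivisorClass k F) : ℕ := dimension c.out

/-- The divisor with nonnegative multiplicities `E`. -/
noncomputable def effective (E : CurvePoint k F →₀ ℕ) : CurvePoint k F →₀ ℤ :=
  E.mapRange Nat.cast Nat.cast_zero

theorem effective_apply (E : CurvePoint k F →₀ ℕ) (v : CurvePoint k F) : effective E v = E v := rfl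

theorem effective_injective : Function.Injective (effective : (CurvePoint k F →₀ ℕ) → _) :=
  Finsupp.mapRange_injective Nat.cast Nat.cast_zero Nat.cast_injective

theorem effective_nonneg (E : CurvePoint k F →₀ ℕ) : 0 ≤ effective E := fun _ =>
  Int.natCast_nonneg _

theorem exists_effective_eq {D : CurvePoint k F →₀ ℤ} (hD : 0 ≤ D) : ∃ E, effective E = D := by
  refine ⟨D.mapRange Int.toNat rfl, ?_⟩
  ext v
  rw [effective_apply, Finsupp.mapRange_apply]
  exact Int.toNat_of_nonneg (hD v)

variable [Finite k] (hF : IsFunctionFieldOfOneVariable k F)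
include hF

theorem mem_principalDivisors {D : CurvePoint k F →₀ ℤ} :
    D ∈ principalDivisors k F ↔ ∃ x : F, x ≠ 0 ∧ poleDivisor x = D := by
  refine exists_congr fun x => and_congr_right fun hx => ?_
  rw [DFunLike.ext_iff]
  exact forall_congr' fun v => by rw [valuation_eq_exp_poleDivisor hF hx, WithZero.exp_inj]

theorem exists_out_eq (D : CurvePoint k F →₀ ℤ) :
    ∃ x : F, x ≠ 0 ∧ (QuotientAddGroup.mk D : DivisorClass k F).out = D + poleDivisor x := by
  have h : -D + (QuotientAddGroup.mk D : DivisorClass k F).out ∈ principalDivisors k F := by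
    rw [← QuotientAddGroup.eq, QuotientAddGroup.out_eq']
  obtain ⟨x, hx, h⟩ := (mem_principalDivisors hF).1 h
  exact ⟨x, hx, by rw [h]; abel⟩

theorem classDegree_mk (D : CurvePoint k F →₀ ℤ) :
    classDegree (QuotientAddGroup.mk D : DivisorClass k F) = divisorDegree D := by
  obtain ⟨x, hx, h⟩ := exists_out_eq hF D
  rw [classDegree, h, map_add, divisorDegree_poleDivisor hF, add_zero]

theorem classDimension_mk (D : CurvePoint k F →₀ ℤ) :
    classDimension (QuotientAddGroup.mk D : DivisorClass k F) = dimension D := by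
  obtain ⟨x, hx, h⟩ := exists_out_eq hF D
  rw [classDimension, h, dimension_add_poleDivisor hF hx]

theorem classDegree_add (c d : DivisorClass k F) :
    classDegree (c + d) = classDegree c + classDegree d := by
  induction c using QuotientAddGroup.induction_on with | H D =>
  induction d using QuotientAddGroup.induction_on with | H E =>
  rw [← QuotientAddGroup.mk_add, classDegree_mk hF, classDegree_mk hF, classDegree_mk hF, map_add]

/-- For a fixed `D` of degree at least `m + g`, every such `E` leaves a nonzero `z` in the space of
`D - E`. Then `E ≤ D - poleDivisor z` with `z` in the finite space of `D`, so `E` lies in one of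
finitely many finite intervals. -/
theorem finite_effective_of_degree (m : ℕ) :
    Finite {E : CurvePoint k F →₀ ℕ // E.sum (fun v n => n * v.degree) = m} := by
  classical
  obtain ⟨v⟩ := nonempty hF
  set N : ℕ := (m + curveGenus k F).toNat
  let D : CurvePoint k F →₀ ℤ := Finsupp.single v (N : ℤ)
  have hD : (m : ℤ) + curveGenus k F ≤ divisorDegree D := by
    rw [divisorDegree_single]
    have h1 : (1 : ℤ) ≤ v.degree := by exact_mod_cast v.degree_pos hF
    have h2 : (m : ℤ) + curveGenus k F ≤ N := Int.self_le_toNat _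
    nlinarith
  have := finite_riemannRochSpace hF D
  have hfin : (⋃ x : riemannRochSpace D,
      {E : CurvePoint k F →₀ ℕ | effective E ∈ Set.Icc 0 (D - poleDivisor (x : F))}).Finite :=
    Set.finite_iUnion fun x => (Set.finite_Icc _ _).preimage effective_injective.injOn
  refine (hfin.subset fun E hE => ?_).to_subtype
  have hE' : divisorDegree (effective E) = m := by
    rw [effective, divisorDegree_mapRange]; exact congrArg Nat.cast hE
  have h1 := degree_sub_dimension_le hF (D - effective E)
  rw [map_sub, hE'] at h1
  have h2 : 0 < dimension (D - effective E) := by omega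
  have := finite_riemannRochSpace hF (D - effective E)
  obtain ⟨⟨z, hz⟩, hz0⟩ := (Module.finrank_pos_iff_exists_ne_zero (R := k)).1 h2
  have hz0' : z ≠ 0 := fun h => hz0 (Subtype.ext h)
  have h3 := (mem_riemannRochSpace_iff hF hz0').1 hz
  refine Set.mem_iUnion.2 ⟨⟨z, riemannRochSpace_mono (sub_le_self _ (effective_nonneg E)) hz⟩,
    effective_nonneg E, ?_⟩
  rw [le_sub_comm]
  exact h3

/-- Nonzero elements `y` of the space of `D` map to the effective divisors `D - poleDivisor y` in
its class, and the fibres are torsors under the nonzero constants. The constants are the space of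
the divisor `0`, possibly larger than `k`. -/
theorem card_effective_mul (c : DivisorClass k F) :
    Nat.card {E : CurvePoint k F →₀ ℕ // QuotientAddGroup.mk (effective E) = c} *
      (Nat.card k ^ dimension (0 : CurvePoint k F →₀ ℤ) - 1) =
      Nat.card k ^ classDimension c - 1 := by
  induction c using QuotientAddGroup.induction_on with | H D =>
  have hcard : ∀ A : CurvePoint k F →₀ ℤ,
      Nat.card {x : riemannRochSpace A // x ≠ 0} = Nat.card k ^ dimension A - 1 := fun A => by
    classical
    have := finite_riemannRochSpace hF A
    rw [← card_riemannRochSpace hF, ← Nat.card_congr (Equiv.optionSubtypeNe (0 : riemannRochSpace A)),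
      Finite.card_option, Nat.add_sub_cancel]
  rw [classDimension_mk hF, ← hcard, ← hcard, ← Nat.card_prod]
  have h1 : ∀ E : {E : CurvePoint k F →₀ ℕ //
      (QuotientAddGroup.mk (effective E) : DivisorClass k F) = QuotientAddGroup.mk D},
      ∃ x : F, x ≠ 0 ∧ poleDivisor x = D - effective E.1 := fun E => by
    have h := E.2
    rw [QuotientAddGroup.eq, mem_principalDivisors hF] at h
    obtain ⟨x, hx, h⟩ := h
    exact ⟨x, hx, by rw [h]; abel⟩
  choose x hx0 hx using h1
  have hu : ∀ u : {u : riemannRochSpace (0 : CurvePoint k F →₀ ℤ) // u ≠ 0},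
      ((u : riemannRochSpace (0 : CurvePoint k F →₀ ℤ)) : F) ≠ 0 ∧
      (poleDivisor ((u : riemannRochSpace (0 : CurvePoint k F →₀ ℤ)) : F) :
        CurvePoint k F →₀ ℤ) = 0 := fun u => by
    have h0 : ((u : riemannRochSpace (0 : CurvePoint k F →₀ ℤ)) : F) ≠ 0 :=
      fun h => u.2 (Subtype.ext h)
    refine ⟨h0, ?_⟩
    have h2 := (mem_riemannRochSpace_iff hF h0).1 u.1.2
    rw [← neg_eq_zero]
    exact eq_zero_of_degree_nonpos hF (neg_nonneg.2 h2)
      (by rw [map_neg, divisorDegree_poleDivisor hF, neg_zero])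
  have hpd : ∀ E u, (poleDivisor (x E * ((u : {u : riemannRochSpace (0 : CurvePoint k F →₀ ℤ) //
      u ≠ 0}) : riemannRochSpace (0 : CurvePoint k F →₀ ℤ))) : CurvePoint k F →₀ ℤ) =
      D - effective E.1 := fun E u => by
    rw [poleDivisor_mul hF (hx0 E) (hu u).1, (hu u).2, add_zero, hx]
  refine Nat.card_congr (Equiv.ofBijective (fun p =>
    ⟨⟨x p.1 * p.2.1, ?_⟩, ?_⟩) ⟨?_, ?_⟩)
  · rw [mem_riemannRochSpace_iff hF (mul_ne_zero (hx0 _) (hu _).1), hpd]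
    exact sub_le_self _ (effective_nonneg _)
  · exact fun h => mul_ne_zero (hx0 _) (hu _).1 (congrArg Subtype.val h)
  · rintro ⟨E, u⟩ ⟨E', u'⟩ h
    have h2 : x E * (u.1 : F) = x E' * (u'.1 : F) :=
      congrArg (fun z : {x : riemannRochSpace D // x ≠ 0} => (z.1 : F)) h
    have h3 := hpd E u
    rw [h2, hpd E' u', sub_right_inj] at h3
    have h4 : E = E' := Subtype.ext (effective_injective h3.symm)
    subst h4
    have h5 : u = u' := Subtype.ext (Subtype.ext (mul_left_cancel₀ (hx0 E) h2))
    rw [h5]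
  · rintro ⟨⟨y, hy⟩, hy0⟩
    have hy0' : y ≠ 0 := fun h => hy0 (Subtype.ext h)
    obtain ⟨E, hE⟩ := exists_effective_eq (sub_nonneg.2 ((mem_riemannRochSpace_iff hF hy0').1 hy))
    have hEc : (QuotientAddGroup.mk (effective E) : DivisorClass k F) = QuotientAddGroup.mk D := by
      rw [QuotientAddGroup.eq, mem_principalDivisors hF]
      exact ⟨y, hy0', by rw [hE]; abel⟩
    have hpx : (poleDivisor y : CurvePoint k F →₀ ℤ) = poleDivisor (x ⟨E, hEc⟩) := by
      rw [hx, hE]; abel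
    have hmem : (x ⟨E, hEc⟩)⁻¹ * y ∈ riemannRochSpace (0 : CurvePoint k F →₀ ℤ) := by
      rw [mem_riemannRochSpace_iff hF (mul_ne_zero (inv_ne_zero (hx0 _)) hy0'),
        poleDivisor_mul hF (inv_ne_zero (hx0 _)) hy0', poleDivisor_inv hF, hpx, neg_add_cancel]
    refine ⟨⟨⟨E, hEc⟩, ⟨⟨(x ⟨E, hEc⟩)⁻¹ * y, hmem⟩, fun h => ?_⟩⟩, ?_⟩
    · exact mul_ne_zero (inv_ne_zero (hx0 _)) hy0' (congrArg Subtype.val h)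
    · refine Subtype.ext (Subtype.ext ?_)
      exact mul_inv_cancel_left₀ (hx0 _) y

/-- After adding a multiple `N v` that makes the degree at least the genus, every class contains an
effective divisor, and there are finitely many of these. -/
theorem finite_class_of_degree (m : ℤ) : Finite {c : DivisorClass k F // classDegree c = m} := by
  obtain ⟨v⟩ := nonempty hF
  have hv : (1 : ℤ) ≤ v.degree := by exact_mod_cast v.degree_pos hF
  obtain ⟨N, hN0, hN⟩ : ∃ N : ℤ, 0 ≤ m + N * v.degree ∧ curveGenus k F ≤ m + N * v.degree := by
    refine ⟨max 0 (curveGenus k F) + |m|, ?_, ?_⟩ <;>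
    nlinarith [le_max_left 0 (curveGenus k F), le_max_right 0 (curveGenus k F), abs_nonneg m,
      neg_abs_le m]
  obtain ⟨M, hM⟩ := Int.eq_ofNat_of_zero_le hN0
  have := finite_effective_of_degree hF M
  let f : {E : CurvePoint k F →₀ ℕ // E.sum (fun v n => n * v.degree) = M} →
      {c : DivisorClass k F // classDegree c = m} := fun E =>
    ⟨QuotientAddGroup.mk (effective E.1 - Finsupp.single v N), by
      rw [classDegree_mk hF, map_sub, divisorDegree_single, effective, divisorDegree_mapRange, E.2,
        ← hM]
      ring⟩
  refine Finite.of_surjective f ?_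
  rintro ⟨c, hc⟩
  induction c using QuotientAddGroup.induction_on with | H D =>
  rw [classDegree_mk hF] at hc
  have h1 := degree_sub_dimension_le hF (D + Finsupp.single v N)
  rw [map_add, divisorDegree_single, hc] at h1
  have h2 : 0 < dimension (D + Finsupp.single v N) := by omega
  have := finite_riemannRochSpace hF (D + Finsupp.single v N)
  obtain ⟨⟨z, hz⟩, hz0⟩ := (Module.finrank_pos_iff_exists_ne_zero (R := k)).1 h2
  have hz0' : z ≠ 0 := fun h => hz0 (Subtype.ext h)
  obtain ⟨E, hE⟩ := exists_effective_eq (sub_nonneg.2 ((mem_riemannRochSpace_iff hF hz0').1 hz))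
  have hEM : E.sum (fun v n => n * v.degree) = M := by
    have h3 : divisorDegree (effective E) = (M : ℤ) := by
      rw [hE, map_sub, divisorDegree_poleDivisor hF, map_add, divisorDegree_single, hc, hM]; simp
    rw [effective, divisorDegree_mapRange] at h3
    exact_mod_cast h3
  refine ⟨⟨E, hEM⟩, Subtype.ext ?_⟩
  change (QuotientAddGroup.mk (effective E - Finsupp.single v N) : DivisorClass k F) = _
  rw [QuotientAddGroup.eq, mem_principalDivisors hF]
  exact ⟨z, hz0', by rw [hE]; abel⟩

end CurvePoint

namespace CurvePoint

variable {k F : Type*} [Field k] [Field F] [Algebra k F]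

variable (k F) in
/-- The number of effective divisors of degree `m`. -/
noncomputable def effectiveCount (m : ℕ) : ℕ :=
  Nat.card {E : CurvePoint k F →₀ ℕ // E.sum (fun v n => n * v.degree) = m}

variable (k F) in
/-- The number of divisor classes of degree `m`. -/
noncomputable def classCount (m : ℤ) : ℕ := Nat.card {c : DivisorClass k F // classDegree c = m}

variable (k F) in
/-- The sum of the numbers of elements of the Riemann-Roch spaces of the classes of degree `m`. -/
noncomputable def classSum (m : ℤ) : ℂ :=
  ∑ᶠ c : {c : DivisorClass k F // classDegree c = m}, (Nat.card k : ℂ) ^ classDimension c.1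

variable [Finite k] (hF : IsFunctionFieldOfOneVariable k F)
include hF

theorem effectiveCount_zero : effectiveCount k F 0 = 1 := by
  rw [effectiveCount, Nat.card_eq_one_iff_unique]
  refine ⟨⟨fun E E' => ?_⟩, ⟨0, by simp⟩⟩
  have h : ∀ E : {E : CurvePoint k F →₀ ℕ // E.sum (fun v n => n * v.degree) = 0}, E.1 = 0 :=
    fun E => by
      have h1 : effective E.1 = 0 := eq_zero_of_degree_nonpos hF (effective_nonneg _)
        (by rw [effective, divisorDegree_mapRange, E.2]; simp)
      refine effective_injective (h1.trans ?_)
      ext v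
      simp [effective_apply]
  exact Subtype.ext ((h E).trans (h E').symm)

theorem classCount_zero_pos : 0 < classCount k F 0 := by
  have := finite_class_of_degree hF 0
  have : Nonempty {c : DivisorClass k F // classDegree c = 0} :=
    ⟨⟨QuotientAddGroup.mk 0, by rw [classDegree_mk hF, map_zero]⟩⟩
  exact Nat.card_pos

/-- Translation by the class of `v`. Any period is enough for rationality of the zeta function, so
the least positive degree of a divisor need not be determined. -/
theorem classCount_add_degree (v : CurvePoint k F) (m : ℤ) :
    classCount k F (m + v.degree) = classCount k F m := by
  refine (Nat.card_congr ((Equiv.addRight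
    (QuotientAddGroup.mk (Finsupp.single v 1) : DivisorClass k F)).subtypeEquiv fun c => ?_)).symm
  rw [Equiv.coe_addRight, classDegree_add hF, classDegree_mk hF, divisorDegree_single, one_mul,
    add_left_inj]

theorem classSum_of_neg {m : ℤ} (hm : m < 0) : classSum k F m = classCount k F m := by
  have := finite_class_of_degree hF m
  have := Fintype.ofFinite {c : DivisorClass k F // classDegree c = m}
  have hcount : (classCount k F m : ℂ) =
      ∑ _c : {c : DivisorClass k F // classDegree c = m}, 1 := by
    rw [classCount, Nat.card_eq_fintype_card]; simp
  rw [classSum, finsum_eq_sum_of_fintype, hcount]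
  refine Finset.sum_congr rfl fun c _ => ?_
  have : classDimension c.1 = 0 :=
    dimension_eq_zero_of_degree_neg hF (lt_of_eq_of_lt c.2 hm)
  rw [this, pow_zero]

theorem exists_class_duality : ∃ e : DivisorClass k F ≃ DivisorClass k F, ∀ c,
    classDegree (e c) = 2 * curveGenus k F - 2 - classDegree c ∧
    (classDimension c : ℤ) - classDimension (e c) = classDegree c + 1 - curveGenus k F := by
  obtain ⟨W, hW⟩ := riemannRoch hF
  have h0 := hW 0
  have hW' := hW W
  rw [sub_zero, map_zero] at h0
  rw [sub_self] at hW'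
  refine ⟨Equiv.subLeft (QuotientAddGroup.mk W), fun c => ?_⟩
  induction c using QuotientAddGroup.induction_on with | H D =>
  rw [Equiv.subLeft_apply, ← QuotientAddGroup.mk_sub, classDegree_mk hF, classDegree_mk hF,
    classDimension_mk hF, classDimension_mk hF, map_sub]
  exact ⟨by omega, hW D⟩

theorem classCount_reflect (m : ℤ) :
    classCount k F (2 * curveGenus k F - 2 - m) = classCount k F m := by
  obtain ⟨e, he⟩ := exists_class_duality hF
  refine (Nat.card_congr (e.subtypeEquiv fun c => ?_)).symm
  rw [(he c).1, sub_right_inj]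

/-- Riemann-Roch for each class `c`, summed over the duality `c ↦ W - c`. Above degree `2 g - 2` the
dual sums reduce to class numbers. -/
theorem classSum_reflect (m : ℤ) :
    classSum k F m = (Nat.card k : ℂ) ^ (m + 1 - curveGenus k F) *
      classSum k F (2 * curveGenus k F - 2 - m) := by
  obtain ⟨e, he⟩ := exists_class_duality hF
  have := finite_class_of_degree hF m
  have := Fintype.ofFinite {c : DivisorClass k F // classDegree c = m}
  have := finite_class_of_degree hF (2 * curveGenus k F - 2 - m)
  have := Fintype.ofFinite
    {c : DivisorClass k F // classDegree c = 2 * curveGenus k F - 2 - m}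
  rw [classSum, classSum, finsum_eq_sum_of_fintype, finsum_eq_sum_of_fintype, Finset.mul_sum]
  refine Fintype.sum_equiv (e.subtypeEquiv fun c => ?_) _ _ fun c => ?_
  · rw [(he c).1, sub_right_inj]
  · have h1 := (he c.1).2
    rw [c.2] at h1
    have hq : (Nat.card k : ℂ) ≠ 0 := Nat.cast_ne_zero.2 Nat.card_pos.ne'
    change _ = _ * (Nat.card k : ℂ) ^ classDimension (e c.1)
    rw [← h1, ← zpow_natCast, ← zpow_natCast, ← zpow_add₀ hq]
    congr 1
    ring

theorem effectiveCount_mul (m : ℕ) :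
    ((Nat.card k ^ dimension (0 : CurvePoint k F →₀ ℤ) : ℕ) - 1 : ℂ) * effectiveCount k F m =
      classSum k F m - classCount k F m := by
  have := finite_class_of_degree hF m
  have := Fintype.ofFinite {c : DivisorClass k F // classDegree c = (m : ℤ)}
  have hdeg : ∀ E : CurvePoint k F →₀ ℕ, E.sum (fun v n => n * v.degree) = m ↔
      classDegree (QuotientAddGroup.mk (effective E) : DivisorClass k F) = m := fun E => by
    rw [classDegree_mk hF, effective, divisorDegree_mapRange, Nat.cast_inj]
  let e : {E : CurvePoint k F →₀ ℕ // E.sum (fun v n => n * v.degree) = m} ≃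
      Σ c : {c : DivisorClass k F // classDegree c = (m : ℤ)},
        {E : CurvePoint k F →₀ ℕ // QuotientAddGroup.mk (effective E) = c.1} :=
    { toFun := fun E => ⟨⟨QuotientAddGroup.mk (effective E.1), (hdeg _).1 E.2⟩, ⟨E.1, rfl⟩⟩
      invFun := fun p => ⟨p.2.1, (hdeg _).2 (by rw [p.2.2]; exact p.1.2)⟩
      left_inv := fun E => rfl
      right_inv := by
        rintro ⟨⟨c, hc⟩, ⟨E, hE⟩⟩
        dsimp only at hE
        subst hE
        rfl }
  have := finite_effective_of_degree hF m
  have hfin : ∀ c : {c : DivisorClass k F // classDegree c = (m : ℤ)},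
      Finite {E : CurvePoint k F →₀ ℕ // QuotientAddGroup.mk (effective E) = c.1} := fun c =>
    Finite.of_injective (fun E => e.symm ⟨c, E⟩) fun E E' h => by
      simpa using e.symm.injective h
  have hcount : (classCount k F m : ℂ) =
      ∑ _c : {c : DivisorClass k F // classDegree c = (m : ℤ)}, 1 := by
    rw [classCount, Nat.card_eq_fintype_card]; simp
  rw [effectiveCount, Nat.card_congr e, Nat.card_sigma, classSum, finsum_eq_sum_of_fintype,
    hcount, Nat.cast_sum,
    Finset.mul_sum, ← Finset.sum_sub_distrib]
  refine Finset.sum_congr rfl fun c _ => ?_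
  have h1 := card_effective_mul hF c.1
  have hq : 0 < Nat.card k := Nat.card_pos
  have h2 := congrArg (Nat.cast : ℕ → ℂ) h1
  rw [Nat.cast_mul, Nat.cast_sub (Nat.one_le_pow _ _ hq), Nat.cast_sub (Nat.one_le_pow _ _ hq),
    Nat.cast_pow _ (classDimension c.1), Nat.cast_one] at h2
  rw [← h2, mul_comm]

theorem one_lt_card_pow_dimension_zero :
    1 < Nat.card k ^ dimension (0 : CurvePoint k F →₀ ℤ) := by
  rw [← card_riemannRochSpace hF]
  have := finite_riemannRochSpace hF (0 : CurvePoint k F →₀ ℤ)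
  have h1 : (1 : F) ∈ riemannRochSpace (0 : CurvePoint k F →₀ ℤ) := fun v => by
    change v.valuation 1 ≤ _; simp
  have : Nontrivial (riemannRochSpace (0 : CurvePoint k F →₀ ℤ)) :=
    ⟨⟨1, h1⟩, 0, fun h => one_ne_zero (congrArg Subtype.val h)⟩
  exact Finite.one_lt_card

end CurvePoint

/-! ### The zeta function as a rational function of `y = q ^ (-s)`. -/

section PeriodicSeries

/-- The rational function expanding to `∑_{m ≥ a} h m y ^ (m + c)` for `h` of period `d`. -/
noncomputable def periodicSeries (h : ℤ → ℂ) (d : ℕ) (a c : ℤ) (y : ℂ) : ℂ :=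
  (∑ r ∈ Finset.range d, h (a + r) * y ^ (a + r + c)) / (1 - y ^ d)

variable {h : ℤ → ℂ} {d : ℕ}

theorem summable_periodic_mul_zpow (hd : 0 < d) (hh : ∀ m, h (m + d) = h m) (a c : ℤ) {y : ℂ}
    (hy0 : y ≠ 0) (hy : ‖y‖ < 1) : Summable fun n : ℕ => h (a + n) * y ^ (a + n + c) := by
  have hC : ∀ n : ℕ, ‖h (a + n)‖ ≤ ∑ r ∈ Finset.range d, ‖h (a + r)‖ := by
    intro n
    induction n using Nat.strong_induction_on with
    | _ n ih =>
      by_cases hn : n < d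
      · exact Finset.single_le_sum (f := fun r : ℕ => ‖h (a + r)‖) (fun _ _ => norm_nonneg _)
          (Finset.mem_range.2 hn)
      · have h1 := ih (n - d) (by omega)
        rw [← hh] at h1
        rwa [show a + ((n - d : ℕ) : ℤ) + d = a + n by omega] at h1
  refine Summable.of_norm_bounded (g := fun n =>
    ((∑ r ∈ Finset.range d, ‖h (a + r)‖) * ‖y‖ ^ (a + c)) * ‖y‖ ^ n)
    ((summable_geometric_of_lt_one (norm_nonneg _) hy).mul_left _) fun n => ?_
  rw [norm_mul, norm_zpow, show a + n + c = (a + c) + n by ring,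
    zpow_add₀ (norm_ne_zero_iff.2 hy0), zpow_natCast, ← mul_assoc]
  exact mul_le_mul_of_nonneg_right (mul_le_mul_of_nonneg_right (hC n) (by positivity))
    (by positivity)

theorem hasSum_periodicSeries (hd : 0 < d) (hh : ∀ m, h (m + d) = h m) (a c : ℤ) {y : ℂ}
    (hy0 : y ≠ 0) (hy : ‖y‖ < 1) :
    HasSum (fun n : ℕ => h (a + n) * y ^ (a + n + c)) (periodicSeries h d a c y) := by
  have hs := summable_periodic_mul_zpow hd hh a c hy0 hy
  have h1 := hs.sum_add_tsum_nat_add d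
  have h2 : ∀ n : ℕ, h (a + ((n + d : ℕ) : ℤ)) * y ^ (a + ((n + d : ℕ) : ℤ) + c) =
      y ^ d * (h (a + n) * y ^ (a + n + c)) := fun n => by
    rw [Nat.cast_add, ← add_assoc, hh, show a + n + d + c = (a + n + c) + d by ring,
      zpow_add₀ hy0, zpow_natCast]
    ring
  simp_rw [h2, tsum_mul_left] at h1
  have h3 : 1 - y ^ d ≠ 0 := by
    intro h
    have : ‖y ^ d‖ < 1 := by rw [norm_pow]; exact pow_lt_one₀ (norm_nonneg _) hy hd.ne'
    rw [← sub_eq_zero.1 h, norm_one] at this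
    exact lt_irrefl _ this
  have h4 : periodicSeries h d a c y = ∑' n : ℕ, h (a + n) * y ^ (a + n + c) := by
    rw [periodicSeries, div_eq_iff h3]
    linear_combination h1
  rw [h4]
  exact hs.hasSum

/-- Formally the sum of a periodic sequence over all of `ℤ` is zero as a rational function, so the
half-series towards `-∞` is minus the one towards `+∞`. Reversing one period makes this finite; the
symmetry of `h` identifies the coefficients. -/
theorem periodicSeries_inv (hh : ∀ m, h (m + d) = h m) {a b c : ℤ}
    (hrefl : ∀ m, h (-2 * c - m) = h m) (hab : a + b = -2 * c + 1) {y : ℂ} (hy0 : y ≠ 0)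
    (hy : y ^ d ≠ 1) :
    periodicSeries h d a c y⁻¹ = - periodicSeries h d b c y := by
  have h1 : 1 - y ^ d ≠ 0 := sub_ne_zero.2 hy.symm
  have hyd : y ^ d ≠ 0 := pow_ne_zero _ hy0
  have h2 : 1 - y⁻¹ ^ d ≠ 0 := by
    rw [inv_pow]
    intro h
    exact hy (inv_eq_one.1 (sub_eq_zero.1 h).symm)
  rw [periodicSeries, periodicSeries, ← neg_div, div_eq_div_iff h2 h1,
    ← Finset.sum_range_reflect (fun r : ℕ => h (b + r) * y ^ (b + r + c))]
  have h3 : ∀ r ∈ Finset.range d, h (b + ((d - 1 - r : ℕ) : ℤ)) * y ^ (b + ((d - 1 - r : ℕ) : ℤ) + c) =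
      y ^ d * (h (a + r) * y⁻¹ ^ (a + r + c)) := fun r hr => by
    rw [Finset.mem_range] at hr
    have e1 : b + ((d - 1 - r : ℕ) : ℤ) = (-2 * c - (a + r)) + d := by omega
    rw [e1, hh, hrefl, inv_zpow', ← zpow_natCast y d, mul_left_comm, ← zpow_add₀ hy0]
    congr 2
    ring
  rw [Finset.sum_congr rfl h3, ← Finset.mul_sum, inv_pow]
  field_simp
  ring

end PeriodicSeries

namespace CurvePoint

variable {k F : Type*} [Field k] [Field F] [Algebra k F]

variable (k F) in
/-- The largest degree of a divisor class which may have both a nonzero Riemann-Roch space and a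
nonzero dual space. -/
noncomputable def specialBound : ℤ := max 0 (2 * curveGenus k F - 2)

variable (k F) in
/-- The degree opposite to `specialBound`. -/
noncomputable def specialLowerBound : ℤ := 2 * curveGenus k F - 2 - specialBound k F

variable (k F) in
/-- The part of the zeta function, as a function of `y = q ^ (-s)`, due to the classes of degree at
most `specialBound`. -/
noncomputable def zetaPolynomial (y : ℂ) : ℂ :=
  ∑ n ∈ Finset.range (specialBound k F + 1 - specialLowerBound k F).toNat,
    classSum k F (specialLowerBound k F + n) *
      y ^ (specialLowerBound k F + n + (1 - curveGenus k F))

/-- The numbers of divisor classes of degrees from `specialLowerBound` on, summed up to a rational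
function. -/
noncomputable def classSeries (v : CurvePoint k F) (y : ℂ) : ℂ :=
  periodicSeries (fun m => classCount k F m) v.degree (specialLowerBound k F) (1 - curveGenus k F) y

/-- The zeta function as a function of `y = q ^ (-s)`, multiplied by the number of nonzero
constants. -/
noncomputable def rationalZeta (v : CurvePoint k F) (y : ℂ) : ℂ :=
  zetaPolynomial k F y - classSeries v y - classSeries v ((Nat.card k : ℂ) * y)⁻¹

theorem specialLowerBound_nonpos : specialLowerBound k F ≤ 0 := by
  rw [specialLowerBound, specialBound]
  omega

theorem specialLowerBound_le : specialLowerBound k F ≤ specialBound k F + 1 := by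
  rw [specialLowerBound, specialBound]
  omega

variable [Finite k] (hF : IsFunctionFieldOfOneVariable k F)
include hF

/-- The degrees run over an interval symmetric under `m ↦ 2 g - 2 - m`, and the power of `q` from
Riemann-Roch is absorbed by `y ↦ (q y)⁻¹`. -/
theorem zetaPolynomial_inv (y : ℂ) :
    zetaPolynomial k F ((Nat.card k : ℂ) * y)⁻¹ = zetaPolynomial k F y := by
  have hq : (Nat.card k : ℂ) ≠ 0 := Nat.cast_ne_zero.2 Nat.card_pos.ne'
  rw [zetaPolynomial, zetaPolynomial, ← Finset.sum_range_reflect]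
  refine Finset.sum_congr rfl fun n hn => ?_
  rw [Finset.mem_range] at hn
  have e1 : specialLowerBound k F +
      (((specialBound k F + 1 - specialLowerBound k F).toNat - 1 - n : ℕ) : ℤ) =
      2 * curveGenus k F - 2 - (specialLowerBound k F + n) := by
    have := specialLowerBound_le (k := k) (F := F)
    have : specialLowerBound k F = 2 * curveGenus k F - 2 - specialBound k F := rfl
    omega
  rw [e1, classSum_reflect hF (specialLowerBound k F + n), inv_zpow', mul_zpow,
    show -(2 * curveGenus k F - 2 - (specialLowerBound k F + n) + (1 - curveGenus k F)) =
      specialLowerBound k F + n + 1 - curveGenus k F by ring,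
    show specialLowerBound k F + n + (1 - curveGenus k F) =
      specialLowerBound k F + n + 1 - curveGenus k F by ring]
  ring

theorem rationalZeta_inv (v : CurvePoint k F) {y : ℂ} (hy : y ≠ 0) :
    rationalZeta v ((Nat.card k : ℂ) * y)⁻¹ = rationalZeta v y := by
  have hq : (Nat.card k : ℂ) ≠ 0 := Nat.cast_ne_zero.2 Nat.card_pos.ne'
  rw [rationalZeta, rationalZeta, zetaPolynomial_inv hF y]
  have h1 : ((Nat.card k : ℂ) * ((Nat.card k : ℂ) * y)⁻¹)⁻¹ = y := by field_simp
  rw [h1]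
  ring

/-- The coefficients are `classSum - classCount`. The second part is a periodic series in `y`; the
first is a polynomial part up to `specialBound` followed by a periodic series in `q y`. Both sums
start at `specialLowerBound ≤ 0` so that the result is symmetric. -/
theorem hasSum_rationalZeta (v : CurvePoint k F) {y : ℂ} (hy0 : y ≠ 0)
    (hy : ‖(Nat.card k : ℂ) * y‖ < 1) :
    HasSum (fun m : ℕ => ((Nat.card k ^ dimension (0 : CurvePoint k F →₀ ℤ) : ℕ) - 1 : ℂ) *
      effectiveCount k F m * y ^ (m + (1 - curveGenus k F))) (rationalZeta v y) := by
  have hq : (Nat.card k : ℂ) ≠ 0 := Nat.cast_ne_zero.2 Nat.card_pos.ne'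
  have hu0 : (Nat.card k : ℂ) * y ≠ 0 := mul_ne_zero hq hy0
  have hy1 : ‖y‖ < 1 := by
    refine lt_of_le_of_lt ?_ hy
    rw [norm_mul, Complex.norm_natCast]
    exact le_mul_of_one_le_left (norm_nonneg _) (by exact_mod_cast Nat.card_pos)
  set u := (Nat.card k : ℂ) * y with hu
  set g := curveGenus k F
  set a := specialLowerBound k F with ha
  set M := specialBound k F
  have haM : a = 2 * g - 2 - M := rfl
  have ha0 : a ≤ 0 := specialLowerBound_nonpos
  have haM1 : a ≤ M + 1 := specialLowerBound_le
  have hMG : 2 * g - 2 ≤ M := le_max_right _ _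
  set h : ℤ → ℂ := fun m => classCount k F m with hh
  have hper : ∀ m, h (m + v.degree) = h m := fun m => by
    simp only [hh, classCount_add_degree hF v m]
  have hrefl : ∀ m, h (-2 * (1 - g) - m) = h m := fun m => by
    rw [show -2 * (1 - g) - m = 2 * g - 2 - m by ring]
    simp only [hh, g, classCount_reflect hF m]
  have hd := v.degree_pos hF
  have h1 := hasSum_periodicSeries hd hper a (1 - g) hy0 hy1
  have h2 := hasSum_periodicSeries hd hper (M + 1) (1 - g) hu0 hy
  -- The tail starts at `M + 1`, complementary to `specialLowerBound = 2 g - 2 - M` under the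
  -- inversion.
  have h3 : periodicSeries h v.degree (M + 1) (1 - g) u = - classSeries v u⁻¹ := by
    rw [classSeries, periodicSeries_inv (b := M + 1) hper hrefl (by rw [← ha, haM]; ring) hu0, neg_neg]
    intro h'
    have : ‖u ^ v.degree‖ < 1 := by rw [norm_pow]; exact pow_lt_one₀ (norm_nonneg _) hy hd.ne'
    rw [h', norm_one] at this
    exact lt_irrefl _ this
  rw [h3] at h2
  have h4 : HasSum (fun n : ℕ => classSum k F (a + n) * y ^ (a + n + (1 - g)))
      (zetaPolynomial k F y - classSeries v u⁻¹) := by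
    rw [← hasSum_nat_add_iff' (M + 1 - a).toNat]
    have e : zetaPolynomial k F y - classSeries v u⁻¹ -
        ∑ n ∈ Finset.range (M + 1 - a).toNat, classSum k F (a + n) * y ^ (a + n + (1 - g)) =
        - classSeries v u⁻¹ := by
      rw [zetaPolynomial]; ring
    rw [e]
    refine (congrArg (fun f => HasSum f _) (funext fun n => ?_)).mp h2
    have e1 : a + ((n + (M + 1 - a).toNat : ℕ) : ℤ) = M + 1 + n := by omega
    rw [e1, classSum_reflect hF (M + 1 + n), classSum_of_neg hF (by omega), classCount_reflect hF,
      hu, mul_zpow, show M + 1 + (n : ℤ) + 1 - g = M + 1 + n + (1 - g) by ring]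
    ring
  have h5 : HasSum (fun n : ℕ => (classSum k F (a + n) - h (a + n)) * y ^ (a + n + (1 - g)))
      (rationalZeta v y) := by
    have e : rationalZeta v y = zetaPolynomial k F y - classSeries v u⁻¹ -
        periodicSeries h v.degree a (1 - g) y := by
      rw [rationalZeta, classSeries, sub_right_comm]
    rw [e]
    exact (congrArg (fun f => HasSum f _) (funext fun n => by ring)).mp (h4.sub h1)
  rw [← hasSum_nat_add_iff' (-a).toNat] at h5
  -- The added negative degrees contribute nothing: every space is zero there, so `classSum` and
  -- `classCount` agree.
  have h6 : ∑ n ∈ Finset.range (-a).toNat,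
      (classSum k F (a + n) - h (a + n)) * y ^ (a + n + (1 - g)) = 0 := by
    refine Finset.sum_eq_zero fun n hn => ?_
    rw [Finset.mem_range] at hn
    rw [classSum_of_neg hF (by omega), sub_self, zero_mul]
  rw [h6, sub_zero] at h5
  refine (congrArg (fun f => HasSum f _) (funext fun m => ?_)).mp h5
  have e1 : a + ((m + (-a).toNat : ℕ) : ℤ) = m := by omega
  rw [e1, effectiveCount_mul hF]

end CurvePoint

/-! ### Continuation, functional equation and pole at `1` of the Artin zeta function. -/

/-- All terms in a fibre are equal, so the norms in a fibre add up to the norm of the fibre sum.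
Convergence in `ℂ` is absolute, hence the series may be ungrouped. -/
theorem hasSum_pow_of_hasSum_card_fiber {α : Type*} (d : α → ℕ)
    (hd : ∀ m, Finite {a // d a = m}) {y S : ℂ}
    (h : HasSum (fun m : ℕ => (Nat.card {a // d a = m} : ℂ) * y ^ m) S) :
    HasSum (fun a => y ^ d a) S := by
  rw [← (Equiv.sigmaFiberEquiv d).hasSum_iff]
  have hterm : ∀ c : Σ m, {a // d a = m},
      ((fun a => y ^ d a) ∘ Equiv.sigmaFiberEquiv d) c = y ^ c.1 := fun c => by
    rw [Function.comp_apply, Equiv.sigmaFiberEquiv_apply, c.2.2]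
  have hfib : ∀ (z : ℂ) (m : ℕ), HasSum (fun _ : {a // d a = m} => z)
      ((Nat.card {a // d a = m} : ℂ) * z) := fun z m => by
    have := hd m
    have := Fintype.ofFinite {a // d a = m}
    convert hasSum_fintype (fun _ : {a // d a = m} => z)
    rw [Finset.sum_const, Finset.card_univ, nsmul_eq_mul, Nat.card_eq_fintype_card]
  have hsum : Summable ((fun a => y ^ d a) ∘ Equiv.sigmaFiberEquiv d) := by
    refine Summable.of_norm ((summable_sigma_of_nonneg fun _ => norm_nonneg _).2 ⟨?_, ?_⟩)
    · intro m
      have := hd m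
      exact Summable.of_finite
    · refine (summable_norm_iff.2 h.summable).congr fun m => ?_
      simp_rw [hterm]
      have := hd m
      have := Fintype.ofFinite {a // d a = m}
      rw [tsum_fintype, Finset.sum_const, Finset.card_univ, nsmul_eq_mul, norm_mul,
        Complex.norm_natCast, Nat.card_eq_fintype_card]
  refine h.sigma_of_hasSum (fun m => ?_) hsum
  simp_rw [hterm]
  exact hfib _ m

theorem Meromorphic.eventuallyEq_codiscrete_of_eventuallyEq {f g : ℂ → ℂ} (hf : Meromorphic f)
    (hg : Meromorphic g) {z : ℂ} (h : f =ᶠ[𝓝 z] g) : f =ᶠ[codiscrete ℂ] g := by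
  rw [Filter.EventuallyEq, eventually_codiscrete_iff]
  intro x
  have hfg : MeromorphicOn (fun s => f s - g s) Set.univ := fun y _ => (hf y).sub (hg y)
  have htop : meromorphicOrderAt (fun s => f s - g s) z = ⊤ := by
    rw [meromorphicOrderAt_eq_top_iff]
    exact (h.filter_mono nhdsWithin_le_nhds).mono fun s hs => sub_eq_zero.2 hs
  have hx : meromorphicOrderAt (fun s => f s - g s) x = ⊤ := by
    by_contra hne
    exact hfg.meromorphicOrderAt_ne_top_of_isPreconnected isPreconnected_univ (Set.mem_univ x)
      (Set.mem_univ z) hne htop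
  exact (meromorphicOrderAt_eq_top_iff.1 hx).mono fun s hs => sub_eq_zero.1 hs

namespace CurvePoint

variable {k F : Type*} [Field k] [Field F] [Algebra k F]

/-- The complete Artin zeta function, as a rational function of `q ^ (-s)`. -/
noncomputable def continuedZeta (v : CurvePoint k F) (s : ℂ) : ℂ :=
  rationalZeta v ((Nat.card k : ℂ) ^ (-s)) /
    ((Nat.card k ^ dimension (0 : CurvePoint k F →₀ ℤ) : ℕ) - 1 : ℂ)

theorem analyticAt_zetaPolynomial_comp {f : ℂ → ℂ} {s : ℂ} (hf : AnalyticAt ℂ f s)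
    (h0 : f s ≠ 0) : AnalyticAt ℂ (fun z => zetaPolynomial k F (f z)) s :=
  Finset.analyticAt_fun_sum _ fun _ _ => analyticAt_const.mul (hf.fun_zpow h0)

theorem analyticAt_classSeries_numerator (v : CurvePoint k F) {f : ℂ → ℂ} {s : ℂ}
    (hf : AnalyticAt ℂ f s) (h0 : f s ≠ 0) :
    AnalyticAt ℂ (fun z => ∑ r ∈ Finset.range v.degree,
      (classCount k F (specialLowerBound k F + r) : ℂ) *
        f z ^ (specialLowerBound k F + r + (1 - curveGenus k F))) s :=
  Finset.analyticAt_fun_sum _ fun _ _ => analyticAt_const.mul (hf.fun_zpow h0)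

theorem analyticAt_classSeries_comp (v : CurvePoint k F) {f : ℂ → ℂ} {s : ℂ}
    (hf : AnalyticAt ℂ f s) (h0 : f s ≠ 0) (h1 : f s ^ v.degree ≠ 1) :
    AnalyticAt ℂ (fun z => classSeries v (f z)) s :=
  (analyticAt_classSeries_numerator v hf h0).fun_div (analyticAt_const.sub (hf.fun_pow _))
    (sub_ne_zero.2 h1.symm)

theorem meromorphicAt_classSeries_comp (v : CurvePoint k F) {f : ℂ → ℂ} {s : ℂ}
    (hf : AnalyticAt ℂ f s) (h0 : f s ≠ 0) :
    MeromorphicAt (fun z => classSeries v (f z)) s :=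
  (analyticAt_classSeries_numerator v hf h0).meromorphicAt.fun_div
    (analyticAt_const.sub (hf.fun_pow _)).meromorphicAt

section Finite

variable [Finite k] (hF : IsFunctionFieldOfOneVariable k F)

theorem natCast_card_ne_zero : (Nat.card k : ℂ) ≠ 0 := Nat.cast_ne_zero.2 Nat.card_pos.ne'

theorem natCast_card_cpow_ne_zero (s : ℂ) : (Nat.card k : ℂ) ^ s ≠ 0 := by
  rw [Ne, Complex.cpow_eq_zero_iff]
  exact fun h => natCast_card_ne_zero h.1

theorem inv_natCast_card_mul_cpow (s : ℂ) :
    ((Nat.card k : ℂ) * (Nat.card k : ℂ) ^ (-s))⁻¹ = (Nat.card k : ℂ) ^ (-(1 - s)) := by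
  rw [Complex.cpow_neg, Complex.cpow_neg, Complex.cpow_sub _ _ natCast_card_ne_zero,
    Complex.cpow_one, ← div_eq_mul_inv]

theorem norm_natCast_card_cpow (s : ℂ) :
    ‖(Nat.card k : ℂ) ^ s‖ = (Nat.card k : ℝ) ^ s.re :=
  Complex.norm_natCast_cpow_of_pos Nat.card_pos _

theorem analyticAt_natCast_card_cpow_neg (s : ℂ) :
    AnalyticAt ℂ (fun z => (Nat.card k : ℂ) ^ (-z)) s :=
  analyticAt_natCast_cpow_neg Finite.one_lt_card s

include hF

theorem continuedZeta_one_sub (v : CurvePoint k F) (s : ℂ) :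
    continuedZeta v (1 - s) = continuedZeta v s := by
  rw [continuedZeta, continuedZeta, ← inv_natCast_card_mul_cpow,
    rationalZeta_inv hF v (natCast_card_cpow_ne_zero _)]

theorem meromorphic_continuedZeta (v : CurvePoint k F) : Meromorphic (continuedZeta v) := by
  intro s
  have hY := analyticAt_natCast_card_cpow_neg (k := k) s
  have h0 := natCast_card_cpow_ne_zero (k := k) (-s)
  refine (((analyticAt_zetaPolynomial_comp hY h0).meromorphicAt.fun_sub
    (meromorphicAt_classSeries_comp v hY h0)).fun_sub
    (meromorphicAt_classSeries_comp v ((analyticAt_const.mul hY).fun_inv ?_) ?_)).fun_div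
    (MeromorphicAt.const _ _)
  · exact mul_ne_zero natCast_card_ne_zero h0
  · exact inv_ne_zero (mul_ne_zero natCast_card_ne_zero h0)

theorem natCast_card_cpow_pow_degree_ne_one (v : CurvePoint k F) {s : ℂ} (hs : s.re ≠ 0) :
    ((Nat.card k : ℂ) ^ (-s)) ^ v.degree ≠ 1 := by
  intro h
  have h1 := congrArg norm h
  rw [norm_pow, norm_one, pow_eq_one_iff_of_nonneg (norm_nonneg _) (v.degree_pos hF).ne',
    norm_natCast_card_cpow, Complex.neg_re] at h1
  have h2 : (1 : ℝ) < Nat.card k := by exact_mod_cast Finite.one_lt_card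
  rcases lt_or_gt_of_ne hs with h3 | h3
  · exact (Real.one_lt_rpow h2 (neg_pos.2 h3)).ne' h1
  · exact (Real.rpow_lt_one_of_one_lt_of_neg h2 (neg_neg_of_pos h3)).ne h1

theorem analyticAt_continuedZeta (v : CurvePoint k F) {s : ℂ} (hs0 : s.re ≠ 0) (hs1 : s.re ≠ 1) :
    AnalyticAt ℂ (continuedZeta v) s := by
  have hY := analyticAt_natCast_card_cpow_neg (k := k) s
  have h0 := natCast_card_cpow_ne_zero (k := k) (-s)
  have h1 := mul_ne_zero (natCast_card_ne_zero (k := k)) h0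
  refine (((analyticAt_zetaPolynomial_comp hY h0).fun_sub
    (analyticAt_classSeries_comp v hY h0 (natCast_card_cpow_pow_degree_ne_one hF v hs0))).fun_sub
    (analyticAt_classSeries_comp v ((analyticAt_const.mul hY).fun_inv h1) (inv_ne_zero h1)
      ?_)).div_const
  rw [Pi.mul_apply, inv_natCast_card_mul_cpow]
  refine natCast_card_cpow_pow_degree_ne_one hF v ?_
  rw [Complex.sub_re, Complex.one_re]
  exact sub_ne_zero.2 hs1.symm

theorem constants_sub_one_ne_zero :
    ((Nat.card k ^ dimension (0 : CurvePoint k F →₀ ℤ) : ℕ) - 1 : ℂ) ≠ 0 := by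
  rw [sub_ne_zero]
  exact_mod_cast (one_lt_card_pow_dimension_zero hF).ne'

theorem hasSum_effectiveCount (v : CurvePoint k F) {s : ℂ} (hs : 1 < s.re) :
    HasSum (fun m : ℕ => (effectiveCount k F m : ℂ) * ((Nat.card k : ℂ) ^ (-s)) ^ m)
      ((Nat.card k : ℂ) ^ (-((curveGenus k F - 1 : ℂ) * s)) * continuedZeta v s) := by
  have hY0 := natCast_card_cpow_ne_zero (k := k) (-s)
  have hY : ‖(Nat.card k : ℂ) * (Nat.card k : ℂ) ^ (-s)‖ < 1 := by
    have h2 : (1 : ℝ) < Nat.card k := by exact_mod_cast Finite.one_lt_card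
    have h3 : (Nat.card k : ℂ) * (Nat.card k : ℂ) ^ (-s) = (Nat.card k : ℂ) ^ (1 - s) := by
      rw [sub_eq_add_neg, Complex.cpow_add _ _ natCast_card_ne_zero, Complex.cpow_one]
    rw [h3, norm_natCast_card_cpow]
    refine Real.rpow_lt_one_of_one_lt_of_neg h2 ?_
    rw [Complex.sub_re, Complex.one_re]
    linarith
  have hg : (Nat.card k : ℂ) ^ (-((curveGenus k F - 1 : ℂ) * s)) =
      ((Nat.card k : ℂ) ^ (-s)) ^ (curveGenus k F - 1) := by
    rw [← Complex.cpow_int_mul]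
    congr 1
    push_cast
    ring
  have hc := constants_sub_one_ne_zero hF
  have h := (hasSum_rationalZeta hF v hY0 hY).mul_left
    (((Nat.card k : ℂ) ^ (-s)) ^ (curveGenus k F - 1) /
      ((Nat.card k ^ dimension (0 : CurvePoint k F →₀ ℤ) : ℕ) - 1 : ℂ))
  rw [hg, continuedZeta, ← mul_comm_div]
  refine (congrArg (fun f => HasSum f _) (funext fun m => ?_)).mp h
  rw [zpow_add₀ hY0, zpow_natCast, show (1 - curveGenus k F) = -(curveGenus k F - 1) by ring,
    zpow_neg]
  have := zpow_ne_zero (curveGenus k F - 1) hY0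
  field_simp

theorem hasSum_artinZetaSeries (v : CurvePoint k F) {s : ℂ} (hs : 1 < s.re) :
    HasSum (fun m : ℕ => (effectiveCount k F m : ℂ) * ((Nat.card k : ℂ) ^ (-s)) ^ m)
      (artinZetaSeries k F s) := by
  have h := hasSum_effectiveCount hF v hs
  have h1 := hasSum_pow_of_hasSum_card_fiber _ (finite_effective_of_degree hF) h
  have h2 : artinZetaSeries k F s =
      ∑' D : CurvePoint k F →₀ ℕ, ((Nat.card k : ℂ) ^ (-s)) ^ (D.sum fun v n => n * v.degree) := by
    refine tsum_congr fun D => ?_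
    rw [← Complex.cpow_nat_mul, mul_neg]
  rw [h2, h1.tsum_eq]
  exact h

theorem continuedZeta_eq (v : CurvePoint k F) {s : ℂ} (hs : 1 < s.re) :
    continuedZeta v s =
      (Nat.card k : ℂ) ^ ((curveGenus k F - 1 : ℂ) * s) * artinZetaSeries k F s := by
  rw [(hasSum_artinZetaSeries hF v hs).unique (hasSum_effectiveCount hF v hs), ← mul_assoc,
    Complex.cpow_neg, mul_inv_cancel₀ (natCast_card_cpow_ne_zero _), one_mul]

/-- The zeta series at a real point has nonnegative terms, and its degree-zero term is `1`. -/
theorem continuedZeta_natCast_ne_zero (v : CurvePoint k F) {n : ℕ} (hn : 2 ≤ n) :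
    continuedZeta v n ≠ 0 := by
  have hs : 1 < (n : ℂ).re := by
    rw [Complex.natCast_re]
    exact_mod_cast hn
  rw [continuedZeta_eq hF v hs]
  refine mul_ne_zero (natCast_card_cpow_ne_zero _) fun h0 => ?_
  have h := Complex.hasSum_re (hasSum_artinZetaSeries hF v hs)
  have hre : ∀ m : ℕ, ((effectiveCount k F m : ℂ) * ((Nat.card k : ℂ) ^ (-(n : ℂ))) ^ m).re =
      effectiveCount k F m * (((Nat.card k : ℝ) ^ n)⁻¹) ^ m := fun m => by
    have : (effectiveCount k F m : ℂ) * ((Nat.card k : ℂ) ^ (-(n : ℂ))) ^ m =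
        ((effectiveCount k F m * (((Nat.card k : ℝ) ^ n)⁻¹) ^ m : ℝ) : ℂ) := by
      rw [Complex.cpow_neg, Complex.cpow_natCast]
      push_cast
      rfl
    rw [this, Complex.ofReal_re]
  simp_rw [hre] at h
  have h1 := le_hasSum h 0 fun m _ => by positivity
  rw [effectiveCount_zero hF, h0, pow_zero, Complex.zero_re] at h1
  norm_num at h1

/-- One of the consecutive degrees is a multiple of the period, where the count equals that of
degree zero. -/
theorem exists_classCount_ne_zero (v : CurvePoint k F) (a : ℤ) :
    ∃ r ∈ Finset.range v.degree, classCount k F (a + r) ≠ 0 := by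
  have hd : (0 : ℤ) < v.degree := by exact_mod_cast v.degree_pos hF
  have hper : Function.Periodic (classCount k F) (v.degree : ℤ) := classCount_add_degree hF v
  refine ⟨((-a) % v.degree).toNat, Finset.mem_range.2 ?_, ?_⟩
  · have := Int.emod_lt_of_pos (-a) hd
    omega
  · have h1 := Int.mul_ediv_add_emod (-a) v.degree
    have h2 := Int.emod_nonneg (-a) hd.ne'
    have h3 : a + (((-a) % v.degree).toNat : ℤ) = (-(-a / v.degree)) * v.degree := by
      rw [Int.toNat_of_nonneg h2]
      linear_combination h1
    rw [h3]
    have := hper.int_mul_eq (-(-a / v.degree))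
    simp only [Int.cast_id] at this
    rw [this]
    exact (classCount_zero_pos hF).ne'

theorem exists_continuedZeta_one_add (v : CurvePoint k F) :
    ∃ φ : ℂ → ℂ, AnalyticAt ℂ φ 0 ∧ φ 0 ≠ 0 ∧
      ∀ z, z ≠ 0 → continuedZeta v (1 + z) = z⁻¹ * φ z := by
  obtain ⟨ε, hε, hε0, hεz⟩ := exists_inv_one_sub_natCast_cpow (q := Nat.card k) Finite.one_lt_card
  have hd : (v.degree : ℂ) ≠ 0 := Nat.cast_ne_zero.2 (v.degree_pos hF).ne'
  set N : ℂ → ℂ := fun y => ∑ r ∈ Finset.range v.degree,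
      (classCount k F (specialLowerBound k F + r) : ℂ) *
        y ^ (specialLowerBound k F + r + (1 - curveGenus k F)) with hN
  have hN1 : N 1 ≠ 0 := by
    obtain ⟨r, hr, hr0⟩ := exists_classCount_ne_zero hF v (specialLowerBound k F)
    simp only [hN, one_zpow, mul_one]
    exact_mod_cast (Finset.sum_pos' (fun _ _ => Nat.zero_le _) ⟨r, hr, Nat.pos_of_ne_zero hr0⟩).ne'
  set Y : ℂ → ℂ := fun z => (Nat.card k : ℂ) ^ (-(1 + z)) with hY
  have hYa : AnalyticAt ℂ Y 0 :=
    (analyticAt_natCast_card_cpow_neg (k := k) (1 + 0)).fun_comp_of_eq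
      (analyticAt_const.add analyticAt_id) rfl
  have hY0 : Y 0 ≠ 0 := natCast_card_cpow_ne_zero _
  set U : ℂ → ℂ := fun z => (Nat.card k : ℂ) ^ (-(-z)) with hU
  have hUa : AnalyticAt ℂ U 0 :=
    (analyticAt_natCast_card_cpow_neg (k := k) (-0)).fun_comp_of_eq analyticAt_id.neg rfl
  have hU0 : U 0 = 1 := by simp [hU]
  set c := ((Nat.card k ^ dimension (0 : CurvePoint k F →₀ ℤ) : ℕ) - 1 : ℂ)
  have hc : c ≠ 0 := constants_sub_one_ne_zero hF
  have hεa : AnalyticAt ℂ (fun z => ε (-v.degree * z)) 0 :=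
    AnalyticAt.fun_comp_of_eq (g := ε) (y := 0) hε (analyticAt_const.mul analyticAt_id)
      (by simp)
  -- At `s = 1 + z` only `classSeries` at `(q y)⁻¹ = q ^ z = U z` is singular. Its denominator is `1
  -- - q ^ (d z)` with `d` the degree of `v`, which brings in `ε` at `-d z`; its numerator at `z =
  -- 0` is a sum of class numbers over a full period, hence nonzero.
  refine ⟨fun z => (z * (zetaPolynomial k F (Y z) - classSeries v (Y z)) -
    N (U z) * ((-v.degree : ℂ)⁻¹ * ε (-v.degree * z))) / c, ?_, ?_, ?_⟩
  · refine ((analyticAt_id.fun_mul ((analyticAt_zetaPolynomial_comp hYa hY0).fun_sub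
      (analyticAt_classSeries_comp v hYa hY0
        (natCast_card_cpow_pow_degree_ne_one hF v (by simp))))).fun_sub
      ((analyticAt_classSeries_numerator v hUa (hU0.trans_ne one_ne_zero)).fun_mul
        (analyticAt_const.fun_mul hεa))).div_const
  · simp only [zero_mul, mul_zero, zero_sub, hU0]
    exact div_ne_zero (neg_ne_zero.2 (mul_ne_zero hN1
      (mul_ne_zero (inv_ne_zero (neg_ne_zero.2 hd)) hε0))) hc
  · intro z hz
    have h1 : ((Nat.card k : ℂ) * Y z)⁻¹ = U z := by
      rw [hY, hU]
      dsimp only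
      rw [inv_natCast_card_mul_cpow]
      congr 1
      ring
    have h2 : classSeries v (U z) = N (U z) * (z⁻¹ * ((-v.degree : ℂ)⁻¹ * ε (-v.degree * z))) := by
      have h3 := hεz (-v.degree * z) (mul_ne_zero (neg_ne_zero.2 hd) hz)
      have h4 : (Nat.card k : ℂ) ^ (-(-v.degree * z)) = U z ^ v.degree := by
        rw [hU, ← Complex.cpow_nat_mul]
        congr 1
        ring
      rw [h4, mul_inv] at h3
      rw [classSeries, periodicSeries, div_eq_mul_inv, h3]
      simp only [hN]
      ring
    rw [continuedZeta, rationalZeta]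
    change (zetaPolynomial k F (Y z) - classSeries v (Y z) -
      classSeries v ((Nat.card k : ℂ) * Y z)⁻¹) / c = _
    rw [h1, h2]
    field_simp

/-- Passing to the normal form does not change values at points of analyticity, in particular in the
half-plane of convergence. -/
theorem exists_isCompleteArtinZeta : ∃ f, IsCompleteArtinZeta k F f := by
  obtain ⟨v⟩ := nonempty hF
  have hm : MeromorphicOn (continuedZeta v) Set.univ :=
    fun s _ => meromorphic_continuedZeta hF v s
  refine ⟨toMeromorphicNFOn (continuedZeta v) Set.univ, meromorphicNFOn_toMeromorphicNFOn _ _,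
    fun s hs => ?_⟩
  have ha : AnalyticAt ℂ (continuedZeta v) s := analyticAt_continuedZeta hF v (by linarith) hs.ne'
  rw [toMeromorphicNFOn_eq_toMeromorphicNFAt hm (Set.mem_univ s),
    toMeromorphicNFAt_eq_self.2 ha.meromorphicNFAt, continuedZeta_eq hF v hs]

theorem isCompleteArtinZeta_completeArtinZeta : IsCompleteArtinZeta k F (completeArtinZeta k F) := by
  rw [completeArtinZeta, dif_pos (exists_isCompleteArtinZeta hF)]
  exact (exists_isCompleteArtinZeta hF).choose_spec

end Finite

end CurvePoint

/-! ### The complete Artin zeta function satisfies the abstract hypotheses; conclusion. -/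

open CurvePoint in
theorem isZetaLike_completeArtinZeta {k F : Type*} [Field k] [Field F] [Algebra k F] [Finite k]
    (hF : IsFunctionFieldOfOneVariable k F) : IsZetaLike (completeArtinZeta k F) := by
  obtain ⟨v⟩ := nonempty hF
  obtain ⟨hNF, hseries⟩ := isCompleteArtinZeta_completeArtinZeta hF
  have hmero : Meromorphic (completeArtinZeta k F) := fun s =>
    (hNF (Set.mem_univ s)).meromorphicAt
  have heq : ∀ s : ℂ, 1 < s.re → completeArtinZeta k F s = continuedZeta v s := fun s hs => by
    rw [hseries s hs, continuedZeta_eq hF v hs]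
  have hnhds : ∀ s : ℂ, 1 < s.re → completeArtinZeta k F =ᶠ[𝓝 s] continuedZeta v := fun s hs =>
    Filter.mem_of_superset ((isOpen_lt continuous_const Complex.continuous_re).mem_nhds hs) heq
  -- The chosen function is only known through its series for `1 < s.re`; the identity theorem
  -- transfers the functional equation and the pole from the rational expression.
  have hcod : ∀ᶠ s in codiscrete ℂ, completeArtinZeta k F s = continuedZeta v s :=
    hmero.eventuallyEq_codiscrete_of_eventuallyEq (meromorphic_continuedZeta hF v)
      (hnhds 2 (by norm_num))
  have hn : ∀ n : ℕ, 2 ≤ n → 1 < (n : ℂ).re := fun n h => by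
    rw [Complex.natCast_re]
    exact_mod_cast h
  refine ⟨hmero, ?_, fun n h => ?_, fun n h => ?_, ?_⟩
  · have h1 := hcod.comp_affine (a := -1) (b := 1) (by norm_num)
    filter_upwards [hcod, h1] with s h2 h3
    rw [show (1 : ℂ) - s = -1 * s + 1 by ring, h3, h2,
      show -1 * s + 1 = 1 - s by ring, continuedZeta_one_sub hF]
  · have h1 := hn n h
    exact (analyticAt_continuedZeta hF v (by linarith) h1.ne').congr (hnhds n h1).symm
  · rw [heq n (hn n h)]
    exact continuedZeta_natCast_ne_zero hF v h
  · obtain ⟨φ, hφ, hφ0, hφz⟩ := exists_continuedZeta_one_add hF v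
    refine ⟨φ, hφ, hφ0, ?_⟩
    have h1 := hcod.comp_affine (a := 1) (b := 1) one_ne_zero
    filter_upwards [eventually_codiscrete_iff.1 h1 0, self_mem_nhdsWithin] with z h2 h3
    rw [show (1 : ℂ) + z = 1 * z + 1 by ring, h2, show 1 * z + 1 = 1 + z by ring, hφz z h3]

theorem theorem4
    {k F : Type*} [Field k] [Finite k] [Field F] [Algebra k F]
    (hF : IsFunctionFieldOfOneVariable k F)
    {ι V N : Type*} [Fintype ι] [AddCommGroup V] [Module ℂ V] [AddCommGroup N] [Module ℂ N]
    (P : RootPairing ι ℂ V N) [P.IsRootSystem] [P.IsCrystallographic] [P.IsReduced]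
    (b : P.Base) (p : b.support)
    (l : List b.support) (hl : l.Nodup) (hlp : ∀ j, j ∈ l ↔ j ≠ p) :
    (∃! S : Multiset (ℂ × ℂ),
      b.IsMinimalClearing (Nat.card k) (completeArtinZeta k F) p l S) ∧
    ∀ S : Multiset (ℂ × ℂ),
      b.IsMinimalClearing (Nat.card k) (completeArtinZeta k F) p l S →
        Meromorphic (b.parabolicZeta (Nat.card k) (completeArtinZeta k F) p l S) ∧
        ∀ᶠ s in codiscrete ℂ,
          b.parabolicZeta (Nat.card k) (completeArtinZeta k F) p l S (-b.levelConstant p - s) =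
            b.parabolicZeta (Nat.card k) (completeArtinZeta k F) p l S s := by
  have hq : 2 ≤ Nat.card k := Finite.one_lt_card
  exact b.functionalEquation hq (isZetaLike_completeArtinZeta hF) p hl hlp
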